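/- Let $d\ge 2$ and $S\ge 0$, and let $Q=[0,1]^d$ with Lebesgue measure. For a function $f\colon Q\to\mathbb{R}$ let $\|f\|_\infty$ be its supremum norm and $\operatorname{Lip}(f)$ its least Lipschitz constant with respect to the Euclidean distance. For a Lipschitz map $\pi=(\pi^1,\dots,\pi^d)\colon Q\to\mathbb{R}^d$ let $\mathrm{D}\pi$ be its differential, which exists almost everywhere. Let $B_{L^\infty}=\{\rho\in L^\infty(Q):\|\rho\|_{L^\infty}\le 1\}$, equipped with the topology induced by the weak$^*$ topology of $L^\infty(Q)=L^1(Q)^*$. Consider the set $A_S\subset L^\infty(Q)$ of all functions $$\sum_{i\in\mathbb{N}} f_i\det\mathrm{D}\pi_i$$ (the series converging absolutely in $L^\infty(Q)$), where $f_i\colon Q\to\mathbb{R}$ and $\pi_i\colon Q\to\mathbb{R}^d$, $i\in\mathbb{N}$, are Lipschitz maps with $$\sum_{i\in\mathbb{N}}\max\{\|f_i\|_\infty,\operatorname{Lip}(f_i)\}\prod_{j=1}^d\operatorname{Lip}(\pi_i^j)\le S.$$ Then $A_S\cap B_{L^\infty}$ is weak$^*$ nowhere dense in $B_{L^\infty}$,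 that is, its closure in $B_{L^\infty}$ with respect to this topology has empty interior in $B_{L^\infty}$. -/

import Mathlib

open MeasureTheory
open scoped ENNReal NNReal

noncomputable section

namespace LipJac

/-- The unit cube `[0,1]^d` in Euclidean space `ℝ^d`. -/
def cube (d : ℕ) : Set (EuclideanSpace ℝ (Fin d)) :=
  {x | ∀ i, x i ∈ Set.Icc (0 : ℝ) 1}

/-- Lebesgue measure on `[0,1]^d`. -/
def cubeMeasure (d : ℕ) : Measure (EuclideanSpace ℝ (Fin d)) :=
  volume.restrict (cube d)

/-- `L^∞([0,1]^d)`, with its norm. -/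
abbrev Linf (d : ℕ) : Type := Lp ℝ ∞ (cubeMeasure d)

/-- The weak* topology of `L^∞ = (L^1)^*`: the coarsest topology for which
`ρ ↦ ∫ u ρ` is continuous for every `u ∈ L^1([0,1]^d)`. -/
abbrev weakStar (d : ℕ) : TopologicalSpace (Linf d) :=
  ⨅ u : Lp ℝ 1 (cubeMeasure d),
    TopologicalSpace.induced (fun ρ : Linf d => ∫ x, u x * ρ x ∂(cubeMeasure d)) inferInstance

/-- `f` is Lipschitz on `[0,1]^d` (with respect to the Euclidean distance). -/
def IsLip {d : ℕ} (f : EuclideanSpace ℝ (Fin d) → ℝ) : Prop :=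
  ∃ K : ℝ≥0, LipschitzOnWith K f (cube d)

/-- The least Lipschitz constant `Lip(f)` of `f` on `[0,1]^d` (`∞` if `f` is not Lipschitz). -/
def lip {d : ℕ} (f : EuclideanSpace ℝ (Fin d) → ℝ) : ℝ≥0∞ :=
  ⨅ (K : ℝ≥0) (_ : LipschitzOnWith K f (cube d)), (K : ℝ≥0∞)

/-- The supremum norm of `f` on `[0,1]^d`. -/
def supNorm {d : ℕ} (f : EuclideanSpace ℝ (Fin d) → ℝ) : ℝ≥0∞ :=
  ⨆ x ∈ cube d, ‖f x‖ₑ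

/-- The function `f · det Dπ` on `[0,1]^d`. Only the values of `f` and `π` on the cube matter. For
Lipschitz `π` the differential exists at almost every point, and in the interior of the cube it is
the differential at that point of any Lipschitz extension of `π`. -/
def jacTerm {d : ℕ} (f : EuclideanSpace ℝ (Fin d) → ℝ)
    (π : EuclideanSpace ℝ (Fin d) → EuclideanSpace ℝ (Fin d)) :
    EuclideanSpace ℝ (Fin d) → ℝ :=
  fun x => f x * (fderivWithin ℝ π (cube d) x).det

/-- The set of all `∑ i, f i · det D(π i)`, the sum being taken in the Banach space `L^∞`, over
sequences of Lipschitz `f i : [0,1]^d → ℝ` and `π i : [0,1]^d → ℝ^d` such that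
`∑ i, max (‖f i‖_∞) (Lip (f i)) · ∏ j, Lip (π i ^ j) ≤ S`. -/
def jacSums (d : ℕ) (S : ℝ) : Set (Linf d) :=
  {ρ | ∃ (f : ℕ → EuclideanSpace ℝ (Fin d) → ℝ)
      (π : ℕ → EuclideanSpace ℝ (Fin d) → EuclideanSpace ℝ (Fin d)),
      (∀ i, IsLip (f i)) ∧
      (∀ i j, IsLip (fun x => π i x j)) ∧
      ∑' i, max (supNorm (f i)) (lip (f i)) * ∏ j, lip (fun x => π i x j) ≤ ENNReal.ofReal S ∧
      ∃ g : ℕ → Linf d, (∀ i, g i =ᵐ[cubeMeasure d] jacTerm (f i) (π i)) ∧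
        (Summable fun i => ‖g i‖) ∧ HasSum g ρ}

end LipJac

end

noncomputable section

namespace LipJac

/-! The heart is `exists_almost_orthogonal`: for every `ε > 0` there are a bounded `u`, vanishing
off the interior of the cube, and a `g` with `|g| ≤ 1`, such that `|∫ u f det Dp| ≤ ε ∫ u g` for all
normalized Lipschitz `f` and `p`. By linearity the functional given by `u` is then small on all of
`jacSums d S` compared to its value at `g`, and so it is on the weak* closure. If this closure had
an interior point `b`, a slight move from `b` towards `g` would stay in it but make the functional
too large (`isNowhereDense_of_functionals`).

The function `u` is a sum over `K` widely separated scales of `bump * weight * wave`. The `k`-th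
wave oscillates in `x j` with half period `h = step N k`; the `k`-th weight is a Riesz product in
the other variable `x i`, which is where `d ≥ 2` enters. All weights have nearly the same mass, but
each lives where the previous factors do not vanish.

Upper bound: in the `k`-th term replace `p` by its average over translates by multiples of `h` along
the `j`-th axis. The Jacobian of the average is almost `h`-periodic, hence almost orthogonal to the
wave, which changes sign under that translation (`abs_integral_oscillating_mul_jac_le`). The error
of the replacement is integrated by parts, so that it only involves `p` minus its average
(`abs_integral_mul_jac_sub_le`, which rests on `integral_jac_eq_zero`). That distance is controlled
by second differences at scale `h`, and these by the drop of the weighted energy of difference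
quotients from scale `h` to `2 * h` (`integral_abs_sub_avg_le`). Energies grow, up to small errors,
as the scale decreases and stay bounded, so the drops have a sum bounded independently of `K`
(`sum_energy_drop_le`). Hence the pairing of `u` with Jacobians is `o(K)`.

Lower bound: the sets on which a given weight is the last nonzero one are disjoint, and each carries
about a third of the mass of its weight. Taking for `g` the `k`-th wave on the `k`-th set gives `∫ u
g` of order `K` (`integral_testFun_mul_pairing_ge`). `exists_parameters` balances the two bounds. -/

/-- The Euclidean space `ℝ^d`. -/
abbrev Euc (d : ℕ) : Type := EuclideanSpace ℝ (Fin d)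

/-! ### Change of variables for Lipschitz perturbations of the identity. -/

/-- A Lipschitz self-map of `ℝ^d` maps null sets to null sets. -/
lemma volume_image_eq_zero_of_lipschitz {d : ℕ} {f : Euc d → Euc d} {K : ℝ≥0}
    (hf : LipschitzWith K f) {s : Set (Euc d)} (hs : volume s = 0) : volume (f '' s) = 0 := by
  have hI : (μH[(Module.finrank ℝ (Euc d) : ℝ)] : Measure (Euc d)).IsAddHaarMeasure :=
    isAddHaarMeasure_hausdorffMeasure
  -- Top-dimensional Hausdorff measure and volume are multiples of each other. Both directions are
  -- used: nullity passes to Hausdorff measure, where Lipschitz images are controlled, and back.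
  have h1 := Measure.isAddLeftInvariant_eq_smul
    (μH[(Module.finrank ℝ (Euc d) : ℝ)] : Measure (Euc d)) (volume : Measure (Euc d))
  have h2 := Measure.isAddLeftInvariant_eq_smul (volume : Measure (Euc d))
    (μH[(Module.finrank ℝ (Euc d) : ℝ)] : Measure (Euc d))
  have h3 : μH[(Module.finrank ℝ (Euc d) : ℝ)] s = 0 := by
    rw [h1, Measure.smul_apply, hs, smul_zero]
  have h4 : μH[(Module.finrank ℝ (Euc d) : ℝ)] (f '' s) = 0 := by
    have := (hf.lipschitzOnWith (s := s)).hausdorffMeasure_image_le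
      (d := (Module.finrank ℝ (Euc d) : ℝ)) (by positivity)
    rw [h3, mul_zero] at this
    exact le_antisymm this bot_le
  rw [h2, Measure.smul_apply, h4, smul_zero]

/-- Along the segment from `1` to `1 + A` all maps are invertible by the Neumann series, so the
determinant cannot change sign. -/
lemma det_one_add_pos {d : ℕ} (A : Euc d →L[ℝ] Euc d) (hA : ‖A‖ < 1) :
    0 < (1 + A).det := by
  have hne : ∀ s ∈ Set.Icc (0 : ℝ) 1, (1 + s • A).det ≠ 0 := by
    intro s hs
    have h1 : ‖-(s • A)‖ < 1 := by
      rw [norm_neg, norm_smul, Real.norm_of_nonneg hs.1]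
      nlinarith [hs.1, hs.2, norm_nonneg A]
    have h2 : IsUnit (1 - -(s • A)) := isUnit_one_sub_of_norm_lt_one h1
    rw [sub_neg_eq_add] at h2
    have h3 : IsUnit ((1 + s • A : Euc d →L[ℝ] Euc d) : Euc d →ₗ[ℝ] Euc d) := by
      obtain ⟨u, hu⟩ := h2
      refine ⟨⟨(u.1 : Euc d →L[ℝ] Euc d), (u.2 : Euc d →L[ℝ] Euc d), ?_, ?_⟩, ?_⟩
      · ext1 x
        exact DFunLike.congr_fun u.3 x
      · ext1 x
        exact DFunLike.congr_fun u.4 x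
      · rw [← hu]
    exact (LinearMap.isUnit_iff_isUnit_det _).1 h3 |>.ne_zero
  by_contra hcon
  push Not at hcon
  have hc : ContinuousOn (fun s : ℝ => (1 + s • A).det) (Set.Icc 0 1) := by
    apply Continuous.continuousOn
    exact ContinuousLinearMap.continuous_det.comp (by fun_prop)
  have := intermediate_value_Icc' (zero_le_one' ℝ) hc
  have h0 : (0 : ℝ) ∈ Set.Icc ((1 + (1 : ℝ) • A).det) ((1 + (0 : ℝ) • A).det) := by
    constructor
    · simpa using hcon
    · simp [ContinuousLinearMap.det]
  obtain ⟨s, hs, hs0⟩ := this h0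
  exact hne s hs hs0

/-- A Lipschitz perturbation of the identity, supported in a ball and with small constant,
preserves the volume of this ball. -/
lemma setIntegral_det_one_add {d : ℕ} {φ : Euc d → Euc d} {K : ℝ≥0} (hφ : LipschitzWith K φ)
    (hK : K < 1) {R : ℝ} (hR : ∀ x, x ∉ Metric.closedBall (0 : Euc d) R → φ x = 0) :
    ∫ x in Metric.closedBall (0 : Euc d) R, (1 + fderiv ℝ φ x).det =
      volume.real (Metric.closedBall (0 : Euc d) R) := by
  set B := Metric.closedBall (0 : Euc d) R
  set f : Euc d → Euc d := fun x => x + φ x with hf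
  have happ : ApproximatesLinearOn f ((ContinuousLinearEquiv.refl ℝ (Euc d) :
      Euc d →L[ℝ] Euc d)) Set.univ K := by
    rw [ApproximatesLinearOn.approximatesLinearOn_iff_lipschitzOnWith]
    have : (f - ⇑((ContinuousLinearEquiv.refl ℝ (Euc d) : Euc d →L[ℝ] Euc d))) = φ := by
      ext1 x; simp [hf]
    rw [this]
    exact hφ.lipschitzOnWith
  have hcond : Subsingleton (Euc d) ∨ K < ‖((ContinuousLinearEquiv.refl ℝ (Euc d)).symm :
      Euc d →L[ℝ] Euc d)‖₊⁻¹ := by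
    rcases subsingleton_or_nontrivial (Euc d) with h | h
    · exact Or.inl h
    · right
      have : ‖((ContinuousLinearEquiv.refl ℝ (Euc d)).symm : Euc d →L[ℝ] Euc d)‖₊ = 1 := by
        ext
        simp
      rw [this]; simpa using hK
  have hinj : Function.Injective f := Set.injOn_univ.1 (happ.injOn hcond)
  have hsurj : Function.Surjective f := happ.surjective hcond
  -- Outside `B` the map `f` is the identity. A point of `B` sent outside would have the same image
  -- as that outside point, against injectivity.
  have hfB : f '' B = B := by
    ext y
    constructor
    · rintro ⟨x, hx, rfl⟩
      by_contra hy
      have h1 : f (f x) = f x := by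
        change f x + φ (f x) = f x
        rw [hR _ hy, add_zero]
      exact hy (by rw [hinj h1]; exact hx)
    · intro hy
      obtain ⟨x, rfl⟩ := hsurj y
      by_cases hx : x ∈ B
      · exact ⟨x, hx, rfl⟩
      · exfalso
        apply hx
        have : f x = x := by change x + φ x = x; rw [hR _ hx, add_zero]
        rwa [this] at hy
  have hfl : LipschitzWith (1 + K) f := LipschitzWith.id.add hφ
  have hBm : MeasurableSet B := Metric.isClosed_closedBall.measurableSet
  -- The area formula needs a derivative at every point. The discarded set is null by Rademacher,
  -- and so is its image.
  set S : Set (Euc d) := B ∩ {x | DifferentiableAt ℝ φ x} with hS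
  have hSm : MeasurableSet S := hBm.inter (measurableSet_of_differentiableAt ℝ φ)
  have hae : ∀ᵐ x ∂(volume : Measure (Euc d)), DifferentiableAt ℝ φ x := hφ.ae_differentiableAt
  have hnull : volume (B \ S) = 0 := by
    refine measure_mono_null ?_ (ae_iff.1 hae)
    intro x hx
    simp only [hS, Set.mem_sdiff, Set.mem_inter_iff, Set.mem_ofPred_eq, not_and] at hx
    exact hx.2 hx.1
  have hvol : volume (f '' S) = volume B := by
    apply le_antisymm
    · rw [← hfB]
      exact measure_mono (Set.image_mono Set.inter_subset_left)
    · have hsub : B ⊆ f '' S ∪ f '' (B \ S) := by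
        rw [← Set.image_union, Set.union_sdiff_cancel Set.inter_subset_left, hfB]
      calc volume B ≤ volume (f '' S ∪ f '' (B \ S)) := measure_mono hsub
        _ ≤ volume (f '' S) + volume (f '' (B \ S)) := measure_union_le _ _
        _ = volume (f '' S) := by
            rw [volume_image_eq_zero_of_lipschitz hfl hnull, add_zero]
  have hder : ∀ x ∈ S, HasFDerivWithinAt f (1 + fderiv ℝ φ x) S x := by
    intro x hx
    exact ((hasFDerivAt_id x).add hx.2.hasFDerivAt).hasFDerivWithinAt
  have harea := integral_image_eq_integral_abs_det_fderiv_smul volume hSm hder hinj.injOn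
    (fun _ => (1 : ℝ))
  have hpos : ∀ x, |(1 + fderiv ℝ φ x).det| = (1 + fderiv ℝ φ x).det := by
    intro x
    apply abs_of_pos
    apply det_one_add_pos
    exact lt_of_le_of_lt (norm_fderiv_le_of_lipschitz ℝ hφ) (by exact_mod_cast hK)
  simp only [smul_eq_mul, mul_one, hpos] at harea
  have hSB : S =ᵐ[volume] B := by
    refine ae_eq_set.2 ⟨?_, hnull⟩
    rw [Set.sdiff_eq_empty.2 Set.inter_subset_left, measure_empty]
  rw [← setIntegral_congr_set hSB, ← harea]
  simp [Measure.real, hvol]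

/-! ### Jacobians in coordinates and their vanishing integrals. -/

/-- The gradient of `φ` at `x`, in coordinates. -/
def grad {d : ℕ} (φ : Euc d → ℝ) (x : Euc d) : Fin d → ℝ :=
  fun j => fderiv ℝ φ x (EuclideanSpace.single j 1)

/-- The Jacobian determinant of the map with components `g i`. -/
def jac {d : ℕ} (g : Fin d → Euc d → ℝ) (x : Euc d) : ℝ :=
  Matrix.detRowAlternating (fun i => grad (g i) x)

lemma det_fderiv_eq_jac {d : ℕ} {π : Euc d → Euc d} {x : Euc d} (h : DifferentiableAt ℝ π x) :
    (fderiv ℝ π x).det = jac (fun i y => π y i) x := by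
  have hb := LinearMap.det_toMatrix (EuclideanSpace.basisFun (Fin d) ℝ).toBasis
    (fderiv ℝ π x : Euc d →ₗ[ℝ] Euc d)
  rw [ContinuousLinearMap.det, ← hb]
  change _ = Matrix.det _
  congr 1
  ext i j
  have h1 : HasFDerivAt (fun y => π y i)
      ((EuclideanSpace.proj i : Euc d →L[ℝ] ℝ).comp (fderiv ℝ π x)) x :=
    (EuclideanSpace.proj i : Euc d →L[ℝ] ℝ).hasFDerivAt.comp x h.hasFDerivAt
  simp [LinearMap.toMatrix_apply, grad, h1.fderiv]

lemma abs_grad_le {d : ℕ} {φ : Euc d → ℝ} {K : ℝ≥0} (h : LipschitzWith K φ) (x : Euc d)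
    (j : Fin d) : |grad φ x j| ≤ K := by
  have h1 := (fderiv ℝ φ x).le_opNorm (EuclideanSpace.single j 1)
  rw [PiLp.norm_single, norm_one, mul_one] at h1
  exact h1.trans (norm_fderiv_le_of_lipschitz ℝ h)

lemma measurable_grad {d : ℕ} (φ : Euc d → ℝ) : Measurable (grad φ) := by
  rw [measurable_pi_iff]
  intro j
  exact measurable_fderiv_apply_const ℝ φ _

lemma abs_det_le {d : ℕ} (v : Fin d → Fin d → ℝ) (c : Fin d → ℝ) (h : ∀ i j, |v i j| ≤ c i) :
    |Matrix.detRowAlternating v| ≤ d.factorial * ∏ i, c i := by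
  have hv : Matrix.detRowAlternating v =
      ∑ σ : Equiv.Perm (Fin d), Equiv.Perm.sign σ • ∏ i, v i (σ i) :=
    (Matrix.det_transpose (Matrix.of v)).symm.trans (Matrix.det_apply _)
  rw [hv]
  refine (Finset.abs_sum_le_sum_abs _ _).trans ?_
  have : ∀ σ ∈ (Finset.univ : Finset (Equiv.Perm (Fin d))),
      |Equiv.Perm.sign σ • ∏ i, v i (σ i)| ≤
        ∏ i, c i := by
    intro σ _
    have h1 : |Equiv.Perm.sign σ • ∏ i, v i (σ i)| =
        ∏ i, |v i (σ i)| := by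
      rw [← Finset.abs_prod]
      rcases Int.units_eq_one_or (Equiv.Perm.sign σ) with h | h <;> simp [h]
    rw [h1]
    exact Finset.prod_le_prod (fun _ _ => abs_nonneg _) (fun i _ => h i _)
  refine (Finset.sum_le_sum this).trans ?_
  simp [Finset.card_univ, Fintype.card_perm]

lemma measurable_det {α : Type*} [MeasurableSpace α] {d : ℕ} {v : α → Fin d → Fin d → ℝ}
    (h : ∀ i, Measurable (fun a => v a i)) :
    Measurable (fun a => Matrix.detRowAlternating (v a)) := by
  have h' : ∀ i j, Measurable (fun a => v a i j) := fun i j => (measurable_pi_iff.1 (h i)) j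
  have : (fun a => Matrix.detRowAlternating (v a)) =
      fun a => ∑ σ : Equiv.Perm (Fin d), ((Equiv.Perm.sign σ : ℤ) : ℝ) * ∏ i, v a (σ i) i := by
    funext a
    exact Matrix.det_apply' _
  rw [this]
  fun_prop

lemma measurable_jac {d : ℕ} (g : Fin d → Euc d → ℝ) : Measurable (jac g) :=
  measurable_det fun i => measurable_grad (g i)

lemma abs_jac_le {d : ℕ} {g : Fin d → Euc d → ℝ} {K : Fin d → ℝ≥0}
    (hg : ∀ i, LipschitzWith (K i) (g i)) (x : Euc d) :
    |jac g x| ≤ d.factorial * ∏ i, (K i : ℝ) :=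
  abs_det_le _ _ fun i j => abs_grad_le (hg i) x j

/-- A polynomial with infinitely many roots vanishes. This isolates the top-degree coefficient, the
integral of the Jacobian, in the volume identity for `x + t φ(x)`. -/
lemma coeff_eq_zero_of_sum_pow {ι : Type*} (s : Finset ι) (e : ι → ℕ) (a : ι → ℝ) {t₀ : ℝ}
    (ht₀ : 0 < t₀) (h : ∀ t ∈ Set.Ioo 0 t₀, ∑ i ∈ s, t ^ e i * a i = 0) (n : ℕ) :
    ∑ i ∈ s with e i = n, a i = 0 := by
  let P : Polynomial ℝ := ∑ i ∈ s, Polynomial.monomial (e i) (a i)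
  have hP : P = 0 := by
    apply Polynomial.eq_zero_of_infinite_isRoot
    refine (Set.Ioo_infinite ht₀).mono ?_
    intro t ht
    change Polynomial.eval t P = 0
    rw [Polynomial.eval_finsetSum, ← h t ht]
    refine Finset.sum_congr rfl fun i _ => ?_
    rw [Polynomial.eval_monomial, mul_comm]
  have h1 : P.coeff n = ∑ i ∈ s with e i = n, a i := by
    rw [Polynomial.finsetSum_coeff, Finset.sum_filter]
    refine Finset.sum_congr rfl fun i _ => ?_
    rw [Polynomial.coeff_monomial]
  rw [← h1, hP, Polynomial.coeff_zero]

/-- The Jacobian of a compactly supported Lipschitz map has vanishing integral. -/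
lemma integral_jac_eq_zero_of_forall {d : ℕ} (hd : 0 < d) {g : Fin d → Euc d → ℝ} {K : ℝ≥0}
    (hg : ∀ i, LipschitzWith K (g i)) {R : ℝ}
    (hR : ∀ i x, x ∉ Metric.closedBall (0 : Euc d) R → g i x = 0) :
    ∫ x, jac g x = 0 := by
  set B := Metric.closedBall (0 : Euc d) R with hB
  let φ : Euc d → Euc d := fun x => WithLp.toLp 2 (fun i => g i x)
  obtain ⟨C, hφ⟩ : ∃ C : ℝ≥0, LipschitzWith C φ := by
    have h1 : LipschitzWith K (fun x i => g i x) := LipschitzWith.of_dist_le_mul fun x y =>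
      (dist_pi_le_iff (by positivity)).2 fun i => (hg i).dist_le_mul x y
    exact ⟨_, (PiLp.lipschitzWith_toLp 2 (fun _ : Fin d => ℝ)).comp h1⟩
  have hφR : ∀ x, x ∉ B → φ x = 0 := by
    intro x hx
    ext i
    simp [φ, hR i x hx]
  let I : Fin d → Fin d → ℝ := fun i j => if i = j then 1 else 0
  -- Multilinear expansion of `det (1 + t Dφ)`: the rows in `s` come from the identity, the others
  -- from the gradients and contribute one factor `t` each.
  let G : Finset (Fin d) → Euc d → ℝ := fun s x =>
    Matrix.detRowAlternating (s.piecewise I (fun i => grad (g i) x))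
  have hGm : ∀ s, Measurable (G s) := by
    intro s
    refine measurable_det fun i => ?_
    by_cases hi : i ∈ s
    · simp [hi]
    · simpa [hi] using measurable_grad (g i)
  have hGb : ∀ s x, |G s x| ≤ d.factorial * ∏ _i : Fin d, ((K : ℝ) + 1) := by
    intro s x
    refine abs_det_le _ _ fun i j => ?_
    by_cases hi : i ∈ s
    · simp only [Finset.piecewise_eq_of_mem _ _ _ hi]
      have : |I i j| ≤ 1 := by
        simp only [I]
        split_ifs <;> simp
      have := K.2
      linarith
    · simp only [Finset.piecewise_eq_of_notMem _ _ _ hi]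
      have := abs_grad_le (hg i) x j
      linarith
  have hBfin : volume B ≠ ∞ := measure_closedBall_lt_top.ne
  have hGi : ∀ s, IntegrableOn (G s) B := fun s =>
    Measure.integrableOn_of_bounded hBfin (hGm s).aestronglyMeasurable
      (Filter.Eventually.of_forall fun x => hGb s x)
  have hdet : ∀ t : ℝ, ∀ x, DifferentiableAt ℝ φ x →
      (1 + fderiv ℝ (fun y => t • φ y) x).det = ∑ s : Finset (Fin d), t ^ (sᶜ).card * G s x := by
    intro t x hx
    have hm : (1 + fderiv ℝ (fun y => t • φ y) x).det =
        Matrix.detRowAlternating (I + fun i => t • grad (g i) x) := by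
      have hb := LinearMap.det_toMatrix (EuclideanSpace.basisFun (Fin d) ℝ).toBasis
        ((1 + fderiv ℝ (fun y => t • φ y) x : Euc d →L[ℝ] Euc d) : Euc d →ₗ[ℝ] Euc d)
      rw [ContinuousLinearMap.det, ← hb]
      change _ = Matrix.det _
      congr 1
      ext i j
      have h1 : HasFDerivAt (g i)
          ((EuclideanSpace.proj i : Euc d →L[ℝ] ℝ).comp (fderiv ℝ φ x)) x :=
        (EuclideanSpace.proj i : Euc d →L[ℝ] ℝ).hasFDerivAt.comp x hx.hasFDerivAt
      have h2 : HasFDerivAt (fun y => t • φ y) (t • fderiv ℝ φ x) x := hx.hasFDerivAt.const_smul t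
      simp [LinearMap.toMatrix_apply, grad, h1.fderiv, h2.fderiv, I]
    rw [hm]
    have := (Matrix.detRowAlternating (R := ℝ) (n := Fin d)).toMultilinearMap.map_add_univ I
      (fun i => t • grad (g i) x)
    refine this.trans (Finset.sum_congr rfl fun s _ => ?_)
    have h3 := (Matrix.detRowAlternating (R := ℝ) (n := Fin d)).toMultilinearMap.map_piecewise_smul
      (fun _ => t) (s.piecewise I (fun i => grad (g i) x)) sᶜ
    rw [Finset.prod_const, smul_eq_mul] at h3
    refine Eq.trans ?_ h3
    congr 1
    funext i
    by_cases hi : i ∈ s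
    · simp [hi]
    · simp [hi]
  have hae : ∀ᵐ x ∂(volume : Measure (Euc d)), DifferentiableAt ℝ φ x := hφ.ae_differentiableAt
  have hkey : ∀ t ∈ Set.Ioo (0 : ℝ) (1 / (C + 1)),
      ∑ s ∈ Finset.univ.erase (Finset.univ : Finset (Fin d)),
        t ^ (sᶜ).card * ∫ x in B, G s x = 0 := by
    intro t ht
    have hC1 : (0 : ℝ) < C + 1 := by positivity
    have hlip : LipschitzWith (‖t‖₊ * C) (fun y => t • φ y) := (lipschitzWith_smul t).comp hφ
    have hlt : ‖t‖₊ * C < 1 := by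
      rw [← NNReal.coe_lt_coe]
      push_cast
      rw [Real.norm_of_nonneg ht.1.le]
      have := (lt_div_iff₀ hC1).1 ht.2
      nlinarith [ht.1]
    have h1 := setIntegral_det_one_add hlip hlt (R := R) (by
      intro x hx; rw [hφR x hx, smul_zero])
    have h2 : ∫ x in B, (1 + fderiv ℝ (fun y => t • φ y) x).det =
        ∑ s : Finset (Fin d), t ^ (sᶜ).card * ∫ x in B, G s x := by
      rw [integral_congr_ae (g := fun x => ∑ s : Finset (Fin d), t ^ (sᶜ).card * G s x)
        (by filter_upwards [ae_restrict_of_ae hae] with x hx using hdet t x hx)]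
      rw [integral_finsetSum _ (fun s _ => (hGi s).const_mul _)]
      exact Finset.sum_congr rfl fun s _ => integral_const_mul _ _
    rw [h1, ← Finset.add_sum_erase _ _ (Finset.mem_univ (Finset.univ : Finset (Fin d)))] at h2
    -- The constant term in `t` is the volume itself, so the remaining terms cancel for every small
    -- `t`.
    have h3 : ∫ x in B, G Finset.univ x = volume.real B := by
      have : ∀ x, G Finset.univ x = 1 := by
        intro x
        have : G Finset.univ x = Matrix.det (1 : Matrix (Fin d) (Fin d) ℝ) := by
          simp only [G, Finset.piecewise_univ]
          refine congrArg Matrix.det ?_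
          ext i j
          simp [I, Matrix.one_apply]
        rw [this, Matrix.det_one]
      simp [this]
    rw [h3] at h2
    simp only [Finset.compl_univ, Finset.card_empty, pow_zero, one_mul] at h2
    linarith
  -- Degree `d` is attained only by `s = ∅`, whose term is the Jacobian; `d > 0` ensures that `∅`
  -- was not the erased set.
  have hfin := coeff_eq_zero_of_sum_pow _ (fun s : Finset (Fin d) => (sᶜ).card)
    (fun s => ∫ x in B, G s x) (by positivity) hkey d
  have hfilter : ((Finset.univ.erase (Finset.univ : Finset (Fin d))).filter
      fun s => (sᶜ).card = d) = {∅} := by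
    ext s
    simp only [Finset.mem_filter, Finset.mem_erase, Finset.mem_univ, and_true,
      Finset.mem_singleton]
    constructor
    · rintro ⟨-, h⟩
      have : sᶜ = Finset.univ := by
        rw [← Finset.card_eq_iff_eq_univ, h, Fintype.card_fin]
      simpa using this
    · rintro rfl
      refine ⟨?_, by simp⟩
      intro h
      have := congrArg Finset.card h
      simp at this
      omega
  rw [hfilter, Finset.sum_singleton] at hfin
  have hG0 : ∀ x, G ∅ x = jac g x := by
    intro x
    simp [G, jac]
  simp only [hG0] at hfin
  rw [← hfin]
  symm
  refine setIntegral_eq_integral_of_forall_compl_eq_zero fun x hx => ?_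
  have hz : ∀ i, grad (g i) x = 0 := by
    intro i
    have : g i =ᶠ[nhds x] fun _ => 0 := by
      filter_upwards [Metric.isClosed_closedBall.isOpen_compl.mem_nhds hx] with y hy
      exact hR i y hy
    funext j
    simp [grad, this.fderiv_eq]
  simp only [jac, hz]
  exact Matrix.detRowAlternating.map_coord_zero ⟨0, hd⟩ rfl

/-- The bound on `g` is required only where `f` does not vanish, so cutoffs may be multiplied with
unbounded Lipschitz functions. In the splitting, `g` is evaluated at whichever of the two points has
`f ≠ 0`. -/
lemma lipschitzWith_mul {α : Type*} [PseudoMetricSpace α] {f g : α → ℝ} {Kf Kg A B : ℝ≥0}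
    (hf : LipschitzWith Kf f) (hg : LipschitzWith Kg g) (hA : ∀ x, |f x| ≤ A)
    (hB : ∀ x, f x ≠ 0 → |g x| ≤ B) : LipschitzWith (A * Kg + B * Kf) (fun x => f x * g x) := by
  have key : ∀ x y, f x ≠ 0 →
      |f x * g x - f y * g y| ≤ (A * Kg + B * Kf : ℝ≥0) * dist x y := by
    intro x y hx
    have h1 : f x * g x - f y * g y = (f x - f y) * g x + f y * (g x - g y) := by ring
    have h2 : |f x - f y| ≤ Kf * dist x y := hf.dist_le_mul x y
    have h3 : |g x - g y| ≤ Kg * dist x y := hg.dist_le_mul x y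
    rw [h1]
    calc |(f x - f y) * g x + f y * (g x - g y)|
        ≤ |f x - f y| * |g x| + |f y| * |g x - g y| := by
          rw [← abs_mul, ← abs_mul]; exact abs_add_le _ _
      _ ≤ (Kf * dist x y) * B + A * (Kg * dist x y) := by
          gcongr
          · exact hB x hx
          · exact hA y
      _ = _ := by push_cast; ring
  refine LipschitzWith.of_dist_le_mul fun x y => ?_
  rw [Real.dist_eq]
  by_cases hx : f x = 0
  · by_cases hy : f y = 0
    · simp only [hx, hy, zero_mul, sub_zero, abs_zero]
      positivity
    · rw [abs_sub_comm, dist_comm]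
      exact key y x hy
  · exact key x y hx

lemma integrable_of_bounded_of_support {d : ℕ} {F : Euc d → ℝ} (hF : Measurable F) {C R : ℝ}
    (hC : ∀ x, |F x| ≤ C) (hR : ∀ x, x ∉ Metric.closedBall (0 : Euc d) R → F x = 0) :
    Integrable F := by
  have h1 : IntegrableOn F (Metric.closedBall (0 : Euc d) R) :=
    Measure.integrableOn_of_bounded measure_closedBall_lt_top.ne hF.aestronglyMeasurable
      (Filter.Eventually.of_forall fun x => hC x)
  exact (integrableOn_iff_integrable_of_support_subset fun x hx => by
    by_contra h; exact hx (hR x h)).1 h1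

lemma grad_congr {d : ℕ} {φ ψ : Euc d → ℝ} {x : Euc d} (h : φ =ᶠ[nhds x] ψ) :
    grad φ x = grad ψ x := by
  funext j
  simp [grad, h.fderiv_eq]

lemma grad_eq_zero_of_notMem {d : ℕ} {φ : Euc d → ℝ} {s : Set (Euc d)} (hs : IsClosed s)
    (h : ∀ x, x ∉ s → φ x = 0) {x : Euc d} (hx : x ∉ s) : grad φ x = 0 := by
  have : φ =ᶠ[nhds x] fun _ => 0 := by
    filter_upwards [hs.isOpen_compl.mem_nhds hx] with y hy
    exact h y hy
  rw [grad_congr this]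
  funext j
  simp [grad]

lemma jac_update {d : ℕ} (g : Fin d → Euc d → ℝ) (i : Fin d) (φ : Euc d → ℝ) (x : Euc d) :
    jac (Function.update g i φ) x =
      Matrix.detRowAlternating (Function.update (fun j => grad (g j) x) i (grad φ x)) := by
  unfold jac
  congr 1
  funext j
  rcases eq_or_ne j i with rfl | h
  · simp
  · simp [h]

/-- The Jacobian of a Lipschitz map one of whose components is compactly supported has vanishing
integral. -/
lemma integral_jac_eq_zero {d : ℕ} {g : Fin d → Euc d → ℝ} {K : ℝ≥0}
    (hg : ∀ i, LipschitzWith K (g i)) (i₀ : Fin d) {R : ℝ}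
    (hR : ∀ x, x ∉ Metric.closedBall (0 : Euc d) R → g i₀ x = 0) :
    ∫ x, jac g x = 0 := by
  have hd : 0 < d := i₀.pos
  -- Multiplying every component by this cutoff does not change the Jacobian: near the ball of
  -- radius `R` the cutoff is `1`, and off that ball the row `i₀` vanishes both before and after.
  let θ : Euc d → ℝ := fun x => max 0 (min 1 (R + 2 - ‖x‖))
  have hθl : LipschitzWith 1 θ := by
    have h1 : LipschitzWith 1 (fun x : Euc d => R + 2 - ‖x‖) := by
      refine LipschitzWith.of_dist_le_mul fun x y => ?_
      rw [Real.dist_eq, NNReal.coe_one, one_mul]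
      have : R + 2 - ‖x‖ - (R + 2 - ‖y‖) = ‖y‖ - ‖x‖ := by ring
      rw [this, abs_sub_comm, dist_eq_norm]
      exact abs_norm_sub_norm_le x y
    exact (h1.const_min 1).const_max 0
  have hθb : ∀ x, |θ x| ≤ (1 : ℝ≥0) := by
    intro x
    rw [abs_of_nonneg (le_max_left _ _)]
    exact max_le zero_le_one (min_le_left _ _)
  have hθ0 : ∀ x, x ∉ Metric.closedBall (0 : Euc d) (R + 2) → θ x = 0 := by
    intro x hx
    rw [mem_closedBall_zero_iff, not_le] at hx
    apply max_eq_left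
    exact (min_le_right _ _).trans (by linarith)
  have hθ1 : ∀ x, x ∈ Metric.ball (0 : Euc d) (R + 1) → θ x = 1 := by
    intro x hx
    rw [mem_ball_zero_iff] at hx
    change max 0 (min 1 (R + 2 - ‖x‖)) = 1
    rw [min_eq_left (by linarith), max_eq_right zero_le_one]
  have hbd : ∃ B : ℝ≥0, ∀ i x, x ∈ Metric.closedBall (0 : Euc d) (R + 2) → |g i x| ≤ B := by
    have : ∀ i, ∃ B : ℝ, ∀ x ∈ Metric.closedBall (0 : Euc d) (R + 2), ‖g i x‖ ≤ B := fun i =>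
      (isCompact_closedBall _ _).exists_bound_of_continuousOn (hg i).continuous.continuousOn
    choose B hB using this
    refine ⟨(∑ i, |B i|).toNNReal, fun i x hx => ?_⟩
    rw [Real.coe_toNNReal _ (Finset.sum_nonneg fun _ _ => abs_nonneg _)]
    exact ((hB i x hx).trans (le_abs_self _)).trans
      (Finset.single_le_sum (f := fun i => |B i|) (fun _ _ => abs_nonneg _) (Finset.mem_univ i))
  obtain ⟨B, hB⟩ := hbd
  have hl : ∀ i, LipschitzWith (1 * K + B * 1) (fun x => θ x * g i x) := fun i =>
    lipschitzWith_mul hθl (hg i) hθb fun x hx => hB i x (by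
      by_contra h
      exact hx (hθ0 x h))
  have h0 := integral_jac_eq_zero_of_forall hd hl (R := R + 2) (by
    intro i x hx
    simp [hθ0 x hx])
  rw [← h0]
  congr 1
  funext x
  by_cases hx : x ∈ Metric.closedBall (0 : Euc d) R
  · unfold jac
    congr 1
    funext i
    apply grad_congr
    have hx' : x ∈ Metric.ball (0 : Euc d) (R + 1) := by
      rw [mem_closedBall_zero_iff] at hx
      rw [mem_ball_zero_iff]; linarith
    filter_upwards [Metric.isOpen_ball.mem_nhds hx'] with y hy
    rw [hθ1 y hy, one_mul]
  · have h1 : grad (g i₀) x = 0 := grad_eq_zero_of_notMem Metric.isClosed_closedBall hR hx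
    have h2 : grad (fun x => θ x * g i₀ x) x = 0 :=
      grad_eq_zero_of_notMem Metric.isClosed_closedBall (fun y hy => by
        rw [hR y hy, mul_zero]) hx
    unfold jac
    rw [Matrix.detRowAlternating.map_coord_zero i₀ h1,
      Matrix.detRowAlternating.map_coord_zero i₀ h2]

/-! ### Integration by parts and weak continuity of Jacobians. -/

lemma grad_mul {d : ℕ} {φ ψ : Euc d → ℝ} {x : Euc d} (hφ : DifferentiableAt ℝ φ x)
    (hψ : DifferentiableAt ℝ ψ x) :
    grad (fun y => φ y * ψ y) x = φ x • grad ψ x + ψ x • grad φ x := by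
  funext j
  simp [grad, fderiv_fun_mul hφ hψ]

lemma grad_sub {d : ℕ} {φ ψ : Euc d → ℝ} {x : Euc d} (hφ : DifferentiableAt ℝ φ x)
    (hψ : DifferentiableAt ℝ ψ x) :
    grad (fun y => φ y - ψ y) x = grad φ x - grad ψ x := by
  funext j
  simp [grad, fderiv_fun_sub hφ hψ]

/-- Integration by parts for Jacobians of Lipschitz maps. -/
lemma integral_mul_jac_update {d : ℕ} {g : Fin d → Euc d → ℝ} {K Kη Kψ A P : ℝ≥0}
    (hg : ∀ i, LipschitzWith K (g i)) (i : Fin d) {η ψ : Euc d → ℝ} (hη : LipschitzWith Kη η)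
    (hψ : LipschitzWith Kψ ψ) (hηb : ∀ x, |η x| ≤ A) (hψb : ∀ x, |ψ x| ≤ P) {R : ℝ}
    (hR : ∀ x, x ∉ Metric.closedBall (0 : Euc d) R → η x = 0) :
    ∫ x, η x * jac (Function.update g i ψ) x =
      -∫ x, ψ x * jac (Function.update g i η) x := by
  have hlip : ∀ {φ : Euc d → ℝ} {Kφ : ℝ≥0}, LipschitzWith Kφ φ → ∀ j,
      LipschitzWith (K + Kφ) (Function.update g i φ j) := by
    intro φ Kφ hφ j
    rcases eq_or_ne j i with rfl | h
    · simpa using hφ.weaken le_add_self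
    · simpa [h] using (hg j).weaken le_self_add
  have hηψ : LipschitzWith (A * Kψ + P * Kη) (fun x => η x * ψ x) :=
    lipschitzWith_mul hη hψ hηb fun x _ => hψb x
  -- With `η * ψ` as the `i`-th component, the product rule splits the null integral into the two
  -- sides of the identity.
  have h0 := integral_jac_eq_zero (hlip hηψ) i (R := R) (by
    intro x hx
    simp [hR x hx])
  have hae : ∀ᵐ x ∂(volume : Measure (Euc d)), jac (Function.update g i fun x => η x * ψ x) x =
      η x * jac (Function.update g i ψ) x + ψ x * jac (Function.update g i η) x := by
    filter_upwards [hη.ae_differentiableAt, hψ.ae_differentiableAt] with x hx1 hx2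
    rw [jac_update, jac_update, jac_update, grad_mul hx1 hx2,
      AlternatingMap.map_update_add, AlternatingMap.map_update_smul,
      AlternatingMap.map_update_smul, smul_eq_mul, smul_eq_mul]
  have hi1 : Integrable (fun x => η x * jac (Function.update g i ψ) x) := by
    refine integrable_of_bounded_of_support (R := R)
      (C := A * (d.factorial * ∏ _j : Fin d, ((K + Kψ : ℝ≥0) : ℝ)))
      (hη.continuous.measurable.mul (measurable_jac _)) ?_ ?_
    · intro x
      rw [abs_mul]
      gcongr
      · exact hηb x
      · exact abs_jac_le (hlip hψ) x
    · intro x hx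
      rw [hR x hx, zero_mul]
  have hi2 : Integrable (fun x => ψ x * jac (Function.update g i η) x) := by
    refine integrable_of_bounded_of_support (R := R)
      (C := P * (d.factorial * ∏ _j : Fin d, ((K + Kη : ℝ≥0) : ℝ)))
      (hψ.continuous.measurable.mul (measurable_jac _)) ?_ ?_
    · intro x
      rw [abs_mul]
      gcongr
      · exact hψb x
      · exact abs_jac_le (hlip hη) x
    · intro x hx
      rw [jac_update, grad_eq_zero_of_notMem Metric.isClosed_closedBall hR hx,
        Matrix.detRowAlternating.map_coord_zero i (by simp), mul_zero]
  rw [integral_congr_ae hae, integral_add hi1 hi2] at h0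
  linarith

/-- Telescoping: the rows of `b` are replaced by those of `a` one at a time. -/
lemma detRow_sub {d : ℕ} (a b : Fin d → Fin d → ℝ) :
    Matrix.detRowAlternating a - Matrix.detRowAlternating b =
      ∑ i, Matrix.detRowAlternating
        (Function.update (fun j => if j < i then a j else b j) i (a i - b i)) := by
  have := (Matrix.detRowAlternating (R := ℝ) (n := Fin d)).toMultilinearMap
    |>.map_piecewise_sub_map_piecewise a b 0 Finset.univ
  simp only [Finset.piecewise_univ, Finset.mem_univ] at this
  refine this.trans (Finset.sum_congr rfl fun i _ => ?_)
  change Matrix.detRowAlternating _ = _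
  congr 1
  funext j
  rcases eq_or_ne j i with rfl | h
  · simp
  · simp [h]

lemma abs_detRow_sub_le {d : ℕ} (a b : Fin d → Fin d → ℝ) {δ : ℝ}
    (ha : ∀ i j, |a i j| ≤ 1) (hb : ∀ i j, |b i j| ≤ 1) (hab : ∀ i j, |a i j - b i j| ≤ δ) :
    |Matrix.detRowAlternating a - Matrix.detRowAlternating b| ≤ d * (d.factorial * δ) := by
  rw [detRow_sub]
  refine (Finset.abs_sum_le_sum_abs _ _).trans ?_
  have : ∀ i ∈ (Finset.univ : Finset (Fin d)), |Matrix.detRowAlternating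
        (Function.update (fun j => if j < i then a j else b j) i (a i - b i))| ≤
        d.factorial * δ := by
    intro i _
    refine (abs_det_le _ (Function.update (fun _ => 1) i δ) ?_).trans ?_
    · intro j l
      rcases eq_or_ne j i with rfl | h
      · simpa using hab j l
      · simp only [Function.update_of_ne h]
        split_ifs
        · exact ha j l
        · exact hb j l
    · rw [Finset.prod_update_of_mem (Finset.mem_univ i)]
      simp
  refine (Finset.sum_le_sum this).trans ?_
  simp

/-- Weak continuity of Jacobians: two Lipschitz maps that are uniformly close have close
Jacobians when tested against Lipschitz functions. -/
lemma abs_integral_mul_jac_sub_le {d : ℕ} {g k : Fin d → Euc d → ℝ}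
    (hg : ∀ i, LipschitzWith 1 (g i)) (hk : ∀ i, LipschitzWith 1 (k i)) {P A Kη : ℝ≥0}
    (hP : ∀ i x, |g i x - k i x| ≤ P) {η : Euc d → ℝ} (hη : LipschitzWith Kη η)
    (hηb : ∀ x, |η x| ≤ A) {R : ℝ}
    (hR : ∀ x, x ∉ Metric.closedBall (0 : Euc d) R → η x = 0) {Γ : Euc d → ℝ}
    (hΓ : Integrable Γ) (hηΓ : ∀ᵐ x ∂(volume : Measure (Euc d)), ∀ j, |grad η x j| ≤ Γ x) :
    |∫ x, η x * (jac g x - jac k x)| ≤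
      d.factorial * ∑ i, ∫ x, |g i x - k i x| * Γ x := by
  -- The hybrid maps of the telescoping sum; in the `i`-th one only the component `i` carries the
  -- difference `g i - k i`.
  let f : Fin d → Fin d → Euc d → ℝ := fun i j => if j < i then g j else k j
  have hf : ∀ i j, LipschitzWith 1 (f i j) := by
    intro i j
    simp only [f]
    split_ifs
    · exact hg j
    · exact hk j
  let ψ : Fin d → Euc d → ℝ := fun i x => g i x - k i x
  have hψ : ∀ i, LipschitzWith (1 + 1) (ψ i) := fun i => (hg i).sub (hk i)
  have hae : ∀ᵐ x ∂(volume : Measure (Euc d)), η x * (jac g x - jac k x) =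
      ∑ i, η x * jac (Function.update (f i) i (ψ i)) x := by
    have h1 : ∀ᵐ x ∂(volume : Measure (Euc d)), ∀ i, DifferentiableAt ℝ (g i) x :=
      ae_all_iff.2 fun i => (hg i).ae_differentiableAt
    have h2 : ∀ᵐ x ∂(volume : Measure (Euc d)), ∀ i, DifferentiableAt ℝ (k i) x :=
      ae_all_iff.2 fun i => (hk i).ae_differentiableAt
    filter_upwards [h1, h2] with x hx1 hx2
    rw [← Finset.mul_sum]
    congr 1
    unfold jac
    rw [detRow_sub]
    refine Finset.sum_congr rfl fun i _ => ?_
    congr 1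
    funext j
    rcases eq_or_ne j i with rfl | h
    · simp [ψ, grad_sub (hx1 j) (hx2 j)]
    · simp only [Function.update_of_ne h, f]
      split_ifs <;> rfl
  have hlip : ∀ i j, LipschitzWith 2 (Function.update (f i) i (ψ i) j) := by
    intro i j
    rcases eq_or_ne j i with rfl | h
    · have := hψ j
      simp only [Function.update_self]
      exact this.weaken (by norm_num)
    · simp only [Function.update_of_ne h]
      exact (hf i j).weaken (by norm_num)
  have hi : ∀ i, Integrable (fun x => η x * jac (Function.update (f i) i (ψ i)) x) := by
    intro i
    refine integrable_of_bounded_of_support (R := R)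
      (C := A * (d.factorial * ∏ _j : Fin d, ((2 : ℝ≥0) : ℝ)))
      (hη.continuous.measurable.mul (measurable_jac _)) ?_ ?_
    · intro x
      rw [abs_mul]
      gcongr
      · exact hηb x
      · exact abs_jac_le (hlip i) x
    · intro x hx
      rw [hR x hx, zero_mul]
  rw [integral_congr_ae hae, integral_finsetSum _ (fun i _ => hi i), Finset.mul_sum]
  refine (Finset.abs_sum_le_sum_abs _ _).trans (Finset.sum_le_sum fun i _ => ?_)
  -- The derivative moves from `g i - k i`, which is only uniformly small, to the test function `η`.
  rw [integral_mul_jac_update (hf i) i hη (hψ i) hηb (hP i) hR, abs_neg, ← integral_const_mul]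
  have hψi : Integrable (fun x => |ψ i x| * Γ x) := by
    refine hΓ.bdd_mul (c := P) (hψ i).continuous.abs.aestronglyMeasurable
      (Filter.Eventually.of_forall fun x => ?_)
    rw [Real.norm_eq_abs, abs_abs]
    exact hP i x
  refine (abs_integral_le_integral_abs).trans (integral_mono_of_nonneg
    (Filter.Eventually.of_forall fun x => abs_nonneg _) (hψi.const_mul _) ?_)
  filter_upwards [hηΓ] with x hx
  rw [abs_mul, jac_update]
  have h1 : |Matrix.detRowAlternating (Function.update (fun j => grad (f i j) x) i (grad η x))| ≤
      d.factorial * Γ x := by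
    refine (abs_det_le _ (Function.update (fun _ => 1) i (Γ x)) ?_).trans ?_
    · intro j l
      rcases eq_or_ne j i with rfl | h
      · simpa using hx l
      · simp only [Function.update_of_ne h]
        exact abs_grad_le (hf i j) x l
    · rw [Finset.prod_update_of_mem (Finset.mem_univ i)]
      simp
  calc |ψ i x| * _ ≤ |ψ i x| * (d.factorial * Γ x) := by gcongr
    _ = _ := by ring

/-! ### Averages along a direction and second differences. -/

/-- The average of the translates of `p` by `i • v`, `-M ≤ i ≤ M`. -/
def avg {d : ℕ} (M : ℕ) (v : Euc d) (p : Euc d → ℝ) (x : Euc d) : ℝ :=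
  (2 * M + 1 : ℝ)⁻¹ * ∑ i ∈ Finset.range (2 * M + 1), p (x + ((i : ℝ) - M) • v)

/-- The second difference of `p` in the direction `v`. -/
def secondDiff {d : ℕ} (v : Euc d) (p : Euc d → ℝ) (x : Euc d) : ℝ :=
  p (x + v) - 2 * p x + p (x - v)

lemma lipschitz_abs_sub_le {d : ℕ} {p : Euc d → ℝ} (hp : LipschitzWith 1 p) (x y : Euc d) :
    |p x - p y| ≤ ‖x - y‖ := by
  have := hp.dist_le_mul x y
  rwa [Real.dist_eq, NNReal.coe_one, one_mul, dist_eq_norm] at this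

lemma abs_inv_mul_sum_range_le (M : ℕ) (a : ℕ → ℝ) {c : ℝ}
    (h : ∀ i ∈ Finset.range (2 * M + 1), |a i| ≤ c) :
    |(2 * M + 1 : ℝ)⁻¹ * ∑ i ∈ Finset.range (2 * M + 1), a i| ≤ c := by
  have hM : (0 : ℝ) < 2 * M + 1 := by positivity
  rw [abs_mul, abs_of_pos (inv_pos.2 hM), inv_mul_le_iff₀ hM]
  refine (Finset.abs_sum_le_sum_abs _ _).trans ((Finset.sum_le_sum h).trans ?_)
  simp

lemma avg_sub {d : ℕ} (M : ℕ) (v : Euc d) (p : Euc d → ℝ) (x : Euc d) (c : ℝ) :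
    avg M v p x - c = (2 * M + 1 : ℝ)⁻¹ *
      ∑ i ∈ Finset.range (2 * M + 1), (p (x + ((i : ℝ) - M) • v) - c) := by
  have hM : (2 * M + 1 : ℝ) ≠ 0 := by positivity
  rw [avg, Finset.sum_sub_distrib, mul_sub]
  congr 1
  simp only [Finset.sum_const, Finset.card_range, nsmul_eq_mul]
  push_cast
  field_simp

lemma lipschitzWith_avg {d : ℕ} (M : ℕ) (v : Euc d) {p : Euc d → ℝ} (hp : LipschitzWith 1 p) :
    LipschitzWith 1 (avg M v p) := by
  refine LipschitzWith.of_dist_le_mul fun x y => ?_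
  rw [Real.dist_eq, NNReal.coe_one, one_mul, dist_eq_norm, avg, avg, ← mul_sub,
    ← Finset.sum_sub_distrib]
  refine abs_inv_mul_sum_range_le M _ fun i _ => ?_
  refine (lipschitz_abs_sub_le hp _ _).trans (le_of_eq ?_)
  rw [add_sub_add_right_eq_sub]

/-- Shifting the window of translates by one changes only its two ends. This is the source of the
gain `1 / M` in the almost periodicity of averages. -/
lemma avg_add_sub_avg {d : ℕ} (M : ℕ) (v : Euc d) (p : Euc d → ℝ) (x : Euc d) :
    avg M v p (x + v) - avg M v p x =
      (2 * M + 1 : ℝ)⁻¹ * (p (x + ((M : ℝ) + 1) • v) - p (x + (-(M : ℝ)) • v)) := by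
  rw [avg, avg, ← mul_sub, ← Finset.sum_sub_distrib]
  congr 1
  have := Finset.sum_range_sub (fun i : ℕ => p (x + ((i : ℝ) - M) • v)) (2 * M + 1)
  have h1 : x + (((2 * M + 1 : ℕ) : ℝ) - M) • v = x + ((M : ℝ) + 1) • v := by
    congr 2; push_cast; ring
  have h2 : x + (((0 : ℕ) : ℝ) - M) • v = x + (-(M : ℝ)) • v := by
    congr 2; push_cast; ring
  rw [h1, h2] at this
  rw [← this]
  refine Finset.sum_congr rfl fun i _ => ?_
  congr 2
  push_cast
  module

lemma lipschitzWith_avg_add_sub_avg {d : ℕ} (M : ℕ) (v : Euc d) {p : Euc d → ℝ}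
    (hp : LipschitzWith 1 p) :
    LipschitzWith (2 / (2 * M + 1)) (fun x => avg M v p (x + v) - avg M v p x) := by
  refine LipschitzWith.of_dist_le_mul fun x y => ?_
  rw [Real.dist_eq, dist_eq_norm, avg_add_sub_avg, avg_add_sub_avg, ← mul_sub, abs_mul]
  have hM : (0 : ℝ) < 2 * M + 1 := by positivity
  rw [abs_of_pos (inv_pos.2 hM)]
  push_cast
  rw [div_mul_eq_mul_div, inv_mul_eq_div]
  gcongr
  have h1 := lipschitz_abs_sub_le hp (x + ((M : ℝ) + 1) • v) (y + ((M : ℝ) + 1) • v)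
  have h2 := lipschitz_abs_sub_le hp (x + (-(M : ℝ)) • v) (y + (-(M : ℝ)) • v)
  rw [add_sub_add_right_eq_sub] at h1 h2
  rw [abs_le] at h1 h2 ⊢
  constructor <;> linarith [h1.1, h1.2, h2.1, h2.2]

/-- A crude bound that suffices for lower-order terms; the main term uses
`abs_sub_avg_le_secondDiff`. -/
lemma abs_sub_avg_le {d : ℕ} (M : ℕ) (v : Euc d) {p : Euc d → ℝ} (hp : LipschitzWith 1 p)
    (x : Euc d) : |p x - avg M v p x| ≤ M * ‖v‖ := by
  rw [abs_sub_comm, avg_sub]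
  refine abs_inv_mul_sum_range_le M _ fun i hi => ?_
  refine (lipschitz_abs_sub_le hp _ _).trans ?_
  rw [add_sub_cancel_left, norm_smul]
  gcongr
  rw [Finset.mem_range] at hi
  have : (i : ℝ) ≤ 2 * M := by exact_mod_cast Nat.lt_succ_iff.1 hi
  rw [Real.norm_eq_abs, abs_le]
  constructor <;> linarith [(Nat.cast_nonneg i : (0 : ℝ) ≤ i)]

/-- A second difference with long step is obtained by summing twice second differences with step
`v`. -/
lemma abs_symm_sum_le {d : ℕ} (v : Euc d) (p : Euc d → ℝ) (x : Euc d) (m : ℕ) :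
    |secondDiff ((m : ℝ) • v) p x| ≤ m * ∑ j ∈ Finset.range (m + 1),
      (|secondDiff v p (x + (j : ℝ) • v)| + |secondDiff v p (x - (j : ℝ) • v)|) := by
  set Q : ℕ → ℝ := fun m => ∑ j ∈ Finset.range (m + 1),
      (|secondDiff v p (x + (j : ℝ) • v)| + |secondDiff v p (x - (j : ℝ) • v)|) with hQ
  have hQs : ∀ m, Q (m + 1) = Q m + (|secondDiff v p (x + ((m + 1 : ℕ) : ℝ) • v)| +
      |secondDiff v p (x - ((m + 1 : ℕ) : ℝ) • v)|) := fun m => Finset.sum_range_succ _ _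
  have hT : ∀ m : ℕ, |secondDiff (((m + 1 : ℕ) : ℝ) • v) p x - secondDiff ((m : ℝ) • v) p x| ≤
      Q m := by
    intro m
    induction m with
    | zero =>
      have h1 : secondDiff (((0 + 1 : ℕ) : ℝ) • v) p x - secondDiff (((0 : ℕ) : ℝ) • v) p x =
          secondDiff v p x := by
        simp [secondDiff]; ring
      rw [h1]
      simp [hQ]
    | succ m ih =>
      have h2 : secondDiff (((m + 1 + 1 : ℕ) : ℝ) • v) p x
          - secondDiff (((m + 1 : ℕ) : ℝ) • v) p x =
          (secondDiff (((m + 1 : ℕ) : ℝ) • v) p x - secondDiff ((m : ℝ) • v) p x) +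
          (secondDiff v p (x + ((m + 1 : ℕ) : ℝ) • v)
            + secondDiff v p (x - ((m + 1 : ℕ) : ℝ) • v)) := by
        simp only [secondDiff]
        have e1 : x + ((m + 1 : ℕ) : ℝ) • v + v = x + ((m + 1 + 1 : ℕ) : ℝ) • v := by
          push_cast; module
        have e2 : x + ((m + 1 : ℕ) : ℝ) • v - v = x + (m : ℝ) • v := by
          push_cast; module
        have e3 : x - ((m + 1 : ℕ) : ℝ) • v + v = x - (m : ℝ) • v := by
          push_cast; module
        have e4 : x - ((m + 1 : ℕ) : ℝ) • v - v = x - ((m + 1 + 1 : ℕ) : ℝ) • v := by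
          push_cast; module
        rw [e1, e2, e3, e4]
        ring
      rw [h2, hQs]
      exact (abs_add_le _ _).trans (add_le_add ih (abs_add_le _ _))
  have hQmono : Monotone Q := monotone_nat_of_le_succ fun m => by
    rw [hQs]; linarith [abs_nonneg (secondDiff v p (x + ((m + 1 : ℕ) : ℝ) • v)),
      abs_nonneg (secondDiff v p (x - ((m + 1 : ℕ) : ℝ) • v))]
  have hmain : ∀ n, n ≤ m → |secondDiff ((n : ℝ) • v) p x| ≤ n * Q m := by
    intro n
    induction n with
    | zero =>
      intro _
      have : secondDiff (((0 : ℕ) : ℝ) • v) p x = 0 := by simp [secondDiff]; ring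
      rw [this]; simp
    | succ n ih =>
      intro hn
      have h1 := ih (by omega)
      have h2 := (hT n).trans (hQmono (show n ≤ m by omega))
      have h3 := abs_add_le (secondDiff (((n + 1 : ℕ) : ℝ) • v) p x - secondDiff ((n : ℝ) • v) p x)
        (secondDiff ((n : ℝ) • v) p x)
      rw [sub_add_cancel] at h3
      push_cast at *
      linarith
  exact hmain m le_rfl

/-- The distance of `p` to its average is controlled by its second differences. -/
lemma abs_sub_avg_le_secondDiff {d : ℕ} (M : ℕ) (v : Euc d) (p : Euc d → ℝ) (x : Euc d) :
    |p x - avg M v p x| ≤ M * ∑ j ∈ Finset.range (M + 1),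
      (|secondDiff v p (x + (j : ℝ) • v)| + |secondDiff v p (x - (j : ℝ) • v)|) := by
  set Q : ℝ := ∑ j ∈ Finset.range (M + 1),
      (|secondDiff v p (x + (j : ℝ) • v)| + |secondDiff v p (x - (j : ℝ) • v)|) with hQ
  have hQ0 : 0 ≤ Q := Finset.sum_nonneg fun _ _ => by positivity
  have hS : ∀ m : ℕ, m ≤ M → |secondDiff ((m : ℝ) • v) p x| ≤ M * Q := by
    intro m hm
    refine (abs_symm_sum_le v p x m).trans ?_
    gcongr
    rw [hQ]
    exact Finset.sum_le_sum_of_subset_of_nonneg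
      (Finset.range_mono (by omega)) fun _ _ _ => by positivity
  have h1 := avg_sub M v p x (p x)
  have hrefl := Finset.sum_range_reflect
    (fun i : ℕ => p (x + ((i : ℝ) - M) • v) - p x) (2 * M + 1)
  have h2 : avg M v p x - p x = (2 * M + 1 : ℝ)⁻¹ * ∑ i ∈ Finset.range (2 * M + 1),
      (secondDiff (((i : ℝ) - M) • v) p x / 2) := by
    -- The window of translates is symmetric, so pairing `i` with `2 * M - i` turns first
    -- differences into second differences.
    have h3 : 2 * ∑ i ∈ Finset.range (2 * M + 1), (p (x + ((i : ℝ) - M) • v) - p x) =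
        ∑ i ∈ Finset.range (2 * M + 1), secondDiff (((i : ℝ) - M) • v) p x := by
      rw [two_mul]
      nth_rewrite 2 [← hrefl]
      rw [← Finset.sum_add_distrib]
      refine Finset.sum_congr rfl fun i hi => ?_
      rw [Finset.mem_range] at hi
      have e : x + (((2 * M + 1 - 1 - i : ℕ) : ℝ) - M) • v = x - ((i : ℝ) - M) • v := by
        rw [Nat.add_sub_cancel, Nat.cast_sub (by omega)]
        push_cast
        module
      rw [e, secondDiff]
      ring
    rw [h1, ← Finset.sum_div, ← h3]
    ring
  rw [abs_sub_comm, h2]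
  refine abs_inv_mul_sum_range_le M _ fun i hi => ?_
  rw [Finset.mem_range] at hi
  have h4 : |secondDiff (((i : ℝ) - M) • v) p x| ≤ M * Q := by
    rcases le_total M i with h | h
    · have := hS (i - M) (by omega)
      rwa [Nat.cast_sub h] at this
    · have := hS (M - i) (by omega)
      rw [Nat.cast_sub h] at this
      have e : secondDiff (((i : ℝ) - M) • v) p x = secondDiff (((M : ℝ) - i) • v) p x := by
        simp only [secondDiff]
        have e1 : x + ((i : ℝ) - M) • v = x - ((M : ℝ) - i) • v := by module
        have e2 : x - ((i : ℝ) - M) • v = x + ((M : ℝ) - i) • v := by module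
        rw [e1, e2]; ring
      rwa [e]
  rw [abs_div, abs_two]
  have := abs_nonneg (secondDiff (((i : ℝ) - M) • v) p x)
  linarith

/-! ### Lipschitz functions against shifted and antiperiodic factors. -/

/-- The volume of a ball that contains all translates of the cube by vectors of norm at most 1. -/
def ballVol (d : ℕ) : ℝ := volume.real (Metric.closedBall (0 : Euc d) (d + 1))

lemma ballVol_nonneg (d : ℕ) : 0 ≤ ballVol d := measureReal_nonneg

lemma norm_le_of_mem_cube {d : ℕ} {x : Euc d} (hx : x ∈ cube d) : ‖x‖ ≤ d := by
  have h1 : ‖x‖ ^ 2 ≤ (d : ℝ) := by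
    rw [EuclideanSpace.norm_sq_eq]
    calc ∑ i, ‖x i‖ ^ 2 ≤ ∑ _i : Fin d, (1 : ℝ) := by
          refine Finset.sum_le_sum fun i _ => ?_
          have := hx i
          rw [Real.norm_eq_abs, sq_abs]
          nlinarith [this.1, this.2]
      _ = d := by simp
  rcases Nat.eq_zero_or_pos d with h | h
  · subst h
    simp only [Nat.cast_zero] at h1 ⊢
    nlinarith [norm_nonneg x]
  · have : (1 : ℝ) ≤ d := by exact_mod_cast h
    nlinarith [norm_nonneg x]

lemma abs_integral_le_of_support {d : ℕ} {F : Euc d → ℝ} {c : ℝ} (hc : ∀ x, |F x| ≤ c)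
    (hF : ∀ x, x ∉ Metric.closedBall (0 : Euc d) (d + 1) → F x = 0) :
    |∫ x, F x| ≤ c * ballVol d := by
  rw [← setIntegral_eq_integral_of_forall_compl_eq_zero hF]
  exact norm_setIntegral_le_of_norm_le_const measure_closedBall_lt_top
    fun x _ => (Real.norm_eq_abs _).trans_le (hc x)

lemma notMem_cube_of_notMem_closedBall {d : ℕ} {x : Euc d}
    (hx : x ∉ Metric.closedBall (0 : Euc d) (d + 1)) : x ∉ cube d := by
  intro h
  apply hx
  rw [mem_closedBall_zero_iff]
  linarith [norm_le_of_mem_cube h]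

lemma add_notMem_cube_of_notMem_closedBall {d : ℕ} {x v : Euc d} (hv : ‖v‖ ≤ 1)
    (hx : x ∉ Metric.closedBall (0 : Euc d) (d + 1)) : x + v ∉ cube d := by
  intro h
  apply hx
  rw [mem_closedBall_zero_iff]
  have h1 := norm_le_of_mem_cube h
  have h2 := norm_sub_le (x + v) v
  rw [add_sub_cancel_right] at h2
  linarith

lemma integrable_mul_of_lipschitz {d : ℕ} {Φ ω : Euc d → ℝ} {L : ℝ≥0} (hΦ : LipschitzWith L Φ)
    (hΦ0 : ∀ x, x ∉ cube d → Φ x = 0) (hω : Measurable ω) {B : ℝ} (hB : ∀ x, |ω x| ≤ B) :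
    Integrable (fun x => Φ x * ω x) := by
  obtain ⟨C, hC⟩ := (isCompact_closedBall (0 : Euc d) (d + 1)).exists_bound_of_continuousOn
    hΦ.continuous.continuousOn
  refine integrable_of_bounded_of_support (R := d + 1) (C := |C| * B)
    (hΦ.continuous.measurable.mul hω) ?_ ?_
  · intro x
    rw [abs_mul]
    by_cases hx : x ∈ Metric.closedBall (0 : Euc d) (d + 1)
    · exact mul_le_mul ((hC x hx).trans (le_abs_self _)) (hB x) (abs_nonneg _) (abs_nonneg _)
    · rw [hΦ0 x (notMem_cube_of_notMem_closedBall hx), abs_zero, zero_mul]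
      exact mul_nonneg (abs_nonneg _) ((abs_nonneg _).trans (hB x))
  · intro x hx
    rw [hΦ0 x (notMem_cube_of_notMem_closedBall hx), zero_mul]

/-- Translating a bounded factor changes its integral against a Lipschitz function little. -/
lemma abs_integral_mul_shift_sub_le {d : ℕ} {Φ ω : Euc d → ℝ} {L : ℝ≥0} (hΦ : LipschitzWith L Φ)
    (hΦ0 : ∀ x, x ∉ cube d → Φ x = 0) (hω : Measurable ω) {B : ℝ} (hB : ∀ x, |ω x| ≤ B)
    {v : Euc d} (hv : ‖v‖ ≤ 1) :
    |(∫ x, Φ x * ω (x + v)) - ∫ x, Φ x * ω x| ≤ L * ‖v‖ * B * ballVol d := by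
  have hi1 : Integrable (fun x => Φ x * ω x) := integrable_mul_of_lipschitz hΦ hΦ0 hω hB
  have hi2 : Integrable (fun x => Φ x * ω (x + v)) :=
    integrable_mul_of_lipschitz hΦ hΦ0 (hω.comp (measurable_add_const v)) fun x => hB _
  have hi3 : Integrable (fun x => Φ (x + v) * ω (x + v)) := hi1.comp_add_right v
  have h1 : ∫ x, Φ x * ω x = ∫ x, Φ (x + v) * ω (x + v) :=
    (integral_add_right_eq_self (fun x => Φ x * ω x) v).symm
  have h2 : ∀ x, |Φ x - Φ (x + v)| ≤ L * ‖v‖ := by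
    intro x
    have := hΦ.dist_le_mul x (x + v)
    rwa [Real.dist_eq, dist_eq_norm, sub_add_cancel_left, norm_neg] at this
  rw [h1, ← integral_sub hi2 hi3]
  refine abs_integral_le_of_support (fun x => ?_) fun x hx => ?_
  · rw [← sub_mul, abs_mul]
    gcongr
    · exact h2 x
    · exact hB _
  · rw [hΦ0 x (notMem_cube_of_notMem_closedBall hx),
      hΦ0 _ (add_notMem_cube_of_notMem_closedBall hv hx)]
    ring

/-- A Lipschitz function is almost orthogonal to antiperiodic functions of small period. -/
lemma abs_integral_mul_antiperiodic_le {d : ℕ} {Φ ω : Euc d → ℝ} {L : ℝ≥0}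
    (hΦ : LipschitzWith L Φ) (hΦ0 : ∀ x, x ∉ cube d → Φ x = 0) (hω : Measurable ω) {B : ℝ}
    (hB : ∀ x, |ω x| ≤ B) {v : Euc d} (hv : ‖v‖ ≤ 1) (hanti : ∀ x, ω (x + v) = -ω x) :
    |∫ x, Φ x * ω x| ≤ L * ‖v‖ * B * ballVol d := by
  have h := abs_integral_mul_shift_sub_le hΦ hΦ0 hω hB hv
  have h1 : ∫ x, Φ x * ω (x + v) = -∫ x, Φ x * ω x := by
    rw [← integral_neg]
    congr 1
    funext x
    rw [hanti]; ring
  rw [h1] at h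
  rw [← neg_add', ← two_mul, abs_neg, abs_mul, abs_two] at h
  linarith [abs_nonneg (∫ x, Φ x * ω x)]

/-! ### Jacobians against a single oscillation. -/

lemma grad_comp_add {d : ℕ} (φ : Euc d → ℝ) (v x : Euc d) :
    grad (fun y => φ (y + v)) x = grad φ (x + v) := by
  funext j
  simp [grad, fderiv_comp_add_right]

/-- The gradient of an average changes by at most `2 / (2 * M + 1)` under translation by `v`, since
the difference of the two functions has this Lipschitz constant. -/
lemma abs_jac_avg_sub_le {d : ℕ} {p : Fin d → Euc d → ℝ} (hp : ∀ i, LipschitzWith 1 (p i))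
    (M : ℕ) (v : Euc d) : ∀ᵐ x ∂(volume : Measure (Euc d)),
    |jac (fun i => avg M v (p i)) (x + v) - jac (fun i => avg M v (p i)) x| ≤
      d * (d.factorial * (2 / (2 * M + 1))) := by
  have h1 : ∀ᵐ x ∂(volume : Measure (Euc d)), ∀ i, DifferentiableAt ℝ (avg M v (p i)) x :=
    ae_all_iff.2 fun i => (lipschitzWith_avg M v (hp i)).ae_differentiableAt
  have hs : ∀ i, LipschitzWith 1 (fun x => avg M v (p i) (x + v)) := fun i =>
    LipschitzWith.of_dist_le_mul fun x y => by
      have := (lipschitzWith_avg M v (hp i)).dist_le_mul (x + v) (y + v)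
      rwa [dist_add_right] at this
  have h2 : ∀ᵐ x ∂(volume : Measure (Euc d)), ∀ i,
      DifferentiableAt ℝ (fun x => avg M v (p i) (x + v)) x :=
    ae_all_iff.2 fun i => (hs i).ae_differentiableAt
  filter_upwards [h1, h2] with x hx1 hx2
  unfold jac
  refine abs_detRow_sub_le _ _ ?_ ?_ ?_
  · exact fun i j => abs_grad_le (lipschitzWith_avg M v (hp i)) _ j
  · exact fun i j => abs_grad_le (lipschitzWith_avg M v (hp i)) _ j
  · intro i j
    rw [← grad_comp_add, ← Pi.sub_apply, ← grad_sub (hx2 i) (hx1 i)]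
    have := abs_grad_le (lipschitzWith_avg_add_sub_avg M v (hp i)) x j
    push_cast at this
    exact this

/-- The Jacobian of a Lipschitz map is almost orthogonal to a rapidly oscillating function, up to
the distance of the map to its averages in the direction of oscillation. -/
lemma abs_integral_oscillating_mul_jac_le {d : ℕ} {p : Fin d → Euc d → ℝ}
    (hp : ∀ i, LipschitzWith 1 (p i)) {G r ω : Euc d → ℝ} {LG Lr A : ℝ≥0}
    (hG : LipschitzWith LG G) (hG0 : ∀ x, x ∉ cube d → G x = 0) (hGω : ∀ x, |G x| ≤ ω x)
    (hωA : ∀ x, ω x ≤ A) (hωi : Integrable ω) (hr : LipschitzWith Lr r) (hr1 : ∀ x, |r x| ≤ 1)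
    {v : Euc d} (hv : ‖v‖ ≤ 1) (hrv : ∀ x, r (x + v) = -r x) {δ : ℝ}
    (hδ : ∀ x, |G x - G (x + v)| ≤ δ) (M : ℕ) :
    |∫ x, G x * r x * jac p x| ≤
      d.factorial * (Lr * ∑ i, ∫ x, ω x * |p i x - avg M v (p i) x|)
      + d.factorial * (d * (M * ‖v‖ * (LG * ballVol d)))
      + d.factorial * (δ * ballVol d)
      + d * (d.factorial * (2 / (2 * M + 1))) * ∫ x, ω x := by
  set k : Fin d → Euc d → ℝ := fun i => avg M v (p i) with hk
  have hkl : ∀ i, LipschitzWith 1 (k i) := fun i => lipschitzWith_avg M v (hp i)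
  set η : Euc d → ℝ := fun x => G x * r x with hη
  have hω0 : ∀ x, 0 ≤ ω x := fun x => (abs_nonneg _).trans (hGω x)
  have hηl : LipschitzWith (A * Lr + 1 * LG) η :=
    lipschitzWith_mul hG hr (fun x => (hGω x).trans (hωA x)) fun x _ => hr1 x
  have hηω : ∀ x, |η x| ≤ ω x := by
    intro x
    rw [hη, abs_mul]
    calc |G x| * |r x| ≤ ω x * 1 := by
          gcongr
          · exact hω0 x
          · exact hGω x
          · exact hr1 x
      _ = ω x := mul_one _
  have hηA : ∀ x, |η x| ≤ A := fun x => (hηω x).trans (hωA x)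
  have hη0 : ∀ x, x ∉ Metric.closedBall (0 : Euc d) (d + 1) → η x = 0 := by
    intro x hx
    rw [hη]
    simp [hG0 x (notMem_cube_of_notMem_closedBall hx)]
  have hint : ∀ {q : Fin d → Euc d → ℝ}, (∀ i, LipschitzWith 1 (q i)) →
      Integrable (fun x => η x * jac q x) := by
    intro q hq
    refine integrable_of_bounded_of_support (R := d + 1)
      (C := A * (d.factorial * ∏ _j : Fin d, ((1 : ℝ≥0) : ℝ)))
      (hηl.continuous.measurable.mul (measurable_jac _)) ?_ ?_
    · intro x
      rw [abs_mul]
      gcongr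
      · exact hηA x
      · exact abs_jac_le hq x
    · intro x hx
      rw [hη0 x hx, zero_mul]
  have hsplit : ∫ x, η x * jac p x =
      (∫ x, η x * (jac p x - jac k x)) + ∫ x, η x * jac k x := by
    rw [← integral_add (((hint hp).sub (hint hkl)).congr
      (Filter.Eventually.of_forall fun x => (mul_sub _ _ _).symm)) (hint hkl)]
    congr 1
    funext x
    ring
  set B := Metric.closedBall (0 : Euc d) (d + 1)
  have hBm : MeasurableSet B := Metric.isClosed_closedBall.measurableSet
  have hBi : Integrable (B.indicator (fun _ => (LG : ℝ))) :=
    (integrable_indicator_iff hBm).2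
      (integrableOn_const (C := (LG : ℝ)) measure_closedBall_lt_top.ne)
  -- The gradient of `η` is bounded pointwise, not uniformly: its large part, from the oscillation
  -- `r`, keeps the weight `ω`. This is what makes weighted energies sufficient.
  have hfirst := abs_integral_mul_jac_sub_le hp hkl (P := M * ‖v‖₊)
    (fun i x => by push_cast; exact abs_sub_avg_le M v (hp i) x) hηl hηA hη0
    (Γ := fun x => Lr * ω x + B.indicator (fun _ => (LG : ℝ)) x)
    ((hωi.const_mul _).add hBi) (by
      filter_upwards [hG.ae_differentiableAt, hr.ae_differentiableAt] with x hx1 hx2 j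
      by_cases hxB : x ∈ B
      · rw [grad_mul hx1 hx2, Set.indicator_of_mem hxB]
        simp only [Pi.add_apply, Pi.smul_apply, smul_eq_mul]
        refine (abs_add_le _ _).trans ?_
        rw [abs_mul, abs_mul]
        have e1 := abs_grad_le hr x j
        have e2 := abs_grad_le hG x j
        calc |G x| * |grad r x j| + |r x| * |grad G x j| ≤ ω x * Lr + 1 * LG := by
              gcongr
              · exact hω0 x
              · exact hGω x
              · exact hr1 x
          _ = _ := by ring
      · rw [grad_eq_zero_of_notMem Metric.isClosed_closedBall hη0 hxB]
        simp only [Pi.zero_apply, abs_zero]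
        have := hω0 x
        have : 0 ≤ B.indicator (fun _ => (LG : ℝ)) x :=
          Set.indicator_nonneg (fun _ _ => LG.2) x
        positivity)
  have hψi : ∀ i, Integrable (fun x => ω x * |p i x - k i x|) := by
    intro i
    refine hωi.mul_bdd (c := M * ‖v‖) ((hp i).continuous.sub
      (hkl i).continuous).abs.aestronglyMeasurable (Filter.Eventually.of_forall fun x => ?_)
    rw [Real.norm_eq_abs, abs_abs]
    exact abs_sub_avg_le M v (hp i) x
  have hterm : ∀ i, ∫ x, |p i x - k i x| * (Lr * ω x + B.indicator (fun _ => (LG : ℝ)) x) ≤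
      Lr * (∫ x, ω x * |p i x - k i x|) + M * ‖v‖ * (LG * ballVol d) := by
    intro i
    have e1 : ∀ x, |p i x - k i x| * (Lr * ω x + B.indicator (fun _ => (LG : ℝ)) x) ≤
        Lr * (ω x * |p i x - k i x|) + M * ‖v‖ * B.indicator (fun _ => (LG : ℝ)) x := by
      intro x
      have e2 : |p i x - k i x| ≤ M * ‖v‖ := abs_sub_avg_le M v (hp i) x
      have e3 : 0 ≤ B.indicator (fun _ => (LG : ℝ)) x :=
        Set.indicator_nonneg (fun _ _ => LG.2) x
      nlinarith
    have e4 : ∫ x, B.indicator (fun _ => (LG : ℝ)) x = LG * ballVol d := by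
      rw [integral_indicator hBm, setIntegral_const, smul_eq_mul, mul_comm]
      rfl
    rw [← e4, ← integral_const_mul, ← integral_const_mul, ← integral_add
      ((hψi i).const_mul (Lr : ℝ)) (hBi.const_mul (M * ‖v‖))]
    refine integral_mono_of_nonneg (Filter.Eventually.of_forall fun x => ?_)
      (((hψi i).const_mul _).add (hBi.const_mul _)) (Filter.Eventually.of_forall e1)
    have := hω0 x
    have : 0 ≤ B.indicator (fun _ => (LG : ℝ)) x :=
      Set.indicator_nonneg (fun _ _ => LG.2) x
    positivity
  have hfirst' : |∫ x, η x * (jac p x - jac k x)| ≤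
      d.factorial * (Lr * ∑ i, ∫ x, ω x * |p i x - k i x|)
      + d.factorial * (d * (M * ‖v‖ * (LG * ballVol d))) := by
    refine hfirst.trans ?_
    rw [← mul_add]
    gcongr
    refine (Finset.sum_le_sum fun i _ => hterm i).trans (le_of_eq ?_)
    rw [Finset.sum_add_distrib, ← Finset.mul_sum]
    simp
  have hsecond : |∫ x, η x * jac k x| ≤ d.factorial * (δ * ballVol d)
      + d * (d.factorial * (2 / (2 * M + 1))) * ∫ x, ω x := by
    have hH := hint hkl
    have hH' := hH.comp_add_right v
    -- Averaging the integrand with its translate by `v` exploits the sign change of `r`.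
    have h1 : 2 * ∫ x, η x * jac k x =
        ∫ x, (η x * jac k x + η (x + v) * jac k (x + v)) := by
      rw [integral_add hH hH', integral_add_right_eq_self (fun x => η x * jac k x) v, two_mul]
    have h2 : |∫ x, (η x * jac k x + η (x + v) * jac k (x + v))| ≤
        ∫ x, (d * (d.factorial * (2 / (2 * M + 1))) * ω x +
          B.indicator (fun _ => d.factorial * δ) x) := by
      have hBi' : Integrable (B.indicator (fun _ => d.factorial * δ)) :=
        (integrable_indicator_iff hBm).2
          (integrableOn_const (C := d.factorial * δ) measure_closedBall_lt_top.ne)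
      refine abs_integral_le_integral_abs.trans (integral_mono_of_nonneg
        (Filter.Eventually.of_forall fun x => abs_nonneg _)
        ((hωi.const_mul _).add hBi') ?_)
      filter_upwards [abs_jac_avg_sub_le hp M v] with x hx
      have hδ0 : 0 ≤ δ := (abs_nonneg _).trans (hδ x)
      -- Since `r` flips its sign, only the variation of the averaged Jacobian and that of `G` over
      -- the translation survive.
      have e1 : η x * jac k x + η (x + v) * jac k (x + v) =
          (-η x) * (jac k (x + v) - jac k x) + r x * ((G x - G (x + v)) * jac k (x + v)) := by
        simp only [hη, hrv]
        ring
      have e2 : |jac k (x + v)| ≤ d.factorial := by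
        have := abs_jac_le hkl (x + v)
        simpa using this
      have e3 : |(G x - G (x + v)) * jac k (x + v)| ≤
          B.indicator (fun _ => d.factorial * δ) x := by
        by_cases hxB : x ∈ B
        · rw [Set.indicator_of_mem hxB, abs_mul, mul_comm (d.factorial : ℝ)]
          gcongr
          exact hδ x
        · rw [hG0 x (notMem_cube_of_notMem_closedBall hxB),
            hG0 _ (add_notMem_cube_of_notMem_closedBall hv hxB), sub_zero, zero_mul, abs_zero]
          exact Set.indicator_nonneg (fun _ _ => by positivity) x
      change |η x * jac k x + η (x + v) * jac k (x + v)| ≤ _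
      rw [e1]
      refine (abs_add_le _ _).trans (add_le_add ?_ ?_)
      · rw [abs_mul, abs_neg, mul_comm]
        gcongr
        exact hηω x
      · rw [abs_mul]
        calc |r x| * |(G x - G (x + v)) * jac k (x + v)|
            ≤ 1 * |(G x - G (x + v)) * jac k (x + v)| := by gcongr; exact hr1 x
          _ ≤ _ := by rw [one_mul]; exact e3
    have h3 : ∫ x, (d * (d.factorial * (2 / (2 * M + 1))) * ω x +
          B.indicator (fun _ => d.factorial * δ) x) =
        d * (d.factorial * (2 / (2 * M + 1))) * (∫ x, ω x) + d.factorial * (δ * ballVol d) := by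
      rw [integral_add (hωi.const_mul _) ((integrable_indicator_iff hBm).2
          (integrableOn_const (C := d.factorial * δ) measure_closedBall_lt_top.ne)),
        integral_const_mul, integral_indicator hBm, setIntegral_const, smul_eq_mul]
      change _ + ballVol d * _ = _
      ring
    rw [← h1, h3, abs_mul, abs_two] at h2
    linarith [abs_nonneg (∫ x, η x * jac k x)]
  change |∫ x, η x * jac p x| ≤ _
  rw [hsplit]
  refine (abs_add_le _ _).trans ?_
  linarith

/-! ### Energies of difference quotients across scales. -/

/-- The difference quotient of `p` with step `h` in the direction `e`. -/
def diffQuot {d : ℕ} (h : ℝ) (e : Euc d) (p : Euc d → ℝ) (x : Euc d) : ℝ :=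
  (p (x + h • e) - p x) / h

/-- The energy of `p` at scale `h` in the direction `e`, with weight `χ * W`. -/
def energy {d : ℕ} (χ W : Euc d → ℝ) (h : ℝ) (e : Euc d) (p : Euc d → ℝ) : ℝ :=
  ∫ x, χ x * (W x * diffQuot h e p x ^ 2)

section

variable {d : ℕ} {h : ℝ} {e : Euc d} {p : Euc d → ℝ}

lemma abs_diffQuot_le (hh : 0 < h) (he : ‖e‖ = 1) (hp : LipschitzWith 1 p) (x : Euc d) :
    |diffQuot h e p x| ≤ 1 := by
  rw [diffQuot, abs_div, abs_of_pos hh, div_le_one hh]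
  have := lipschitz_abs_sub_le hp (x + h • e) x
  rwa [add_sub_cancel_left, norm_smul, he, mul_one, Real.norm_of_nonneg hh.le] at this

lemma diffQuot_sq_le (hh : 0 < h) (he : ‖e‖ = 1) (hp : LipschitzWith 1 p) (x : Euc d) :
    diffQuot h e p x ^ 2 ≤ 1 := by
  have := abs_diffQuot_le hh he hp x
  rw [sq_le_one_iff_abs_le_one]
  exact this

lemma measurable_diffQuot (hp : LipschitzWith 1 p) : Measurable (diffQuot h e p) := by
  have := hp.continuous
  unfold diffQuot
  fun_prop

lemma diffQuot_two_mul (hh : 0 < h) (x : Euc d) :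
    diffQuot (2 * h) e p x = (diffQuot h e p x + diffQuot h e p (x + h • e)) / 2 := by
  have e1 : x + h • e + h • e = x + (2 * h) • e := by module
  rw [diffQuot, diffQuot, diffQuot, e1]
  field_simp
  ring

/-- The parallelogram identity for two neighbouring difference quotients, whose mean is the quotient
at the doubled scale. It is the reason why an energy drop measures second differences. -/
lemma secondDiff_div (hh : 0 < h) (x : Euc d) :
    (secondDiff (h • e) p x / h) ^ 2 = 2 * diffQuot h e p x ^ 2
      + 2 * diffQuot h e p (x - h • e) ^ 2 - 4 * diffQuot (2 * h) e p (x - h • e) ^ 2 := by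
  rw [diffQuot_two_mul hh, sub_add_cancel]
  have e1 : secondDiff (h • e) p x / h = diffQuot h e p x - diffQuot h e p (x - h • e) := by
    rw [secondDiff, diffQuot, diffQuot, sub_add_cancel]
    field_simp
    ring
  rw [e1]
  ring

lemma abs_secondDiff_le (hh : 0 < h) (he : ‖e‖ = 1) (hp : LipschitzWith 1 p) (x : Euc d) :
    |secondDiff (h • e) p x| ≤ 2 * h := by
  have h1 := lipschitz_abs_sub_le hp (x + h • e) x
  have h2 := lipschitz_abs_sub_le hp (x - h • e) x
  have e3 : x - h • e - x = -(h • e) := by abel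
  rw [add_sub_cancel_left, norm_smul, he, mul_one, Real.norm_of_nonneg hh.le] at h1
  rw [e3, norm_neg, norm_smul, he, mul_one, Real.norm_of_nonneg hh.le] at h2
  rw [secondDiff]
  rw [abs_le] at *
  constructor <;> linarith [h1.1, h1.2, h2.1, h2.2]

variable {χ W : Euc d → ℝ} {A : ℝ}

lemma abs_weight_mul_le (hW0 : ∀ x, 0 ≤ W x) (hWA : ∀ x, W x ≤ A) {b c : ℝ} (hb : |b| ≤ c)
    (x : Euc d) : |W x * b| ≤ A * c := by
  rw [abs_mul, abs_of_nonneg (hW0 x)]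
  exact mul_le_mul (hWA x) hb (abs_nonneg _) ((hW0 x).trans (hWA x))

lemma abs_weight_mul_diffQuot_sq_le (hW0 : ∀ x, 0 ≤ W x) (hWA : ∀ x, W x ≤ A) (hh : 0 < h)
    (he : ‖e‖ = 1) (hp : LipschitzWith 1 p) (x : Euc d) :
    |W x * diffQuot h e p x ^ 2| ≤ A := by
  have h1 : |diffQuot h e p x ^ 2| ≤ 1 := by
    rw [abs_of_nonneg (sq_nonneg _)]
    exact diffQuot_sq_le hh he hp x
  simpa using abs_weight_mul_le hW0 hWA h1 x

/-- The energy at scale `2 h` is almost at most the one at scale `h`. -/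
lemma energy_two_mul_le (hχ : LipschitzWith 1 χ) (hχ0 : ∀ x, x ∉ cube d → χ x = 0)
    (hχn : ∀ x, 0 ≤ χ x) (hWm : Measurable W) (hW0 : ∀ x, 0 ≤ W x) (hWA : ∀ x, W x ≤ A)
    (hWe : ∀ (x : Euc d) (t : ℝ), W (x + t • e) = W x) (he : ‖e‖ = 1) (hp : LipschitzWith 1 p)
    (hh : 0 < h) (hh1 : h ≤ 1) :
    energy χ W (2 * h) e p ≤ energy χ W h e p + A * h * ballVol d := by
  have hm : Measurable fun x => W x * diffQuot h e p x ^ 2 :=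
    hWm.mul ((measurable_diffQuot hp).pow_const 2)
  have hb := fun x => abs_weight_mul_diffQuot_sq_le hW0 hWA hh he hp x
  have hv : ‖h • e‖ = h := by rw [norm_smul, he, mul_one, Real.norm_of_nonneg hh.le]
  have hs := abs_integral_mul_shift_sub_le hχ hχ0 hm hb (v := h • e) (by rw [hv]; exact hh1)
  have hi1 : Integrable fun x => χ x * (W x * diffQuot h e p x ^ 2) :=
    integrable_mul_of_lipschitz hχ hχ0 hm hb
  have hi2 : Integrable fun x => χ x * (W (x + h • e) * diffQuot h e p (x + h • e) ^ 2) :=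
    integrable_mul_of_lipschitz hχ hχ0 (hm.comp (measurable_add_const (h • e))) fun x => hb _
  have hle : energy χ W (2 * h) e p ≤ ∫ x, (1 / 2 * (χ x * (W x * diffQuot h e p x ^ 2)) +
      1 / 2 * (χ x * (W (x + h • e) * diffQuot h e p (x + h • e) ^ 2))) := by
    refine integral_mono_of_nonneg (Filter.Eventually.of_forall fun x => ?_)
      ((hi1.const_mul _).add (hi2.const_mul _)) (Filter.Eventually.of_forall fun x => ?_)
    · exact mul_nonneg (hχn x) (mul_nonneg (hW0 x) (sq_nonneg _))
    · change χ x * (W x * diffQuot (2 * h) e p x ^ 2) ≤ _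
      simp only [hWe]
      rw [diffQuot_two_mul hh]
      -- Convexity of the square. The translated half is moved back at the cost of the variation of
      -- `χ` alone, as `W` is constant along `e`.
      have h1 : ((diffQuot h e p x + diffQuot h e p (x + h • e)) / 2) ^ 2 ≤
          1 / 2 * diffQuot h e p x ^ 2 + 1 / 2 * diffQuot h e p (x + h • e) ^ 2 := by
        nlinarith [sq_nonneg (diffQuot h e p x - diffQuot h e p (x + h • e))]
      have := mul_le_mul_of_nonneg_left h1 (mul_nonneg (hχn x) (hW0 x))
      linarith
  rw [integral_add (hi1.const_mul _) (hi2.const_mul _), integral_const_mul,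
    integral_const_mul] at hle
  rw [hv, NNReal.coe_one, one_mul, mul_comm h A] at hs
  have h2 := (abs_le.1 hs).2
  have hA : 0 ≤ A * h * ballVol d :=
    mul_nonneg (mul_nonneg ((hW0 0).trans (hWA 0)) hh.le) (ballVol_nonneg d)
  change energy χ W (2 * h) e p ≤ 1 / 2 * energy χ W h e p + _ at hle
  change _ - energy χ W h e p ≤ _ at h2
  linarith

/-- The errors of successive doublings form a geometric sum, dominated by the coarsest scale. -/
lemma energy_two_pow_mul_le (hχ : LipschitzWith 1 χ) (hχ0 : ∀ x, x ∉ cube d → χ x = 0)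
    (hχn : ∀ x, 0 ≤ χ x) (hWm : Measurable W) (hW0 : ∀ x, 0 ≤ W x) (hWA : ∀ x, W x ≤ A)
    (hWe : ∀ (x : Euc d) (t : ℝ), W (x + t • e) = W x) (he : ‖e‖ = 1) (hp : LipschitzWith 1 p)
    (hh : 0 < h) (b : ℕ) (hb : 2 ^ b * h ≤ 1) :
    energy χ W (2 ^ b * h) e p ≤ energy χ W h e p + A * (2 ^ b * h) * ballVol d := by
  have hA := (hW0 0).trans (hWA 0)
  have hV := ballVol_nonneg d
  induction b with
  | zero =>
    simp only [pow_zero, one_mul]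
    have : 0 ≤ A * h * ballVol d := by positivity
    linarith
  | succ b ih =>
    have h0 : 0 < 2 ^ b * h := by positivity
    rw [pow_succ', mul_assoc] at hb ⊢
    have h1 := ih (by linarith)
    have h2 := energy_two_mul_le hχ hχ0 hχn hWm hW0 hWA hWe he hp h0 (by linarith)
    linarith

/-- Second differences are controlled by the drop of the energy. -/
lemma integral_secondDiff_sq_le (hχ : LipschitzWith 1 χ) (hχ0 : ∀ x, x ∉ cube d → χ x = 0)
    (hWm : Measurable W) (hW0 : ∀ x, 0 ≤ W x) (hWA : ∀ x, W x ≤ A)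
    (hWe : ∀ (x : Euc d) (t : ℝ), W (x + t • e) = W x) (he : ‖e‖ = 1) (hp : LipschitzWith 1 p)
    (hh : 0 < h) (hh1 : h ≤ 1) :
    ∫ x, χ x * (W x * (secondDiff (h • e) p x / h) ^ 2) ≤
      4 * (energy χ W h e p - energy χ W (2 * h) e p) + 6 * (A * h * ballVol d) := by
  have hWe' : ∀ x, W (x + -(h • e)) = W x := fun x => by
    rw [← neg_smul]; exact hWe x (-h)
  have hv : ‖-(h • e)‖ = h := by
    rw [norm_neg, norm_smul, he, mul_one, Real.norm_of_nonneg hh.le]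
  -- The identity `secondDiff_div` involves quotients based at `x - h • e`. Moving them to `x` again
  -- costs only the variation of `χ`; the two shifts, with factors 2 and 4, give the constant 6.
  have key : ∀ t : ℝ, 0 < t →
      Integrable (fun x => χ x * (W x * diffQuot t e p x ^ 2)) ∧
      Integrable (fun x => χ x * (W x * diffQuot t e p (x - h • e) ^ 2)) ∧
      |(∫ x, χ x * (W x * diffQuot t e p (x - h • e) ^ 2)) - energy χ W t e p| ≤
        A * h * ballVol d := by
    intro t ht
    have hm : Measurable fun x => W x * diffQuot t e p x ^ 2 :=
      hWm.mul ((measurable_diffQuot hp).pow_const 2)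
    have hb := fun x => abs_weight_mul_diffQuot_sq_le hW0 hWA ht he hp x
    have hs := abs_integral_mul_shift_sub_le hχ hχ0 hm hb (v := -(h • e)) (by rw [hv]; exact hh1)
    have hi2 : Integrable fun x => χ x * (W (x + -(h • e)) * diffQuot t e p (x + -(h • e)) ^ 2) :=
      integrable_mul_of_lipschitz hχ hχ0 (hm.comp (measurable_add_const (-(h • e)))) fun x => hb _
    rw [hv, NNReal.coe_one, one_mul, mul_comm h A] at hs
    simp only [hWe'] at hs hi2
    simp only [← sub_eq_add_neg] at hs hi2
    exact ⟨integrable_mul_of_lipschitz hχ hχ0 hm hb, hi2, hs⟩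
  obtain ⟨i1, i2, k1⟩ := key h hh
  obtain ⟨-, i4, k2⟩ := key (2 * h) (by linarith)
  have heq : ∫ x, χ x * (W x * (secondDiff (h • e) p x / h) ^ 2) =
      2 * energy χ W h e p + 2 * (∫ x, χ x * (W x * diffQuot h e p (x - h • e) ^ 2))
        - 4 * ∫ x, χ x * (W x * diffQuot (2 * h) e p (x - h • e) ^ 2) := by
    have hpt : ∀ x, χ x * (W x * (secondDiff (h • e) p x / h) ^ 2) =
        2 * (χ x * (W x * diffQuot h e p x ^ 2))
          + 2 * (χ x * (W x * diffQuot h e p (x - h • e) ^ 2))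
          - 4 * (χ x * (W x * diffQuot (2 * h) e p (x - h • e) ^ 2)) := by
      intro x
      rw [secondDiff_div hh]
      ring
    simp only [hpt]
    have i12 : Integrable fun x => 2 * (χ x * (W x * diffQuot h e p x ^ 2))
        + 2 * (χ x * (W x * diffQuot h e p (x - h • e) ^ 2)) :=
      (i1.const_mul 2).add (i2.const_mul 2)
    rw [integral_sub i12 (i4.const_mul 4),
      integral_add (i1.const_mul 2) (i2.const_mul 2), integral_const_mul, integral_const_mul,
      integral_const_mul]
    rfl
  rw [heq]
  have h1 := (abs_le.1 k1).2
  have h2 := (abs_le.1 k2).1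
  linarith

/-- The weighted distance of `p` to its averages is controlled by the drop of the energy. -/
lemma integral_abs_sub_avg_le (hχ : LipschitzWith 1 χ) (hχ0 : ∀ x, x ∉ cube d → χ x = 0)
    (hχn : ∀ x, 0 ≤ χ x) (hWm : Measurable W) (hW0 : ∀ x, 0 ≤ W x) (hWA : ∀ x, W x ≤ A)
    (hWe : ∀ (x : Euc d) (t : ℝ), W (x + t • e) = W x) (he : ‖e‖ = 1) (hp : LipschitzWith 1 p)
    (hh : 0 < h) (hh1 : h ≤ 1) (M : ℕ) (hMh : M * h ≤ 1) {s : ℝ} (hs : 0 < s) :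
    ∫ x, χ x * W x * |p x - avg M (h • e) p x| ≤ h * (2 * M * (M + 1) *
      ((∫ x, χ x * W x) / (2 * s) + 2 * s * (energy χ W h e p - energy χ W (2 * h) e p)
        + (3 * s + 2 * M) * (A * h * ballVol d))) := by
  set q : Euc d → ℝ := secondDiff (h • e) p with hq
  have hA := (hW0 0).trans (hWA 0)
  have hV := ballVol_nonneg d
  have hqm : Measurable q := by
    have := hp.continuous
    rw [hq]
    unfold secondDiff
    fun_prop
  have hqb : ∀ x, |q x| ≤ 2 * h := fun x => abs_secondDiff_le hh he hp x
  have hm : Measurable fun x => W x * |q x| := hWm.mul hqm.abs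
  have hb : ∀ x, |(W x * |q x|)| ≤ A * (2 * h) := fun x =>
    abs_weight_mul_le hW0 hWA (by rw [abs_abs]; exact hqb x) x
  set I : ℝ := ∫ x, χ x * (W x * |q x|) with hI
  have hshift : ∀ t : ℝ, |t| ≤ M →
      Integrable (fun x => χ x * (W x * |q (x + t • h • e)|)) ∧
      ∫ x, χ x * (W x * |q (x + t • h • e)|) ≤ I + 2 * M * h * (A * h * ballVol d) := by
    intro t ht
    have hn : ‖t • h • e‖ = |t| * h := by
      rw [norm_smul, norm_smul, he, mul_one, Real.norm_of_nonneg hh.le, Real.norm_eq_abs]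
    have hn' : |t| * h ≤ M * h := by gcongr
    have hsh := abs_integral_mul_shift_sub_le hχ hχ0 hm hb (v := t • h • e)
      (by rw [hn]; linarith)
    have hi2 : Integrable fun x => χ x * (W (x + t • h • e) * |q (x + t • h • e)|) :=
      integrable_mul_of_lipschitz hχ hχ0 (hm.comp (measurable_add_const (t • h • e)))
        fun x => hb _
    have hWt : ∀ x, W (x + t • h • e) = W x := fun x => by rw [smul_smul]; exact hWe x _
    simp only [hWt] at hsh hi2
    refine ⟨hi2, ?_⟩
    rw [hn, NNReal.coe_one, one_mul] at hsh
    have h1 := (abs_le.1 hsh).2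
    have h2 : |t| * h * (A * (2 * h)) * ballVol d ≤ M * h * (A * (2 * h)) * ballVol d := by
      gcongr
    linarith
  have hjM : ∀ j ∈ Finset.range (M + 1), |(j : ℝ)| ≤ M ∧ |(-(j : ℝ))| ≤ M := by
    intro j hj
    rw [abs_neg, and_self, abs_of_nonneg (Nat.cast_nonneg j)]
    exact_mod_cast Nat.lt_succ_iff.1 (Finset.mem_range.1 hj)
  have hcancel : ∀ (j : ℕ) (x : Euc d), x - (j : ℝ) • h • e = x + (-(j : ℝ)) • h • e := by
    intro j x; module
  have hstep1 : ∫ x, χ x * W x * |p x - avg M (h • e) p x| ≤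
      M * ∑ j ∈ Finset.range (M + 1), ((∫ x, χ x * (W x * |q (x + (j : ℝ) • h • e)|))
        + ∫ x, χ x * (W x * |q (x + (-(j : ℝ)) • h • e)|)) := by
    have hii : ∀ j ∈ Finset.range (M + 1), Integrable (fun x =>
        χ x * (W x * |q (x + (j : ℝ) • h • e)|) + χ x * (W x * |q (x + (-(j : ℝ)) • h • e)|)) :=
      fun j hj => (hshift _ (hjM j hj).1).1.add (hshift _ (hjM j hj).2).1
    have heq : (M : ℝ) * ∑ j ∈ Finset.range (M + 1), ((∫ x, χ x * (W x * |q (x + (j : ℝ) • h • e)|))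
        + ∫ x, χ x * (W x * |q (x + (-(j : ℝ)) • h • e)|)) =
        ∫ x, M * ∑ j ∈ Finset.range (M + 1), (χ x * (W x * |q (x + (j : ℝ) • h • e)|)
          + χ x * (W x * |q (x + (-(j : ℝ)) • h • e)|)) := by
      rw [integral_const_mul, integral_finsetSum _ hii]
      congr 1
      exact Finset.sum_congr rfl fun j hj =>
        (integral_add (hshift _ (hjM j hj).1).1 (hshift _ (hjM j hj).2).1).symm
    rw [heq]
    refine integral_mono_of_nonneg (Filter.Eventually.of_forall fun x => ?_)
      ((integrable_finsetSum _ hii).const_mul _) (Filter.Eventually.of_forall fun x => ?_)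
    · exact mul_nonneg (mul_nonneg (hχn x) (hW0 x)) (abs_nonneg _)
    · have h1 := abs_sub_avg_le_secondDiff M (h • e) p x
      have h2 := mul_le_mul_of_nonneg_left h1 (mul_nonneg (hχn x) (hW0 x))
      refine h2.trans (le_of_eq ?_)
      rw [mul_left_comm, Finset.mul_sum]
      congr 1
      refine Finset.sum_congr rfl fun j _ => ?_
      rw [hcancel]
      ring
  have hstep2 : ∫ x, χ x * W x * |p x - avg M (h • e) p x| ≤
      2 * M * (M + 1) * (I + 2 * M * h * (A * h * ballVol d)) := by
    refine hstep1.trans ?_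
    have : ∑ j ∈ Finset.range (M + 1), ((∫ x, χ x * (W x * |q (x + (j : ℝ) • h • e)|))
        + ∫ x, χ x * (W x * |q (x + (-(j : ℝ)) • h • e)|)) ≤
        ∑ _j ∈ Finset.range (M + 1), (2 * (I + 2 * M * h * (A * h * ballVol d))) := by
      refine Finset.sum_le_sum fun j hj => ?_
      have h1 := (hshift _ (hjM j hj).1).2
      have h2 := (hshift _ (hjM j hj).2).2
      linarith
    rw [Finset.sum_const, Finset.card_range, nsmul_eq_mul] at this
    push_cast at this
    calc _ ≤ (M : ℝ) * (((M : ℝ) + 1) * (2 * (I + 2 * M * h * (A * h * ballVol d)))) := by gcongr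
      _ = _ := by ring
  have hstep3 : I ≤ h * ((∫ x, χ x * W x) / (2 * s)
      + s / 2 * ∫ x, χ x * (W x * (q x / h) ^ 2)) := by
    have hiW : Integrable fun x => χ x * W x :=
      integrable_mul_of_lipschitz hχ hχ0 hWm (B := A) fun x => by
        rw [abs_of_nonneg (hW0 x)]; exact hWA x
    have hiq : Integrable fun x => χ x * (W x * (q x / h) ^ 2) := by
      refine integrable_mul_of_lipschitz hχ hχ0 (hWm.mul ((hqm.div_const h).pow_const 2))
        (B := A * 4) fun x => abs_weight_mul_le hW0 hWA ?_ x
      rw [abs_of_nonneg (sq_nonneg _), ← sq_abs, abs_div, abs_of_pos hh]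
      have : |q x| / h ≤ 2 := by rw [div_le_iff₀ hh]; exact hqb x
      have h0 : 0 ≤ |q x| / h := by positivity
      nlinarith
    have heq : h * ((∫ x, χ x * W x) / (2 * s) + s / 2 * ∫ x, χ x * (W x * (q x / h) ^ 2)) =
        ∫ x, h * ((1 / (2 * s)) * (χ x * W x) + s / 2 * (χ x * (W x * (q x / h) ^ 2))) := by
      rw [integral_const_mul, integral_add (hiW.const_mul _) (hiq.const_mul _),
        integral_const_mul, integral_const_mul]
      ring
    rw [heq]
    refine integral_mono_of_nonneg (Filter.Eventually.of_forall fun x => ?_)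
      (((hiW.const_mul _).add (hiq.const_mul _)).const_mul _)
      (Filter.Eventually.of_forall fun x => ?_)
    · exact mul_nonneg (hχn x) (mul_nonneg (hW0 x) (abs_nonneg _))
    · have hy : |q x| / h ≤ 1 / (2 * s) + s / 2 * (q x / h) ^ 2 := by
        have e1 : (q x / h) ^ 2 = (|q x| / h) ^ 2 := by rw [div_pow, div_pow, sq_abs]
        rw [e1]
        have h1 : 1 / (2 * s) + s / 2 * (|q x| / h) ^ 2 - |q x| / h =
            (s * (|q x| / h) - 1) ^ 2 / (2 * s) := by
          field_simp
          ring
        have : 0 ≤ (s * (|q x| / h) - 1) ^ 2 / (2 * s) := by positivity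
        linarith
      have hy' : |q x| ≤ h * (1 / (2 * s) + s / 2 * (q x / h) ^ 2) := by
        rwa [div_le_iff₀ hh, mul_comm] at hy
      have := mul_le_mul_of_nonneg_left hy' (mul_nonneg (hχn x) (hW0 x))
      linarith
  have hstep4 := integral_secondDiff_sq_le hχ hχ0 hWm hW0 hWA hWe he hp hh hh1
  refine hstep2.trans ?_
  have h5 : I + 2 * M * h * (A * h * ballVol d) ≤ h * ((∫ x, χ x * W x) / (2 * s)
      + 2 * s * (energy χ W h e p - energy χ W (2 * h) e p)
        + (3 * s + 2 * M) * (A * h * ballVol d)) := by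
    have h6 := mul_le_mul_of_nonneg_left hstep4 (show 0 ≤ h * (s / 2) by positivity)
    linarith
  have h7 := mul_le_mul_of_nonneg_left h5 (show (0 : ℝ) ≤ 2 * M * (M + 1) by positivity)
  linarith

lemma lipschitzWith_diffQuot (hh : 0 < h) (hp : LipschitzWith 1 p) :
    LipschitzWith (2 / h).toNNReal (diffQuot h e p) := by
  refine LipschitzWith.of_dist_le_mul fun x y => ?_
  rw [Real.coe_toNNReal _ (by positivity), Real.dist_eq, diffQuot, diffQuot, ← sub_div, abs_div,
    abs_of_pos hh, div_mul_eq_mul_div]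
  gcongr
  have h1 := lipschitz_abs_sub_le hp (x + h • e) (y + h • e)
  have h2 := lipschitz_abs_sub_le hp x y
  rw [add_sub_add_right_eq_sub] at h1
  rw [← dist_eq_norm] at h1 h2
  rw [abs_le] at *
  constructor <;> linarith [h1.1, h1.2, h2.1, h2.2]

/-- Multiplying the weight by a rapidly oscillating factor changes the energy little. -/
lemma abs_integral_energy_mul_antiperiodic_le (hχ : LipschitzWith 1 χ)
    (hχ0 : ∀ x, x ∉ cube d → χ x = 0) (hχn : ∀ x, 0 ≤ χ x) (hχ1 : ∀ x, χ x ≤ 1) {A L : ℝ≥0}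
    (hW0 : ∀ x, 0 ≤ W x) (hWA : ∀ x, W x ≤ A) (hWL : LipschitzWith L W) (he : ‖e‖ = 1)
    (hp : LipschitzWith 1 p) (hh : 0 < h) {ω : Euc d → ℝ} (hω : Measurable ω)
    (hω1 : ∀ x, |ω x| ≤ 1) {v : Euc d} (hv : ‖v‖ ≤ 1) (hanti : ∀ x, ω (x + v) = -ω x) :
    |∫ x, χ x * (W x * diffQuot h e p x ^ 2) * ω x| ≤
      (A * (4 / h) + L + A) * ‖v‖ * ballVol d := by
  have h1 := lipschitzWith_diffQuot (e := e) hh hp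
  have hb : ∀ x, |diffQuot h e p x| ≤ (1 : ℝ≥0) := fun x => abs_diffQuot_le hh he hp x
  have h2 := lipschitzWith_mul h1 h1 hb fun x _ => hb x
  have h3 := lipschitzWith_mul hWL h2 (A := A) (B := 1)
    (fun x => by rw [abs_of_nonneg (hW0 x)]; exact hWA x) fun x _ => by
      rw [← sq, abs_of_nonneg (sq_nonneg _)]; exact diffQuot_sq_le hh he hp x
  have h4 := lipschitzWith_mul hχ h3 (A := 1) (B := A)
    (fun x => by rw [abs_of_nonneg (hχn x)]; exact hχ1 x) fun x _ => by
      rw [← sq]; exact abs_weight_mul_diffQuot_sq_le hW0 hWA hh he hp x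
  have h5 := abs_integral_mul_antiperiodic_le h4 (fun x hx => by rw [hχ0 x hx, zero_mul]) hω hω1
    hv hanti
  simp only [← sq] at h5
  refine h5.trans (le_of_eq ?_)
  push_cast
  rw [Real.coe_toNNReal _ (by positivity)]
  ring

end

/-! ### Oscillations, weights and scales. -/

/-- A `1`-periodic Lipschitz function with values in `[-1, 1]` that changes sign under translation
by `1 / 2` and equals `-1` on an interval of length `1 / 3`. -/
def osc (y : ℝ) : ℝ := max (-1) (min 1 (2 * Real.cos (2 * Real.pi * y)))

lemma abs_osc_le (y : ℝ) : |osc y| ≤ 1 :=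
  abs_le.2 ⟨le_max_left _ _, max_le (by norm_num) (min_le_left _ _)⟩

lemma osc_add_half (y : ℝ) : osc (y + 1 / 2) = -osc y := by
  have h : 2 * Real.pi * (y + 1 / 2) = 2 * Real.pi * y + Real.pi := by ring
  rw [osc, osc, h, Real.cos_add_pi]
  grind

lemma lipschitzWith_osc : LipschitzWith 13 osc := by
  have h1 : LipschitzWith 13 (fun y : ℝ => 2 * Real.cos (2 * Real.pi * y)) := by
    refine LipschitzWith.of_dist_le_mul fun x y => ?_
    rw [Real.dist_eq, Real.dist_eq, ← mul_sub, abs_mul, abs_two]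
    have h2 := Real.abs_cos_sub_cos_le (2 * Real.pi * x) (2 * Real.pi * y)
    rw [← mul_sub, abs_mul, abs_of_pos Real.two_pi_pos] at h2
    -- The constant 13 is a round bound for `4 π`.
    have h3 : 2 * (2 * Real.pi) ≤ 13 := by linarith [Real.pi_lt_d2]
    calc 2 * |Real.cos (2 * Real.pi * x) - Real.cos (2 * Real.pi * y)|
        ≤ 2 * (2 * Real.pi * |x - y|) := by gcongr
      _ = 2 * (2 * Real.pi) * |x - y| := by ring
      _ ≤ 13 * |x - y| := by gcongr
      _ = _ := by norm_num
  exact (h1.const_min 1).const_max (-1)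

/-- A bump function supported in the cube. -/
def bump (d : ℕ) (x : Euc d) : ℝ := min 1 (Metric.infDist x (interior (cube d))ᶜ)

lemma lipschitzWith_bump (d : ℕ) : LipschitzWith 1 (bump d) :=
  (Metric.lipschitz_infDist_pt _).const_min 1

lemma bump_nonneg {d : ℕ} (x : Euc d) : 0 ≤ bump d x := le_min zero_le_one Metric.infDist_nonneg

lemma bump_le_one {d : ℕ} (x : Euc d) : bump d x ≤ 1 := min_le_left _ _

lemma abs_bump_le_one {d : ℕ} (x : Euc d) : |bump d x| ≤ 1 := by
  rw [abs_of_nonneg (bump_nonneg x)]; exact bump_le_one x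

lemma bump_eq_zero_of_notMem_interior {d : ℕ} {x : Euc d} (hx : x ∉ interior (cube d)) :
    bump d x = 0 := by
  rw [bump, Metric.infDist_zero_of_mem (show x ∈ (interior (cube d))ᶜ from hx)]
  exact min_eq_right zero_le_one

lemma bump_eq_zero {d : ℕ} (x : Euc d) (hx : x ∉ cube d) : bump d x = 0 :=
  bump_eq_zero_of_notMem_interior fun h => hx (interior_subset h)

lemma integrable_bump_mul {d : ℕ} {ω : Euc d → ℝ} (hω : Measurable ω) {B : ℝ}
    (hB : ∀ x, |ω x| ≤ B) : Integrable (fun x => bump d x * ω x) :=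
  integrable_mul_of_lipschitz (lipschitzWith_bump d) bump_eq_zero hω hB

lemma abs_coord_sub_le {d : ℕ} (i : Fin d) (x y : Euc d) : |x i - y i| ≤ dist x y := by
  rw [dist_eq_norm]
  exact PiLp.norm_apply_le (x - y) i

/-- The Riesz-type product of the rescaled oscillating factors `1 + osc` in the variable `x i`. -/
def weight {d : ℕ} (i : Fin d) (N k : ℕ) (x : Euc d) : ℝ :=
  ∏ j ∈ Finset.range k, (1 + osc ((N : ℝ) ^ (2 * (j + 1)) * x i))

/-- The oscillation at the `k`-th scale, in the variable `x i`. -/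
def wave {d : ℕ} (i : Fin d) (N k : ℕ) (x : Euc d) : ℝ :=
  Real.cos (Real.pi * ((N : ℝ) ^ (2 * k + 1) * x i))

/-- The `k`-th scale. -/
def step (N k : ℕ) : ℝ := 1 / (N : ℝ) ^ (2 * k + 1)

section

variable {d : ℕ} {i : Fin d} {N : ℕ}

lemma weight_succ (k : ℕ) (x : Euc d) : weight i N (k + 1) x =
    weight i N k x * (1 + osc ((N : ℝ) ^ (2 * (k + 1)) * x i)) :=
  Finset.prod_range_succ _ _

lemma one_add_osc_nonneg (y : ℝ) : 0 ≤ 1 + osc y := by linarith [(abs_le.1 (abs_osc_le y)).1]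

lemma one_add_osc_le (y : ℝ) : 1 + osc y ≤ 2 := by linarith [(abs_le.1 (abs_osc_le y)).2]

lemma weight_nonneg (k : ℕ) (x : Euc d) : 0 ≤ weight i N k x :=
  Finset.prod_nonneg fun _ _ => one_add_osc_nonneg _

lemma weight_le (k : ℕ) (x : Euc d) : weight i N k x ≤ 2 ^ k := by
  refine (Finset.prod_le_prod (fun _ _ => one_add_osc_nonneg _)
    fun _ _ => one_add_osc_le _).trans ?_
  simp

lemma abs_weight_le (k : ℕ) (x : Euc d) : |weight i N k x| ≤ 2 ^ k := by
  rw [abs_of_nonneg (weight_nonneg k x)]; exact weight_le k x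

lemma measurable_osc_coord (c : ℝ) : Measurable fun x : Euc d => osc (c * x i) := by
  have := lipschitzWith_osc.continuous
  fun_prop

lemma measurable_weight (k : ℕ) : Measurable (weight (d := d) i N k) :=
  Finset.measurable_fun_prod _ fun _ _ => (measurable_osc_coord _).const_add 1

/-- Weights vary in `x i` only, whereas waves and differences run along another axis `j`. Having two
different axes is the use of `d ≥ 2`. -/
lemma weight_add_smul_single {j : Fin d} (hij : i ≠ j) (k : ℕ) (x : Euc d) (t : ℝ) :
    weight i N k (x + t • EuclideanSpace.single j 1) = weight i N k x := by
  simp [weight, hij]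

lemma lipschitzWith_coord_comp {f : ℝ → ℝ} {K : ℝ≥0} (hf : LipschitzWith K f) (c : ℝ≥0) :
    LipschitzWith (K * c) (fun x : Euc d => f (c * x i)) := by
  refine LipschitzWith.of_dist_le_mul fun x y => ?_
  refine (hf.dist_le_mul _ _).trans ?_
  rw [Real.dist_eq, ← mul_sub, abs_mul, NNReal.abs_eq]
  push_cast
  rw [mul_assoc]
  gcongr
  exact abs_coord_sub_le i x y

/-- The last, fastest factor dominates. The base 4, instead of the sup bound's 2, absorbs the
induction: `13 + 26 ≤ 13 * 4`. -/
lemma lipschitzWith_weight (hN : 1 ≤ N) (k : ℕ) :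
    LipschitzWith (13 * 4 ^ k * (N : ℝ≥0) ^ (2 * k)) (weight (d := d) i N k) := by
  induction k with
  | zero =>
    have : weight (d := d) i N 0 = fun _ => 1 := by
      funext x; simp [weight]
    rw [this]
    exact (LipschitzWith.const 1).weaken (by positivity)
  | succ k ih =>
    have h1 : LipschitzWith (13 * (N : ℝ≥0) ^ (2 * (k + 1)))
        (fun x : Euc d => 1 + osc ((N : ℝ) ^ (2 * (k + 1)) * x i)) := by
      have h2 := lipschitzWith_coord_comp (i := i) lipschitzWith_osc ((N : ℝ≥0) ^ (2 * (k + 1)))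
      push_cast at h2
      refine LipschitzWith.of_dist_le_mul fun x y => ?_
      rw [dist_add_left]
      exact h2.dist_le_mul x y
    have h3 := lipschitzWith_mul ih h1 (A := 2 ^ k) (B := 2)
      (fun x => by push_cast; exact abs_weight_le k x) (fun x _ => by
        rw [abs_of_nonneg (one_add_osc_nonneg _)]; exact one_add_osc_le _)
    have h4 : weight (d := d) i N (k + 1) = fun x => weight i N k x *
        (1 + osc ((N : ℝ) ^ (2 * (k + 1)) * x i)) := funext fun x => weight_succ k x
    rw [h4]
    refine h3.weaken ?_
    have hN' : (1 : ℝ≥0) ≤ N := by exact_mod_cast hN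
    have e1 : (N : ℝ≥0) ^ (2 * k) ≤ (N : ℝ≥0) ^ (2 * (k + 1)) :=
      pow_le_pow_right₀ hN' (by omega)
    have e2 : (2 : ℝ≥0) ^ k ≤ 4 ^ k := pow_le_pow_left₀ (by norm_num) (by norm_num) k
    calc 2 ^ k * (13 * (N : ℝ≥0) ^ (2 * (k + 1))) + 2 * (13 * 4 ^ k * (N : ℝ≥0) ^ (2 * k))
        ≤ 4 ^ k * (13 * (N : ℝ≥0) ^ (2 * (k + 1)))
          + 2 * (13 * 4 ^ k * (N : ℝ≥0) ^ (2 * (k + 1))) := by gcongr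
      _ = 39 * (4 ^ k * (N : ℝ≥0) ^ (2 * (k + 1))) := by ring
      _ ≤ 52 * (4 ^ k * (N : ℝ≥0) ^ (2 * (k + 1))) := by gcongr; norm_num
      _ = _ := by ring

lemma step_pos (hN : 1 ≤ N) (k : ℕ) : 0 < step N k := by
  have : (0 : ℝ) < N := by exact_mod_cast hN
  unfold step; positivity

lemma norm_step_smul_single (hN : 1 ≤ N) (k : ℕ) :
    ‖step N k • (EuclideanSpace.single i (1 : ℝ) : Euc d)‖ = step N k := by
  rw [norm_smul, PiLp.norm_single, norm_one, mul_one, Real.norm_of_nonneg (step_pos hN k).le]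

lemma step_le (hN : 1 ≤ N) (k : ℕ) : step N k ≤ 1 / N := by
  have hN' : (1 : ℝ) ≤ N := by exact_mod_cast hN
  unfold step
  gcongr
  exact le_self_pow₀ hN' (by omega)

lemma one_div_le_one (hN : 1 ≤ N) : 1 / (N : ℝ) ≤ 1 := by
  have hN' : (1 : ℝ) ≤ N := by exact_mod_cast hN
  rw [div_le_one (by linarith)]
  exact hN'

lemma pow_mul_step (hN : 1 ≤ N) (k : ℕ) : (N : ℝ) ^ (2 * k) * step N k = 1 / N := by
  have : (0 : ℝ) < N := by exact_mod_cast hN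
  rw [step, pow_succ]
  field_simp

lemma abs_wave_le (k : ℕ) (x : Euc d) : |wave i N k x| ≤ 1 := Real.abs_cos_le_one _

lemma measurable_wave (k : ℕ) : Measurable (wave (d := d) i N k) := by
  unfold wave; fun_prop

lemma lipschitzWith_wave (k : ℕ) :
    LipschitzWith (4 * (N : ℝ≥0) ^ (2 * k + 1)) (wave (d := d) i N k) := by
  have h1 : LipschitzWith 4 (fun y : ℝ => Real.cos (Real.pi * y)) := by
    refine LipschitzWith.of_dist_le_mul fun x y => ?_
    refine (Real.abs_cos_sub_cos_le _ _).trans ?_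
    rw [← mul_sub, abs_mul, abs_of_pos Real.pi_pos, Real.dist_eq]
    gcongr
    exact Real.pi_le_four
  have h2 := lipschitzWith_coord_comp (i := i) h1 ((N : ℝ≥0) ^ (2 * k + 1))
  push_cast at h2
  exact h2

lemma wave_add_step (hN : 1 ≤ N) (k : ℕ) (x : Euc d) :
    wave i N k (x + step N k • EuclideanSpace.single i 1) = -wave i N k x := by
  have : (N : ℝ) ≠ 0 := by exact_mod_cast (by omega : N ≠ 0)
  rw [wave, wave, ← Real.cos_add_pi]
  congr 1
  simp [step]
  field_simp

/-- The translation by half a period of the `k + 1`-st factor of the weight. -/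
def halfPeriod {d : ℕ} (i : Fin d) (N k : ℕ) : Euc d :=
  (1 / (2 * (N : ℝ) ^ (2 * (k + 1)))) • EuclideanSpace.single i (1 : ℝ)

lemma osc_add_halfPeriod (hN : 1 ≤ N) (k : ℕ) (x : Euc d) :
    osc ((N : ℝ) ^ (2 * (k + 1)) * (x + halfPeriod i N k) i) =
      -osc ((N : ℝ) ^ (2 * (k + 1)) * x i) := by
  have : (N : ℝ) ≠ 0 := by exact_mod_cast (by omega : N ≠ 0)
  rw [← osc_add_half]
  congr 1
  simp [halfPeriod]
  field_simp

lemma norm_halfPeriod_le (hN : 1 ≤ N) (k : ℕ) :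
    ‖halfPeriod (d := d) i N k‖ ≤ 1 / (N : ℝ) ^ (2 * k + 2) := by
  have : (0 : ℝ) < N := by exact_mod_cast hN
  rw [halfPeriod, norm_smul, PiLp.norm_single, norm_one, mul_one, Real.norm_of_nonneg
    (by positivity)]
  have h2 : 2 * (k + 1) = 2 * k + 2 := by ring
  rw [h2]
  gcongr
  have : (0 : ℝ) < (N : ℝ) ^ (2 * k + 2) := by positivity
  linarith

lemma inv_pow_le_one (hN : 1 ≤ N) (n : ℕ) : 1 / (N : ℝ) ^ n ≤ 1 := by
  have hN' : (1 : ℝ) ≤ N := by exact_mod_cast hN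
  rw [div_le_one (by positivity)]
  exact one_le_pow₀ hN'

lemma two_pow_le_four_pow (k : ℕ) : (2 : ℝ) ^ k ≤ 4 ^ k :=
  pow_le_pow_left₀ (by norm_num) (by norm_num) k

lemma lipschitzWith_bump_mul_weight (hN : 1 ≤ N) (k : ℕ) :
    LipschitzWith (14 * 4 ^ k * (N : ℝ≥0) ^ (2 * k)) (fun x => bump d x * weight i N k x) := by
  have h := lipschitzWith_mul (lipschitzWith_bump d) (lipschitzWith_weight (i := i) hN k)
    (A := 1) (B := 2 ^ k) abs_bump_le_one (fun x _ => by push_cast; exact abs_weight_le k x)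
  refine h.weaken ?_
  have hN' : (1 : ℝ≥0) ≤ N := by exact_mod_cast hN
  have e1 : (1 : ℝ≥0) ≤ (N : ℝ≥0) ^ (2 * k) := one_le_pow₀ hN'
  have e2 : (2 : ℝ≥0) ^ k ≤ 4 ^ k := pow_le_pow_left₀ (by norm_num) (by norm_num) k
  calc 1 * (13 * 4 ^ k * (N : ℝ≥0) ^ (2 * k)) + 2 ^ k * 1
      ≤ 1 * (13 * 4 ^ k * (N : ℝ≥0) ^ (2 * k)) + 4 ^ k * (N : ℝ≥0) ^ (2 * k) := by gcongr
    _ = _ := by ring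

/-- A Lipschitz constant of order `N ^ m` against a period of order `N ^ (-n)`. The separation of
scales leaves at least one factor `1 / N`, so errors take the common form `4 ^ k * ballVol d / N`.
-/
lemma pow_mul_inv_pow_le (hN : 1 ≤ N) (k : ℕ) {m n : ℕ} (hmn : m + 1 ≤ n) {c : ℝ} (hc : 0 ≤ c) :
    c * 4 ^ k * (N : ℝ) ^ m * (1 / (N : ℝ) ^ n) * ballVol d ≤ c * (4 ^ k * ballVol d / N) := by
  have hN' : (1 : ℝ) ≤ N := by exact_mod_cast hN
  have hV := ballVol_nonneg d
  have h1 : (N : ℝ) ^ m * (1 / (N : ℝ) ^ n) ≤ 1 / N := by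
    rw [mul_one_div, div_le_div_iff₀ (by positivity) (by positivity), one_mul, ← pow_succ]
    exact pow_le_pow_right₀ hN' hmn
  calc c * 4 ^ k * (N : ℝ) ^ m * (1 / (N : ℝ) ^ n) * ballVol d
      = c * 4 ^ k * ballVol d * ((N : ℝ) ^ m * (1 / (N : ℝ) ^ n)) := by ring
    _ ≤ c * 4 ^ k * ballVol d * (1 / N) := by gcongr
    _ = _ := by ring

lemma integrable_bump_mul_weight (k : ℕ) :
    Integrable (fun x => bump d x * weight i N k x) :=
  integrable_bump_mul (measurable_weight k) (abs_weight_le k)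

/-! ### Masses of the weights and telescoping of energies. -/

/-- All weights have almost the same mass. -/
lemma abs_integral_weight_sub_le (hN : 1 ≤ N) (k : ℕ) :
    |(∫ x, bump d x * weight i N k x) - ∫ x, bump d x| ≤ 14 * (4 ^ k * ballVol d / N) := by
  have hN' : (1 : ℝ) ≤ N := by exact_mod_cast hN
  have hV := ballVol_nonneg d
  induction k with
  | zero =>
    simp only [weight, Finset.range_zero, Finset.prod_empty, mul_one, sub_self, abs_zero]
    positivity
  | succ k ih =>
    have h1 := abs_integral_mul_antiperiodic_le (lipschitzWith_bump_mul_weight (i := i) hN k)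
      (fun x hx => by rw [bump_eq_zero x hx, zero_mul])
      (measurable_osc_coord (i := i) ((N : ℝ) ^ (2 * (k + 1)))) (fun x => abs_osc_le _)
      ((norm_halfPeriod_le (i := i) hN k).trans (inv_pow_le_one hN _))
      (osc_add_halfPeriod hN k)
    have h2 : ∫ x, bump d x * weight i N (k + 1) x = (∫ x, bump d x * weight i N k x) +
        ∫ x, bump d x * weight i N k x * osc ((N : ℝ) ^ (2 * (k + 1)) * x i) := by
      rw [← integral_add (integrable_bump_mul_weight k)
        ((integrable_bump_mul_weight k).mul_bdd (c := 1)
          (measurable_osc_coord _).aestronglyMeasurable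
          (Filter.Eventually.of_forall fun x => abs_osc_le _))]
      congr 1
      funext x
      rw [weight_succ]
      ring
    have h3 : ((14 * 4 ^ k * (N : ℝ≥0) ^ (2 * k) : ℝ≥0) : ℝ) * ‖halfPeriod (d := d) i N k‖ * 1 *
        ballVol d ≤ 14 * (4 ^ k * ballVol d / N) := by
      refine le_trans ?_ (pow_mul_inv_pow_le hN k (m := 2 * k) (n := 2 * k + 2) (by omega)
        (by norm_num : (0 : ℝ) ≤ 14))
      push_cast
      rw [mul_one]
      gcongr
      exact norm_halfPeriod_le hN k
    have h4 : (0 : ℝ) ≤ 4 ^ k * ballVol d / N := by positivity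
    have h5 : (4 : ℝ) ^ (k + 1) * ballVol d / N = 4 * (4 ^ k * ballVol d / N) := by ring
    rw [h2, h5]
    have h6 := h1.trans h3
    rw [abs_le] at *
    constructor <;> linarith [h6.1, h6.2, ih.1, ih.2]

lemma norm_single_one : ‖(EuclideanSpace.single i (1 : ℝ) : Euc d)‖ = 1 := by
  rw [PiLp.norm_single, norm_one]

/-- The new factor of the weight oscillates at frequency `N ^ (2 * k + 2)`, while the energy density
at scale `step N k` is Lipschitz with constant of order `N ^ (2 * k + 1)`. The constant is `18 = 4 +
13 + 1`. -/
lemma energy_weight_le_succ {j : Fin d} (hN : 1 ≤ N) {p : Euc d → ℝ} (hp : LipschitzWith 1 p)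
    (k : ℕ) :
    energy (bump d) (weight i N k) (step N k) (EuclideanSpace.single j 1) p ≤
      energy (bump d) (weight i N (k + 1)) (step N k) (EuclideanSpace.single j 1) p
        + 18 * (4 ^ k * ballVol d / N) := by
  have hN' : (1 : ℝ) ≤ N := by exact_mod_cast hN
  have hV := ballVol_nonneg d
  set e : Euc d := EuclideanSpace.single j 1
  have h1 := abs_integral_energy_mul_antiperiodic_le (lipschitzWith_bump d) bump_eq_zero
    bump_nonneg bump_le_one (A := 2 ^ k) (weight_nonneg k)
    (fun x => by push_cast; exact weight_le k x) (lipschitzWith_weight (i := i) hN k)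
    (norm_single_one (i := j)) hp (step_pos hN k)
    (measurable_osc_coord (i := i) ((N : ℝ) ^ (2 * (k + 1)))) (fun x => abs_osc_le _)
    ((norm_halfPeriod_le (i := i) hN k).trans (inv_pow_le_one hN _))
    (osc_add_halfPeriod hN k)
  have hb : ∀ x, |weight i N k x * diffQuot (step N k) e p x ^ 2| ≤ 2 ^ k := fun x =>
    abs_weight_mul_diffQuot_sq_le (weight_nonneg k) (weight_le k) (step_pos hN k)
      (norm_single_one (i := j)) hp x
  have hi : Integrable fun x => bump d x * (weight i N k x * diffQuot (step N k) e p x ^ 2) :=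
    integrable_bump_mul
    ((measurable_weight (i := i) (N := N) k).mul ((measurable_diffQuot (h := step N k)
      (e := e) hp).pow_const 2)) hb
  have h2 : energy (bump d) (weight i N (k + 1)) (step N k) e p =
      energy (bump d) (weight i N k) (step N k) e p +
      ∫ x, bump d x * (weight i N k x * diffQuot (step N k) e p x ^ 2) *
        osc ((N : ℝ) ^ (2 * (k + 1)) * x i) := by
    rw [energy, energy, ← integral_add hi (hi.mul_bdd (c := 1)
          (measurable_osc_coord _).aestronglyMeasurable
          (Filter.Eventually.of_forall fun x => abs_osc_le _))]
    congr 1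
    funext x
    rw [weight_succ]
    ring
  have h3 : (((2 ^ k : ℝ≥0) : ℝ) * (4 / step N k) +
      ((13 * 4 ^ k * (N : ℝ≥0) ^ (2 * k) : ℝ≥0) : ℝ) + ((2 ^ k : ℝ≥0) : ℝ)) *
      ‖halfPeriod (d := d) i N k‖ * ballVol d ≤ 18 * (4 ^ k * ballVol d / N) := by
    refine le_trans ?_ (pow_mul_inv_pow_le hN k (m := 2 * k + 1) (n := 2 * k + 2) (by omega)
      (by norm_num : (0 : ℝ) ≤ 18))
    gcongr ?_ * ?_ * _
    · push_cast
      have e1 := two_pow_le_four_pow k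
      have e2 : 4 / step N k = 4 * (N : ℝ) ^ (2 * k + 1) := by
        rw [step]; field_simp
      have e3 : (N : ℝ) ^ (2 * k) ≤ (N : ℝ) ^ (2 * k + 1) := pow_le_pow_right₀ hN' (by omega)
      have e4 : (1 : ℝ) ≤ (N : ℝ) ^ (2 * k + 1) := one_le_pow₀ hN'
      rw [e2]
      calc (2 : ℝ) ^ k * (4 * (N : ℝ) ^ (2 * k + 1)) + 13 * 4 ^ k * (N : ℝ) ^ (2 * k) + 2 ^ k
          ≤ (4 : ℝ) ^ k * (4 * (N : ℝ) ^ (2 * k + 1)) + 13 * 4 ^ k * (N : ℝ) ^ (2 * k + 1)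
            + 4 ^ k * (N : ℝ) ^ (2 * k + 1) := by
            gcongr
            calc (2 : ℝ) ^ k ≤ 4 ^ k * 1 := by rw [mul_one]; exact e1
              _ ≤ _ := by gcongr
        _ = _ := by ring
    · exact norm_halfPeriod_le hN k
  rw [h2]
  have := (abs_le.1 (h1.trans h3)).1
  linarith

/-- Links one scale to the next: first the weight is refined at fixed step, then the step is
shortened at fixed weight. The step ends at twice the next scale, where the following energy drop
begins. -/
lemma energy_step_le {j : Fin d} (hij : i ≠ j) {a : ℕ} (ha : 1 ≤ a) {p : Euc d → ℝ}
    (hp : LipschitzWith 1 p) (k : ℕ) :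
    energy (bump d) (weight i (2 ^ a) k) (step (2 ^ a) k) (EuclideanSpace.single j 1) p ≤
      energy (bump d) (weight i (2 ^ a) (k + 1)) (2 * step (2 ^ a) (k + 1))
        (EuclideanSpace.single j 1) p
        + 20 * (4 ^ k * ballVol d / (2 ^ a : ℕ)) := by
  have hN : 1 ≤ 2 ^ a := Nat.one_le_two_pow
  have hV := ballVol_nonneg d
  have h1 := energy_weight_le_succ (i := i) (j := j) hN hp k
  have hst : 2 ^ (2 * a - 1) * (2 * step (2 ^ a) (k + 1)) = step (2 ^ a) k := by
    have e1 : (2 : ℝ) ^ (2 * a - 1) * 2 = (2 ^ a) ^ 2 := by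
      rw [← pow_succ, ← pow_mul]
      congr 1
      omega
    have e2 : 2 * (k + 1) + 1 = (2 * k + 1) + 2 := by ring
    rw [← mul_assoc, e1, step, step]
    push_cast
    rw [e2, pow_add _ _ 2]
    field_simp
    ring
  have h2 := energy_two_pow_mul_le (lipschitzWith_bump d) bump_eq_zero bump_nonneg
    (measurable_weight (i := i) (N := 2 ^ a) (k + 1)) (weight_nonneg (k + 1)) (weight_le (k + 1))
    (fun x t => weight_add_smul_single hij (k + 1) x t) (norm_single_one (i := j)) hp
    (h := 2 * step (2 ^ a) (k + 1)) (by have := step_pos hN (k + 1); positivity) (2 * a - 1)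
    (by rw [hst]; exact (step_le hN k).trans (one_div_le_one hN))
  rw [hst] at h2
  have h3 : (2 : ℝ) ^ (k + 1) * step (2 ^ a) k * ballVol d ≤
      2 * (4 ^ k * ballVol d / (2 ^ a : ℕ)) := by
    calc (2 : ℝ) ^ (k + 1) * step (2 ^ a) k * ballVol d
        = 2 * 2 ^ k * step (2 ^ a) k * ballVol d := by ring
      _ ≤ 2 * 4 ^ k * (1 / (2 ^ a : ℕ)) * ballVol d := by
          gcongr
          · exact (step_pos hN k).le
          · norm_num
          · exact step_le hN k
      _ = _ := by ring
  linarith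

/-- The total drop of the energy over all scales is bounded. -/
lemma sum_energy_drop_le {j : Fin d} (hij : i ≠ j) {a : ℕ} (ha : 1 ≤ a) {p : Euc d → ℝ}
    (hp : LipschitzWith 1 p) (K : ℕ) :
    ∑ k ∈ Finset.range K,
      (energy (bump d) (weight i (2 ^ a) k) (step (2 ^ a) k) (EuclideanSpace.single j 1) p -
        energy (bump d) (weight i (2 ^ a) k) (2 * step (2 ^ a) k)
          (EuclideanSpace.single j 1) p) ≤
      (∫ x, bump d x) + 34 * (4 ^ K * ballVol d / (2 ^ a : ℕ)) := by
  have hN : 1 ≤ 2 ^ a := Nat.one_le_two_pow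
  have hV := ballVol_nonneg d
  have hE0 : ∀ k h, 0 ≤ energy (bump d) (weight i (2 ^ a) k) h (EuclideanSpace.single j 1) p :=
    fun k h => integral_nonneg fun x =>
      mul_nonneg (bump_nonneg x) (mul_nonneg (weight_nonneg k x) (sq_nonneg _))
  -- Telescoping: the energy at scale `K` pays for all previous drops. The errors grow by the factor
  -- 4, so they stay within the last one.
  have hmain : ∀ K, ∑ k ∈ Finset.range (K + 1),
      (energy (bump d) (weight i (2 ^ a) k) (step (2 ^ a) k) (EuclideanSpace.single j 1) p -
        energy (bump d) (weight i (2 ^ a) k) (2 * step (2 ^ a) k)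
          (EuclideanSpace.single j 1) p) ≤
      energy (bump d) (weight i (2 ^ a) K) (step (2 ^ a) K) (EuclideanSpace.single j 1) p
        + 20 * (4 ^ K * ballVol d / (2 ^ a : ℕ)) := by
    intro K
    induction K with
    | zero =>
      have := hE0 0 (2 * step (2 ^ a) 0)
      have : (0 : ℝ) ≤ 20 * (4 ^ 0 * ballVol d / (2 ^ a : ℕ)) := by positivity
      simp only [zero_add, Finset.sum_range_one]
      linarith
    | succ K ih =>
      rw [Finset.sum_range_succ]
      have h1 := energy_step_le hij ha hp K
      have h2 : (4 : ℝ) ^ (K + 1) * ballVol d / (2 ^ a : ℕ) =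
          4 * (4 ^ K * ballVol d / (2 ^ a : ℕ)) := by ring
      have h3 : (0 : ℝ) ≤ 4 ^ K * ballVol d / (2 ^ a : ℕ) := by positivity
      rw [h2]
      linarith
  have hc : 0 ≤ ∫ x, bump d x := integral_nonneg bump_nonneg
  cases K with
  | zero =>
    simp only [Finset.range_zero, Finset.sum_empty]
    positivity
  | succ K =>
    refine (hmain K).trans ?_
    have h1 : energy (bump d) (weight i (2 ^ a) K) (step (2 ^ a) K)
        (EuclideanSpace.single j 1) p ≤ ∫ x, bump d x * weight i (2 ^ a) K x := by
      refine integral_mono_of_nonneg (Filter.Eventually.of_forall fun x =>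
        mul_nonneg (bump_nonneg x) (mul_nonneg (weight_nonneg K x) (sq_nonneg _)))
        (integrable_bump_mul_weight K) (Filter.Eventually.of_forall fun x => ?_)
      refine mul_le_mul_of_nonneg_left ?_ (bump_nonneg x)
      exact mul_le_of_le_one_right (weight_nonneg K x)
        (diffQuot_sq_le (step_pos hN K) (norm_single_one (i := j)) hp x)
    have h2 := (abs_le.1 (abs_integral_weight_sub_le (d := d) (i := i) hN K)).2
    have h3 : (4 : ℝ) ^ (K + 1) * ballVol d / (2 ^ a : ℕ) =
          4 * (4 ^ K * ballVol d / (2 ^ a : ℕ)) := by ring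
    have h4 : (0 : ℝ) ≤ 4 ^ K * ballVol d / (2 ^ a : ℕ) := by positivity
    rw [h3]
    linarith

end

/-! ### Upper bound: the test function against Jacobians. -/

/-- The function that is almost orthogonal to all Jacobians: a sum over many scales of oscillations
in the variable `x j`, concentrated on smaller and smaller sets of the variable `x i`. -/
def testFun {d : ℕ} (i j : Fin d) (N K : ℕ) (x : Euc d) : ℝ :=
  bump d x * ∑ k ∈ Finset.range K, weight i N k x * wave j N k x

section

variable {d : ℕ} {i j : Fin d} {N : ℕ}

lemma two_pow_mul_step_mul_ballVol_le (hN : 1 ≤ N) (k : ℕ) :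
    2 ^ k * step N k * ballVol d ≤ 4 ^ k * ballVol d / N := by
  have hV := ballVol_nonneg d
  calc 2 ^ k * step N k * ballVol d ≤ 4 ^ k * (1 / N) * ballVol d := by
        gcongr
        · exact (step_pos hN k).le
        · norm_num
        · exact step_le hN k
    _ = _ := by ring

/-- The Lipschitz constant `4 / step N k` of the wave cancels the factor `step N k` of
`integral_abs_sub_avg_le`. Apart from masses and energy drops, only errors with a factor `1 / N`
remain. -/
lemma abs_integral_wave_mul_jac_le (hij : i ≠ j) (hN : 1 ≤ N) {p : Fin d → Euc d → ℝ}
    (hp : ∀ l, LipschitzWith 1 (p l)) {f : Euc d → ℝ} (hf : LipschitzWith 1 f)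
    (hf1 : ∀ x ∈ cube d, |f x| ≤ 1) {M : ℕ} (hM : M ≤ N) {s : ℝ} (hs : 0 < s) (k : ℕ) :
    |∫ x, bump d x * f x * weight i N k x * wave j N k x * jac p x| ≤
      d.factorial * (4 * (2 * M * (M + 1) * (d * ((∫ x, bump d x * weight i N k x) / (2 * s))
        + 2 * s * ∑ l,
          (energy (bump d) (weight i N k) (step N k) (EuclideanSpace.single j 1) (p l) -
          energy (bump d) (weight i N k) (2 * step N k) (EuclideanSpace.single j 1) (p l))
        + d * ((3 * s + 2 * M) * (4 ^ k * ballVol d / N)))))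
      + d.factorial * ((15 * d * M + 2) * (4 ^ k * ballVol d / N))
      + d * (d.factorial * (2 / (2 * M + 1))) * ∫ x, bump d x * weight i N k x := by
  have hN' : (1 : ℝ) ≤ N := by exact_mod_cast hN
  have hV := ballVol_nonneg d
  have hpos := step_pos hN k
  set E : ℝ := 4 ^ k * ballVol d / N with hE
  set e : Euc d := EuclideanSpace.single j 1
  have hbf : ∀ x, bump d x ≠ 0 → |f x| ≤ (1 : ℝ≥0) := fun x hx => hf1 x (by
    by_contra h
    exact hx (bump_eq_zero x h))
  have hF : LipschitzWith 2 (fun x => bump d x * f x) :=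
    (lipschitzWith_mul (lipschitzWith_bump d) hf (A := 1) (B := 1) abs_bump_le_one hbf).weaken
      (by norm_num)
  have hFb : ∀ x, |bump d x * f x| ≤ bump d x := by
    intro x
    rw [abs_mul, abs_of_nonneg (bump_nonneg x)]
    by_cases hx : bump d x = 0
    · simp [hx]
    · exact mul_le_of_le_one_right (bump_nonneg x) (hbf x hx)
  have hG : LipschitzWith (15 * 4 ^ k * (N : ℝ≥0) ^ (2 * k))
      (fun x => bump d x * f x * weight i N k x) := by
    refine (lipschitzWith_mul hF (lipschitzWith_weight (i := i) hN k) (A := 1) (B := 2 ^ k)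
      (fun x => (hFb x).trans (bump_le_one x))
      (fun x _ => by push_cast; exact abs_weight_le k x)).weaken ?_
    have hN'' : (1 : ℝ≥0) ≤ N := by exact_mod_cast hN
    have e1 : (1 : ℝ≥0) ≤ (N : ℝ≥0) ^ (2 * k) := one_le_pow₀ hN''
    have e2 : (2 : ℝ≥0) ^ k ≤ 4 ^ k := pow_le_pow_left₀ (by norm_num) (by norm_num) k
    calc 1 * (13 * 4 ^ k * (N : ℝ≥0) ^ (2 * k)) + 2 ^ k * 2
        ≤ 1 * (13 * 4 ^ k * (N : ℝ≥0) ^ (2 * k)) + (4 ^ k * (N : ℝ≥0) ^ (2 * k)) * 2 := by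
          gcongr
          calc (2 : ℝ≥0) ^ k ≤ 4 ^ k * 1 := by rw [mul_one]; exact e2
            _ ≤ _ := by gcongr
      _ = _ := by ring
  have hδ : ∀ x, |bump d x * f x * weight i N k x - bump d (x + step N k • e) *
      f (x + step N k • e) * weight i N k (x + step N k • e)| ≤ 2 * (2 ^ k * step N k) := by
    intro x
    rw [weight_add_smul_single hij, ← sub_mul, abs_mul]
    have h1 := hF.dist_le_mul x (x + step N k • e)
    rw [Real.dist_eq, dist_eq_norm, sub_add_cancel_left, norm_neg,
      norm_step_smul_single hN k] at h1
    calc _ ≤ (((2 : ℝ≥0) : ℝ) * step N k) * 2 ^ k := by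
          gcongr
          exact abs_weight_le k x
      _ = _ := by push_cast; ring
  have hmain := abs_integral_oscillating_mul_jac_le hp (A := 2 ^ k)
    (ω := fun x => bump d x * weight i N k x) hG
    (fun x hx => by rw [bump_eq_zero x hx, zero_mul, zero_mul])
    (fun x => by
      rw [abs_mul, abs_of_nonneg (weight_nonneg k x)]
      exact mul_le_mul_of_nonneg_right (hFb x) (weight_nonneg k x))
    (fun x => by
      push_cast
      exact (mul_le_of_le_one_left (weight_nonneg k x) (bump_le_one x)).trans (weight_le k x))
    (integrable_bump_mul_weight k) (lipschitzWith_wave (i := j) k) (abs_wave_le k)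
    (v := step N k • e) (by
      rw [norm_step_smul_single hN k]
      exact (step_le hN k).trans (one_div_le_one hN))
    (wave_add_step hN k) hδ M
  rw [norm_step_smul_single hN k] at hmain
  refine hmain.trans ?_
  have hst := two_pow_mul_step_mul_ballVol_le (d := d) hN k
  have hMh : M * step N k ≤ 1 := by
    calc M * step N k ≤ N * (1 / N) := by
          gcongr
          exact step_le hN k
      _ = 1 := by field_simp
  have hsum : ((4 * (N : ℝ≥0) ^ (2 * k + 1) : ℝ≥0) : ℝ) *
      ∑ l, ∫ x, bump d x * weight i N k x * |p l x - avg M (step N k • e) (p l) x| ≤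
      4 * (2 * M * (M + 1) * (d * ((∫ x, bump d x * weight i N k x) / (2 * s))
        + 2 * s * ∑ l, (energy (bump d) (weight i N k) (step N k) e (p l) -
          energy (bump d) (weight i N k) (2 * step N k) e (p l))
        + d * ((3 * s + 2 * M) * E))) := by
    have h1 : ∀ l ∈ Finset.univ,
        ∫ x, bump d x * weight i N k x * |p l x - avg M (step N k • e) (p l) x| ≤
        step N k * (2 * M * (M + 1) * ((∫ x, bump d x * weight i N k x) / (2 * s)
        + 2 * s * (energy (bump d) (weight i N k) (step N k) e (p l) -
          energy (bump d) (weight i N k) (2 * step N k) e (p l))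
        + (3 * s + 2 * M) * E)) := by
      intro l _
      refine (integral_abs_sub_avg_le (lipschitzWith_bump d) bump_eq_zero bump_nonneg
        (measurable_weight k) (weight_nonneg k) (weight_le k)
        (fun x t => weight_add_smul_single hij k x t) (norm_single_one (i := j)) (hp l) hpos
        ((step_le hN k).trans (one_div_le_one hN)) M hMh hs).trans ?_
      gcongr
    have h2 := Finset.sum_le_sum h1
    have h3 : ((4 * (N : ℝ≥0) ^ (2 * k + 1) : ℝ≥0) : ℝ) * step N k = 4 := by
      push_cast
      rw [step]
      field_simp
    refine (mul_le_mul_of_nonneg_left h2 (NNReal.coe_nonneg _)).trans (le_of_eq ?_)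
    rw [← Finset.mul_sum, ← mul_assoc, h3, ← Finset.mul_sum, Finset.sum_add_distrib,
      Finset.sum_add_distrib, ← Finset.mul_sum]
    simp
  have hterm : (d : ℝ) * (M * step N k *
      (((15 * 4 ^ k * (N : ℝ≥0) ^ (2 * k) : ℝ≥0) : ℝ) * ballVol d)) = 15 * d * M * E := by
    have h1 := pow_mul_step hN k
    push_cast
    rw [hE]
    calc _ = (d : ℝ) * M * 15 * 4 ^ k * ballVol d * ((N : ℝ) ^ (2 * k) * step N k) := by ring
      _ = _ := by rw [h1]; ring
  have hd0 : (0 : ℝ) ≤ d.factorial := by positivity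
  have g1 := mul_le_mul_of_nonneg_left hsum hd0
  have g2 := mul_le_mul_of_nonneg_left hst hd0
  rw [hterm]
  linarith

lemma integrable_bump_mul_mul_jac (k : ℕ) {p : Fin d → Euc d → ℝ}
    (hp : ∀ l, LipschitzWith 1 (p l)) {f : Euc d → ℝ} (hf : LipschitzWith 1 f)
    (hf1 : ∀ x ∈ cube d, |f x| ≤ 1) :
    Integrable fun x => bump d x * f x * weight i N k x * wave j N k x * jac p x := by
  refine integrable_of_bounded_of_support (R := d + 1)
    (C := 1 * 1 * 2 ^ k * 1 * (d.factorial * ∏ _j : Fin d, ((1 : ℝ≥0) : ℝ))) ?_ ?_ ?_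
  · exact (((((lipschitzWith_bump d).continuous.measurable).mul hf.continuous.measurable).mul
      (measurable_weight k)).mul (measurable_wave k)).mul (measurable_jac p)
  · intro x
    by_cases hx : x ∈ cube d
    · rw [abs_mul, abs_mul, abs_mul, abs_mul]
      gcongr
      · exact abs_bump_le_one x
      · exact hf1 x hx
      · exact abs_weight_le k x
      · exact abs_wave_le k x
      · exact abs_jac_le hp x
    · rw [bump_eq_zero x hx]
      simp only [zero_mul, abs_zero]
      positivity
  · intro x hx
    rw [bump_eq_zero x (notMem_cube_of_notMem_closedBall hx)]
    simp

/-- The test function is almost orthogonal to all Jacobians. -/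
lemma abs_integral_testFun_mul_jac_le (hij : i ≠ j) {a : ℕ} (ha : 1 ≤ a)
    {p : Fin d → Euc d → ℝ}
    (hp : ∀ l, LipschitzWith 1 (p l)) {f : Euc d → ℝ} (hf : LipschitzWith 1 f)
    (hf1 : ∀ x ∈ cube d, |f x| ≤ 1) {M : ℕ} (hM : M ≤ 2 ^ a) {s : ℝ} (hs : 0 < s) (K : ℕ)
    {c E : ℝ} (hc : c = ∫ x, bump d x) (hE : E = 4 ^ K * ballVol d / (2 ^ a : ℕ)) :
    |∫ x, testFun i j (2 ^ a) K x * f x * jac p x| ≤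
      d.factorial * (4 * (2 * M * (M + 1) * (d * (K * (c + 14 * E) / (2 * s)
        + 2 * s * (c + 34 * E) + K * ((3 * s + 2 * M) * E)))))
      + d.factorial * (K * ((15 * d * M + 2) * E))
      + d * (d.factorial * (2 / (2 * M + 1))) * (K * (c + 14 * E)) := by
  have hN : 1 ≤ 2 ^ a := Nat.one_le_two_pow
  have hV := ballVol_nonneg d
  have hsplit : ∫ x, testFun i j (2 ^ a) K x * f x * jac p x = ∑ k ∈ Finset.range K,
      ∫ x, bump d x * f x * weight i (2 ^ a) k x * wave j (2 ^ a) k x * jac p x := by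
    rw [← integral_finsetSum _ fun k _ => integrable_bump_mul_mul_jac k hp hf hf1]
    congr 1
    funext x
    rw [testFun, Finset.mul_sum, Finset.sum_mul, Finset.sum_mul]
    exact Finset.sum_congr rfl fun k _ => by ring
  have hEk : ∀ k ∈ Finset.range K, 4 ^ k * ballVol d / (2 ^ a : ℕ) ≤ E := by
    intro k hk
    rw [hE]
    gcongr
    · norm_num
    · exact (Finset.mem_range.1 hk).le
  have hm : ∀ k ∈ Finset.range K, ∫ x, bump d x * weight i (2 ^ a) k x ≤ c + 14 * E := by
    intro k hk
    have h1 := (abs_le.1 (abs_integral_weight_sub_le (d := d) (i := i) hN k)).2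
    have h2 := hEk k hk
    rw [hc]
    linarith
  let D : ℕ → Fin d → ℝ := fun k l =>
    energy (bump d) (weight i (2 ^ a) k) (step (2 ^ a) k) (EuclideanSpace.single j 1) (p l) -
      energy (bump d) (weight i (2 ^ a) k) (2 * step (2 ^ a) k) (EuclideanSpace.single j 1) (p l)
  -- At fixed `E` this bound does not grow with `K`, which is what beats the lower bound of order
  -- `K`.
  have hD : ∑ k ∈ Finset.range K, ∑ l, D k l ≤ d * (c + 34 * E) := by
    rw [Finset.sum_comm]
    have h1 : ∀ l ∈ (Finset.univ : Finset (Fin d)), ∑ k ∈ Finset.range K, D k l ≤ c + 34 * E := by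
      intro l _
      rw [hc, hE]
      exact sum_energy_drop_le hij ha (hp l) K
    refine (Finset.sum_le_sum h1).trans ?_
    rw [Finset.sum_const, Finset.card_univ, Fintype.card_fin, nsmul_eq_mul]
  have hpull : ∑ k ∈ Finset.range K, 2 * s * ∑ l, D k l =
      2 * s * ∑ k ∈ Finset.range K, ∑ l, D k l := (Finset.mul_sum _ _ _).symm
  have hlevel : ∀ k ∈ Finset.range K,
      |∫ x, bump d x * f x * weight i (2 ^ a) k x * wave j (2 ^ a) k x * jac p x| ≤
      d.factorial * (4 * (2 * M * (M + 1) * (d * ((c + 14 * E) / (2 * s))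
        + 2 * s * ∑ l, D k l + d * ((3 * s + 2 * M) * E))))
      + d.factorial * ((15 * d * M + 2) * E)
      + d * (d.factorial * (2 / (2 * M + 1))) * (c + 14 * E) := by
    intro k hk
    refine (abs_integral_wave_mul_jac_le hij hN hp hf hf1 hM hs k).trans ?_
    have h1 := hm k hk
    have h2 := hEk k hk
    gcongr
  rw [hsplit]
  refine (Finset.abs_sum_le_sum_abs _ _).trans ((Finset.sum_le_sum hlevel).trans ?_)
  rw [Finset.sum_add_distrib, Finset.sum_add_distrib, ← Finset.mul_sum, ← Finset.mul_sum,
    ← Finset.mul_sum, Finset.sum_add_distrib, Finset.sum_add_distrib, hpull]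
  simp only [Finset.sum_const, Finset.card_range, nsmul_eq_mul]
  have h3 : (K : ℝ) * (d * ((c + 14 * E) / (2 * s))) + 2 * s * (∑ k ∈ Finset.range K, ∑ l, D k l)
      + K * (d * ((3 * s + 2 * M) * E)) ≤ d * (K * (c + 14 * E) / (2 * s)
        + 2 * s * (c + 34 * E) + K * ((3 * s + 2 * M) * E)) := by
    have := mul_le_mul_of_nonneg_left hD (show 0 ≤ 2 * s by positivity)
    calc _ ≤ (K : ℝ) * (d * ((c + 14 * E) / (2 * s))) + 2 * s * (d * (c + 34 * E))
          + K * (d * ((3 * s + 2 * M) * E)) := by linarith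
      _ = _ := by ring
  have h4 := mul_le_mul_of_nonneg_left h3
    (show (0 : ℝ) ≤ d.factorial * (4 * (2 * M * (M + 1))) by positivity)
  refine le_trans (le_of_eq ?_) (le_trans (add_le_add_left (add_le_add_left h4
    (d.factorial * (K * ((15 * d * M + 2) * E))))
    (d * (d.factorial * (2 / (2 * M + 1))) * (K * (c + 14 * E)))) (le_of_eq ?_)) <;> ring

end

/-! ### Lower bound: the test function against a bounded function. -/

open scoped Classical in
/-- The indicator function of the set where the `k`-th weight is the last nonzero one. -/
def lastIndicator {d : ℕ} (i : Fin d) (N k : ℕ) (x : Euc d) : ℝ :=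
  if weight i N k x ≠ 0 ∧ osc ((N : ℝ) ^ (2 * (k + 1)) * x i) = -1 then 1 else 0

open scoped Classical in
/-- The indicator function of the set where the factor `1 + osc` vanishes. -/
def oscIndicator (y : ℝ) : ℝ := if osc y = -1 then 1 else 0

/-- Among three points equally spaced over a period, one has `cos (2 π y) ≤ -1/2`, where the
truncation in `osc` is active. Otherwise `a = cos θ` would satisfy `3 * (1 - a ^ 2) < (1 - a) ^ 2`
although `a > -1/2`. -/
lemma one_le_sum_oscIndicator (y : ℝ) :
    1 ≤ oscIndicator y + oscIndicator (y + 1 / 3) + oscIndicator (y + 2 / 3) := by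
  have hiff : ∀ y, 2 * Real.cos (2 * Real.pi * y) ≤ -1 → oscIndicator y = 1 := by
    intro y hy
    rw [oscIndicator, if_pos]
    rw [osc, min_eq_right (by linarith), max_eq_left hy]
  have hnn : ∀ y, 0 ≤ oscIndicator y := by
    intro y
    rw [oscIndicator]
    split_ifs <;> norm_num
  by_contra hcon
  push Not at hcon
  have h0 := hnn y
  have h1 := hnn (y + 1 / 3)
  have h2 := hnn (y + 2 / 3)
  have c0 : -1 < 2 * Real.cos (2 * Real.pi * y) := by
    by_contra h
    have := hiff _ (not_lt.1 h)
    linarith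
  have c1 : -1 < 2 * Real.cos (2 * Real.pi * (y + 1 / 3)) := by
    by_contra h
    have := hiff _ (not_lt.1 h)
    linarith
  have c2 : -1 < 2 * Real.cos (2 * Real.pi * (y + 2 / 3)) := by
    by_contra h
    have := hiff _ (not_lt.1 h)
    linarith
  set θ := 2 * Real.pi * y
  have e1 : 2 * Real.pi * (y + 1 / 3) = θ - Real.pi / 3 + Real.pi := by simp only [θ]; ring
  have e2 : 2 * Real.pi * (y + 2 / 3) = θ + Real.pi / 3 + Real.pi := by simp only [θ]; ring
  rw [e1, Real.cos_add_pi, Real.cos_sub, Real.cos_pi_div_three, Real.sin_pi_div_three] at c1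
  rw [e2, Real.cos_add_pi, Real.cos_add, Real.cos_pi_div_three, Real.sin_pi_div_three] at c2
  have hsc := Real.sin_sq_add_cos_sq θ
  have h3 : √3 ^ 2 = 3 := Real.sq_sqrt (by norm_num)
  set a := Real.cos θ
  set b := √3 * Real.sin θ with hb
  have hb2 : b ^ 2 = 3 * (1 - a ^ 2) := by
    rw [hb, mul_pow, h3]; linarith
  have d1 : b < 1 - a := by rw [hb]; linarith
  have d2 : -(1 - a) < b := by rw [hb]; linarith
  have hab := abs_lt.2 ⟨d2, d1⟩
  have : b ^ 2 < (1 - a) ^ 2 := sq_lt_sq' d2 d1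
  nlinarith

section

variable {d : ℕ} {i j : Fin d} {N : ℕ}

lemma weight_eq_zero_of_lt {k l : ℕ} (hkl : k < l) {x : Euc d}
    (h : osc ((N : ℝ) ^ (2 * (k + 1)) * x i) = -1) : weight i N l x = 0 :=
  Finset.prod_eq_zero (Finset.mem_range.2 hkl) (by rw [h]; norm_num)

lemma lastIndicator_mul_weight_of_lt {k l : ℕ} (hkl : k < l) (x : Euc d) :
    lastIndicator i N k x * weight i N l x = 0 := by
  rw [lastIndicator]
  split_ifs with h
  · rw [weight_eq_zero_of_lt hkl h.2, mul_zero]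
  · rw [zero_mul]

lemma lastIndicator_mul_weight_self (k : ℕ) (x : Euc d) :
    lastIndicator i N k x * weight i N k x =
      weight i N k x * oscIndicator ((N : ℝ) ^ (2 * (k + 1)) * x i) := by
  rw [lastIndicator, oscIndicator]
  by_cases h : weight i N k x = 0
  · simp [h]
  · by_cases h' : osc ((N : ℝ) ^ (2 * (k + 1)) * x i) = -1 <;> simp [h, h']

lemma lastIndicator_nonneg (k : ℕ) (x : Euc d) : 0 ≤ lastIndicator i N k x := by
  rw [lastIndicator]; split_ifs <;> norm_num

lemma lastIndicator_le_one (k : ℕ) (x : Euc d) : lastIndicator i N k x ≤ 1 := by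
  rw [lastIndicator]; split_ifs <;> norm_num

lemma oscIndicator_nonneg (y : ℝ) : 0 ≤ oscIndicator y := by
  rw [oscIndicator]; split_ifs <;> norm_num

lemma oscIndicator_le_one (y : ℝ) : oscIndicator y ≤ 1 := by
  rw [oscIndicator]; split_ifs <;> norm_num

lemma measurable_lastIndicator (k : ℕ) : Measurable (lastIndicator (d := d) i N k) := by
  refine Measurable.ite ?_ measurable_const measurable_const
  have h1 : MeasurableSet {x : Euc d | weight i N k x = 0} :=
    measurable_weight k (measurableSet_singleton 0)
  have h2 : MeasurableSet {x : Euc d | osc ((N : ℝ) ^ (2 * (k + 1)) * x i) = -1} :=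
    measurable_osc_coord _ (measurableSet_singleton (-1))
  exact h1.compl.inter h2

lemma measurable_oscIndicator_coord (c : ℝ) :
    Measurable fun x : Euc d => oscIndicator (c * x i) := by
  refine Measurable.ite ?_ measurable_const measurable_const
  exact measurable_osc_coord _ (measurableSet_singleton (-1))

/-- The bounded function against which the test function is paired. -/
def pairing {d : ℕ} (i j : Fin d) (N K : ℕ) (x : Euc d) : ℝ :=
  ∑ k ∈ Finset.range K, lastIndicator i N k x * wave j N k x

lemma measurable_pairing (K : ℕ) : Measurable (pairing i j N K) :=
  Finset.measurable_fun_sum _ fun k _ => (measurable_lastIndicator k).mul (measurable_wave k)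

lemma abs_pairing_le_one (K : ℕ) (x : Euc d) : |pairing i j N K x| ≤ 1 := by
  by_cases h : ∃ k ∈ Finset.range K, lastIndicator i N k x ≠ 0
  · obtain ⟨k, hk, hkx⟩ := h
    have hk' : weight i N k x ≠ 0 ∧ osc ((N : ℝ) ^ (2 * (k + 1)) * x i) = -1 := by
      by_contra hcon
      exact hkx (by rw [lastIndicator, if_neg hcon])
    have hsum : pairing i j N K x = lastIndicator i N k x * wave j N k x := by
      -- The sets of the indicators are disjoint: once a factor vanishes, all later weights vanish.
      refine Finset.sum_eq_single_of_mem k hk fun l _ hl => ?_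
      have : lastIndicator i N l x = 0 := by
        rw [lastIndicator, if_neg]
        rintro ⟨h1, h2⟩
        rcases lt_or_gt_of_ne hl with hlk | hlk
        · exact hk'.1 (weight_eq_zero_of_lt hlk h2)
        · exact h1 (weight_eq_zero_of_lt hlk hk'.2)
      rw [this, zero_mul]
    rw [hsum, abs_mul, abs_of_nonneg (lastIndicator_nonneg k x)]
    exact mul_le_one₀ (lastIndicator_le_one k x) (abs_nonneg _) (abs_wave_le k x)
  · push Not at h
    have : pairing i j N K x = 0 := Finset.sum_eq_zero fun k hk => by rw [h k hk, zero_mul]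
    rw [this, abs_zero]
    exact zero_le_one

lemma lastIndicator_add_smul_single (hij : i ≠ j) (k : ℕ) (x : Euc d) (t : ℝ) :
    lastIndicator i N k (x + t • EuclideanSpace.single j 1) = lastIndicator i N k x := by
  simp only [lastIndicator, weight_add_smul_single hij]
  simp [hij]

/-- The finer wave `l` is antiperiodic along `j`, where weight and indicator are constant and the
coarser wave `k` varies slowly. -/
lemma abs_integral_cross_le (hij : i ≠ j) (hN : 1 ≤ N) {k l : ℕ} (hkl : k < l) :
    |∫ x, bump d x * wave j N k x * (lastIndicator i N l x * weight i N k x * wave j N l x)| ≤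
      5 * (4 ^ k * ballVol d / N) := by
  have hN' : (1 : ℝ) ≤ N := by exact_mod_cast hN
  have hV := ballVol_nonneg d
  have hΦ : LipschitzWith (5 * (N : ℝ≥0) ^ (2 * k + 1)) (fun x => bump d x * wave j N k x) := by
    refine (lipschitzWith_mul (lipschitzWith_bump d) (lipschitzWith_wave (i := j) k)
      (A := 1) (B := 1) abs_bump_le_one (fun x _ => abs_wave_le k x)).weaken ?_
    have hN'' : (1 : ℝ≥0) ≤ N := by exact_mod_cast hN
    have e1 : (1 : ℝ≥0) ≤ (N : ℝ≥0) ^ (2 * k + 1) := one_le_pow₀ hN''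
    calc 1 * (4 * (N : ℝ≥0) ^ (2 * k + 1)) + 1 * 1
        ≤ 1 * (4 * (N : ℝ≥0) ^ (2 * k + 1)) + 1 * (N : ℝ≥0) ^ (2 * k + 1) := by gcongr
      _ = _ := by ring
  have h := abs_integral_mul_antiperiodic_le hΦ
    (fun x hx => by rw [bump_eq_zero x hx, zero_mul])
    (ω := fun x => lastIndicator i N l x * weight i N k x * wave j N l x)
    (((measurable_lastIndicator l).mul (measurable_weight k)).mul (measurable_wave l))
    (B := 2 ^ k) (fun x => by
      rw [abs_mul, abs_mul, abs_of_nonneg (lastIndicator_nonneg l x)]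
      have h1 := mul_le_mul (lastIndicator_le_one (i := i) (N := N) l x)
        (abs_weight_le (i := i) (N := N) k x) (abs_nonneg _) zero_le_one
      have h2 := mul_le_mul h1 (abs_wave_le (i := j) (N := N) l x) (abs_nonneg _) (by positivity)
      linarith)
    (v := step N l • EuclideanSpace.single j 1) (by
      rw [norm_step_smul_single hN l]
      exact (step_le hN l).trans (one_div_le_one hN))
    (fun x => by
      rw [lastIndicator_add_smul_single hij, weight_add_smul_single hij, wave_add_step hN]
      ring)
  rw [norm_step_smul_single hN l] at h
  refine h.trans (le_trans ?_ (pow_mul_inv_pow_le hN k (m := 2 * k + 1) (n := 2 * l + 1) (by omega)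
    (by norm_num : (0 : ℝ) ≤ 5)))
  push_cast
  rw [step]
  calc 5 * (N : ℝ) ^ (2 * k + 1) * (1 / (N : ℝ) ^ (2 * l + 1)) * 2 ^ k * ballVol d
      ≤ 5 * (N : ℝ) ^ (2 * k + 1) * (1 / (N : ℝ) ^ (2 * l + 1)) * 4 ^ k * ballVol d := by
        gcongr
        norm_num
    _ = _ := by ring

/-- The indicators shifted by 0, 1/3 and 2/3 of a period cover everything, and the `k`-th weight
hardly changes over such a short shift, so each receives about a third of the mass. -/
lemma integral_weight_mul_oscIndicator_ge (hN : 1 ≤ N) (k : ℕ) :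
    (∫ x, bump d x) / 3 - 19 * (4 ^ k * ballVol d / N) ≤
      ∫ x, bump d x * weight i N k x * oscIndicator ((N : ℝ) ^ (2 * (k + 1)) * x i) := by
  have hN' : (1 : ℝ) ≤ N := by exact_mod_cast hN
  have hV := ballVol_nonneg d
  set E : ℝ := 4 ^ k * ballVol d / N with hE
  set ω : Euc d → ℝ := fun x => oscIndicator ((N : ℝ) ^ (2 * (k + 1)) * x i) with hω
  have hωm : Measurable ω := measurable_oscIndicator_coord _
  have hω1 : ∀ x, |ω x| ≤ 1 := fun x => by
    rw [abs_of_nonneg (oscIndicator_nonneg _)]; exact oscIndicator_le_one _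
  have hΦ := lipschitzWith_bump_mul_weight (i := i) hN k (d := d)
  have hΦ0 : ∀ x, x ∉ cube d → bump d x * weight i N k x = 0 := fun x hx => by
    rw [bump_eq_zero x hx, zero_mul]
  have hshift : ∀ t : ℝ, 0 ≤ t → t ≤ 1 →
      Integrable (fun x => bump d x * weight i N k x *
        oscIndicator ((N : ℝ) ^ (2 * (k + 1)) * x i + t)) ∧
      ∫ x, bump d x * weight i N k x * oscIndicator ((N : ℝ) ^ (2 * (k + 1)) * x i + t) ≤
        (∫ x, bump d x * weight i N k x * ω x) + 14 * E := by
    intro t ht0 ht1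
    set v : Euc d := (t / (N : ℝ) ^ (2 * (k + 1))) • EuclideanSpace.single i 1 with hv
    have hvn : ‖v‖ ≤ 1 / (N : ℝ) ^ (2 * k + 2) := by
      rw [hv, norm_smul, norm_single_one, mul_one, Real.norm_of_nonneg (by positivity)]
      have : 2 * (k + 1) = 2 * k + 2 := by ring
      rw [this]
      gcongr
    have hωv : ∀ x, ω (x + v) = oscIndicator ((N : ℝ) ^ (2 * (k + 1)) * x i + t) := by
      intro x
      simp only [hω]
      congr 1
      simp [hv]
      field_simp
    have h := abs_integral_mul_shift_sub_le hΦ hΦ0 hωm hω1 (hvn.trans (inv_pow_le_one hN _))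
    have hi := integrable_mul_of_lipschitz hΦ hΦ0 (hωm.comp (measurable_add_const v))
      (fun x => hω1 _)
    simp only [Function.comp_apply, hωv] at h hi
    refine ⟨hi, ?_⟩
    have h2 : ((14 * 4 ^ k * (N : ℝ≥0) ^ (2 * k) : ℝ≥0) : ℝ) * ‖v‖ * 1 * ballVol d ≤ 14 * E := by
      refine le_trans ?_ (pow_mul_inv_pow_le hN k (m := 2 * k) (n := 2 * k + 2) (by omega)
        (by norm_num : (0 : ℝ) ≤ 14))
      push_cast
      rw [mul_one]
      gcongr
    have := (abs_le.1 (h.trans h2)).2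
    linarith
  obtain ⟨i0, s0⟩ := hshift 0 le_rfl zero_le_one
  obtain ⟨i1, s1⟩ := hshift (1 / 3) (by norm_num) (by norm_num)
  obtain ⟨i2, s2⟩ := hshift (2 / 3) (by norm_num) (by norm_num)
  simp only [add_zero] at i0 s0
  have hge : ∫ x, bump d x * weight i N k x ≤
      (∫ x, bump d x * weight i N k x * oscIndicator ((N : ℝ) ^ (2 * (k + 1)) * x i)) +
      (∫ x, bump d x * weight i N k x * oscIndicator ((N : ℝ) ^ (2 * (k + 1)) * x i + 1 / 3)) +
      ∫ x, bump d x * weight i N k x * oscIndicator ((N : ℝ) ^ (2 * (k + 1)) * x i + 2 / 3) := by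
    rw [← integral_add i0 i1]
    have i01 : Integrable fun x =>
        bump d x * weight i N k x * oscIndicator ((N : ℝ) ^ (2 * (k + 1)) * x i) +
        bump d x * weight i N k x * oscIndicator ((N : ℝ) ^ (2 * (k + 1)) * x i + 1 / 3) :=
      i0.add i1
    rw [← integral_add i01 i2]
    refine integral_mono_of_nonneg (Filter.Eventually.of_forall fun x =>
      mul_nonneg (bump_nonneg x) (weight_nonneg k x)) (i01.add i2)
      (Filter.Eventually.of_forall fun x => ?_)
    have h1 := one_le_sum_oscIndicator ((N : ℝ) ^ (2 * (k + 1)) * x i)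
    have h2 := mul_le_mul_of_nonneg_left h1 (mul_nonneg (bump_nonneg x)
      (weight_nonneg (i := i) (N := N) k x))
    beta_reduce
    linarith
  have hmass := (abs_le.1 (abs_integral_weight_sub_le (d := d) (i := i) hN k)).1
  rw [← hE] at hmass
  have hE0 : 0 ≤ E := by positivity
  change _ ≤ ∫ x, bump d x * weight i N k x * ω x
  change ∫ x, bump d x * weight i N k x ≤ (∫ x, bump d x * weight i N k x * ω x) + _ + _ at hge
  linarith

/-- The square of the wave has mean 1/2, which turns the third of the mass into a sixth. -/
lemma integral_diagonal_ge (hij : i ≠ j) (hN : 1 ≤ N) (k : ℕ) :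
    (∫ x, bump d x) / 6 - 10 * (4 ^ k * ballVol d / N) ≤
      ∫ x, bump d x * wave j N k x * (lastIndicator i N k x * weight i N k x * wave j N k x) := by
  have hN' : (1 : ℝ) ≤ N := by exact_mod_cast hN
  have hN0 : (N : ℝ) ≠ 0 := by positivity
  have hV := ballVol_nonneg d
  set E : ℝ := 4 ^ k * ballVol d / N with hE
  set z : Euc d → ℝ := fun x => oscIndicator ((N : ℝ) ^ (2 * (k + 1)) * x i) with hz
  set c : Euc d → ℝ := fun x => Real.cos (2 * (Real.pi * ((N : ℝ) ^ (2 * k + 1) * x j))) with hc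
  have hzm : Measurable z := measurable_oscIndicator_coord _
  have hz1 : ∀ x, |z x| ≤ 1 := fun x => by
    rw [abs_of_nonneg (oscIndicator_nonneg _)]; exact oscIndicator_le_one _
  have hcm : Measurable c := by rw [hc]; fun_prop
  have hc1 : ∀ x, |c x| ≤ 1 := fun x => Real.abs_cos_le_one _
  have hpt : ∀ x, bump d x * wave j N k x *
      (lastIndicator i N k x * weight i N k x * wave j N k x) =
      1 / 2 * (bump d x * weight i N k x * z x) + 1 / 2 * (bump d x * (weight i N k x * z x * c x))
      := by
    intro x
    rw [lastIndicator_mul_weight_self]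
    have h1 : c x = 2 * wave j N k x ^ 2 - 1 := Real.cos_two_mul _
    rw [h1]
    simp only [hz]
    ring
  have i1 : Integrable fun x => bump d x * weight i N k x * z x :=
    integrable_mul_of_lipschitz (lipschitzWith_bump_mul_weight (i := i) hN k)
      (fun x hx => by rw [bump_eq_zero x hx, zero_mul]) hzm hz1
  have hωb : ∀ x, |weight i N k x * z x * c x| ≤ 2 ^ k := by
    intro x
    rw [abs_mul, abs_mul]
    have h1 := mul_le_mul (abs_weight_le (i := i) (N := N) k x) (hz1 x) (abs_nonneg _)
      (by positivity)
    have h2 := mul_le_mul h1 (hc1 x) (abs_nonneg _) (by positivity)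
    linarith
  have hωm : Measurable fun x => weight i N k x * z x * c x :=
    ((measurable_weight k).mul hzm).mul hcm
  have i2 : Integrable fun x => bump d x * (weight i N k x * z x * c x) :=
    integrable_bump_mul hωm hωb
  simp only [hpt]
  rw [integral_add (i1.const_mul _) (i2.const_mul _), integral_const_mul, integral_const_mul]
  have h1 := integral_weight_mul_oscIndicator_ge (d := d) (i := i) hN k
  set v : Euc d := (step N k / 2) • EuclideanSpace.single j 1 with hv
  have hpos := step_pos hN k
  have hvn : ‖v‖ ≤ step N k := by
    rw [hv, norm_smul, norm_single_one, mul_one, Real.norm_of_nonneg (by positivity)]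
    linarith
  have h2 := abs_integral_mul_antiperiodic_le (lipschitzWith_bump d) bump_eq_zero hωm hωb
    (hvn.trans ((step_le hN k).trans (one_div_le_one hN))) (fun x => by
      rw [hv, weight_add_smul_single hij]
      have e1 : z (x + (step N k / 2) • EuclideanSpace.single j 1) = z x := by
        simp [hz, hij]
      have e2 : c (x + (step N k / 2) • EuclideanSpace.single j 1) = -c x := by
        simp only [hc]
        rw [← Real.cos_add_pi]
        congr 1
        simp [step]
        field_simp
      rw [e1, e2]
      ring)
  have h3 : ((1 : ℝ≥0) : ℝ) * ‖v‖ * 2 ^ k * ballVol d ≤ E := by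
    refine le_trans ?_ (two_pow_mul_step_mul_ballVol_le hN k)
    rw [NNReal.coe_one, one_mul, mul_comm ‖v‖]
    gcongr
  have h4 := (abs_le.1 (h2.trans h3)).1
  linarith

lemma integral_testFun_mul_pairing_ge (hij : i ≠ j) (hN : 1 ≤ N) (K : ℕ) {c E : ℝ}
    (hc : c = ∫ x, bump d x) (hE : E = 4 ^ K * ballVol d / N) :
    K * (c / 6 - 10 * E) - K * (K * (5 * E)) ≤ ∫ x, testFun i j N K x * pairing i j N K x := by
  have hN' : (1 : ℝ) ≤ N := by exact_mod_cast hN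
  have hV := ballVol_nonneg d
  have hE0 : 0 ≤ E := by rw [hE]; positivity
  have hEk : ∀ k ∈ Finset.range K, 4 ^ k * ballVol d / N ≤ E := by
    intro k hk
    rw [hE]
    gcongr
    · norm_num
    · exact (Finset.mem_range.1 hk).le
  let T : ℕ → ℕ → Euc d → ℝ := fun k l x =>
    bump d x * wave j N k x * (lastIndicator i N l x * weight i N k x * wave j N l x)
  have hTi : ∀ k l, Integrable (T k l) := by
    intro k l
    have : T k l = fun x => bump d x *
        (wave j N k x * (lastIndicator i N l x * weight i N k x * wave j N l x)) := by
      funext x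
      simp only [T]
      ring
    rw [this]
    refine integrable_bump_mul ((measurable_wave k).mul (((measurable_lastIndicator l).mul
      (measurable_weight k)).mul (measurable_wave l))) (B := 1 * (1 * 2 ^ k * 1)) fun x => ?_
    rw [abs_mul, abs_mul, abs_mul, abs_of_nonneg (lastIndicator_nonneg l x)]
    have h0 := lastIndicator_nonneg (i := i) (N := N) l x
    gcongr
    · exact abs_wave_le k x
    · exact lastIndicator_le_one l x
    · exact abs_weight_le k x
    · exact abs_wave_le l x
  have hsplit : ∫ x, testFun i j N K x * pairing i j N K x =
      ∑ k ∈ Finset.range K, ∑ l ∈ Finset.range K, ∫ x, T k l x := by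
    have h1 : ∀ x, testFun i j N K x * pairing i j N K x =
        ∑ k ∈ Finset.range K, ∑ l ∈ Finset.range K, T k l x := by
      intro x
      rw [testFun, pairing, mul_assoc, Finset.sum_mul_sum, Finset.mul_sum]
      refine Finset.sum_congr rfl fun k _ => ?_
      rw [Finset.mul_sum]
      refine Finset.sum_congr rfl fun l _ => ?_
      simp only [T]
      ring
    simp only [h1]
    rw [integral_finsetSum _ fun k _ => integrable_finsetSum _ fun l _ => hTi k l]
    exact Finset.sum_congr rfl fun k _ => integral_finsetSum _ fun l _ => hTi k l
  have hlow : ∀ k ∈ Finset.range K, c / 6 - 10 * E - K * (5 * E) ≤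
      ∑ l ∈ Finset.range K, ∫ x, T k l x := by
    intro k hk
    rw [← Finset.add_sum_erase _ _ hk]
    have h1 : c / 6 - 10 * E ≤ ∫ x, T k k x := by
      have := integral_diagonal_ge (d := d) (i := i) (j := j) hij hN k
      have h2 := hEk k hk
      rw [hc]
      change _ ≤ ∫ x, bump d x * wave j N k x *
        (lastIndicator i N k x * weight i N k x * wave j N k x)
      linarith
    have h2 : ∀ l ∈ (Finset.range K).erase k, -(5 * E) ≤ ∫ x, T k l x := by
      intro l hl
      rcases lt_or_gt_of_ne (Finset.ne_of_mem_erase hl) with h | h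
      -- For `l < k` the weight `k` vanishes where the weight `l` is the last nonzero one.
      · have : ∫ x, T k l x = 0 := by
          have : T k l = fun _ => 0 := by
            funext x
            simp only [T]
            rw [lastIndicator_mul_weight_of_lt h, zero_mul, mul_zero]
          rw [this, integral_zero]
        rw [this]
        linarith
      · have h3 := (abs_le.1 (abs_integral_cross_le (d := d) hij hN h)).1
        have h4 := hEk k hk
        change _ ≤ ∫ x, bump d x * wave j N k x *
          (lastIndicator i N l x * weight i N k x * wave j N l x)
        linarith
    have h3 := Finset.sum_le_sum h2
    rw [Finset.sum_const, nsmul_eq_mul] at h3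
    have h4 : (((Finset.range K).erase k).card : ℝ) ≤ K := by
      have := Finset.card_le_card (Finset.erase_subset k (Finset.range K))
      rw [Finset.card_range] at this
      exact_mod_cast this
    have h5 := mul_le_mul_of_nonneg_right h4 (show 0 ≤ 5 * E by linarith)
    linarith
  rw [hsplit]
  refine le_trans (le_of_eq ?_) (Finset.sum_le_sum hlow)
  rw [Finset.sum_const, Finset.card_range, nsmul_eq_mul]
  ring

end

/-! ### Choice of parameters and the almost orthogonal pair. -/

lemma measurable_testFun {d : ℕ} (i j : Fin d) (N K : ℕ) : Measurable (testFun i j N K) :=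
  (lipschitzWith_bump d).continuous.measurable.mul
    (Finset.measurable_fun_sum _ fun k _ => (measurable_weight k).mul (measurable_wave k))

lemma abs_testFun_le {d : ℕ} (i j : Fin d) (N K : ℕ) (x : Euc d) :
    |testFun i j N K x| ≤ ∑ k ∈ Finset.range K, (2 : ℝ) ^ k := by
  rw [testFun, abs_mul]
  refine (mul_le_of_le_one_left (abs_nonneg _) (abs_bump_le_one x)).trans
    ((Finset.abs_sum_le_sum_abs _ _).trans (Finset.sum_le_sum fun k _ => ?_))
  rw [abs_mul]
  exact (mul_le_of_le_one_right (abs_nonneg _) (abs_wave_le k x)).trans (abs_weight_le k x)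

lemma integral_bump_pos {d : ℕ} (hd : 0 < d) : 0 < ∫ x, bump d x := by
  set x₀ : Euc d := WithLp.toLp 2 fun _ => 1 / 2 with hx₀
  have hint : x₀ ∈ interior (cube d) := by
    rw [mem_interior]
    refine ⟨Metric.ball x₀ (1 / 2), fun y hy l => ?_, Metric.isOpen_ball,
      Metric.mem_ball_self (by norm_num)⟩
    have h1 := (abs_coord_sub_le l y x₀).trans_lt (Metric.mem_ball.1 hy)
    have h2 : x₀ l = 1 / 2 := rfl
    rw [h2, abs_lt] at h1
    constructor <;> linarith [h1.1, h1.2]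
  have hne : ((interior (cube d))ᶜ : Set (Euc d)).Nonempty := by
    refine ⟨WithLp.toLp 2 fun _ => 2, fun h => ?_⟩
    have h1 : (2 : ℝ) ≤ 1 := (interior_subset h ⟨0, hd⟩).2
    norm_num at h1
  have hpos : 0 < bump d x₀ := by
    exact lt_min one_pos ((isOpen_interior.isClosed_compl.notMem_iff_infDist_pos hne).1
      fun h => h hint)
  refine (lipschitzWith_bump d).continuous.integral_pos_of_hasCompactSupport_nonneg_nonzero
    (HasCompactSupport.intro (isCompact_closedBall (0 : Euc d) (d + 1)) fun x hx =>
      bump_eq_zero x (notMem_cube_of_notMem_closedBall hx)) (fun x => bump_nonneg x) hpos.ne'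

/-- The bound on the pairings with Jacobians, divided by the number of scales, becomes small
compared to the lower bound on the mass of the test function. -/
lemma exists_parameters (d : ℕ) {c ε : ℝ} (hc : 0 < c) (hε : 0 < ε) :
    ∃ (M K : ℕ) (s : ℝ), 0 < s ∧ ∀ᶠ E in nhds (0 : ℝ),
      0 < K * (c / 6 - 10 * E) - K * (K * (5 * E)) ∧
      d.factorial * (4 * (2 * M * (M + 1) * (d * (K * (c + 14 * E) / (2 * s)
        + 2 * s * (c + 34 * E) + K * ((3 * s + 2 * M) * E)))))
      + d.factorial * (K * ((15 * d * M + 2) * E))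
      + d * (d.factorial * (2 / (2 * M + 1))) * (K * (c + 14 * E)) ≤
      ε * (K * (c / 6 - 10 * E) - K * (K * (5 * E))) := by
  -- Order of choice: `M` for the almost periodicity, then `s` for the Young term, then `K` for the
  -- total energy drop. Each takes less than `ε / 18` of `K * c`, in all less than `ε / 6`.
  obtain ⟨M, hM⟩ := exists_nat_gt (18 * (d * d.factorial) / ε)
  have hM1 : d * (d.factorial * (2 / (2 * M + 1))) < ε / 18 := by
    rw [div_lt_iff₀ hε] at hM
    have h0 : (0 : ℝ) < 2 * M + 1 := by positivity
    have : d * (d.factorial * (2 / (2 * M + 1))) = (d * d.factorial * 2) / (2 * (M : ℝ) + 1) := by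
      ring
    rw [this, div_lt_div_iff₀ h0 (by norm_num)]
    nlinarith
  set A : ℝ := d.factorial * (4 * (2 * M * (M + 1) * d)) with hA
  have hA0 : 0 ≤ A := by positivity
  set s : ℝ := 9 * (A + 1) / ε with hs
  have hs0 : 0 < s := by positivity
  have hs1 : A / (2 * s) < ε / 18 := by
    rw [hs, div_lt_div_iff₀ (by positivity) (by norm_num)]
    have : ε * (2 * (9 * (A + 1) / ε)) = 18 * (A + 1) := by field_simp; ring
    rw [this]
    linarith
  obtain ⟨K, hK⟩ := exists_nat_gt (18 * (2 * s * A) / ε)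
  have hK0 : (0 : ℝ) < K := lt_of_le_of_lt (by positivity) hK
  have hK1 : 2 * s * A < K * (ε / 18) := by
    rw [div_lt_iff₀ hε] at hK
    linarith
  refine ⟨M, K, s, hs0, ?_⟩
  have hlow : 0 < K * (c / 6 - 10 * (0 : ℝ)) - K * (K * (5 * 0)) := by
    simp only [mul_zero, sub_zero]
    positivity
  have hup : d.factorial * (4 * (2 * M * (M + 1) * (d * (K * (c + 14 * 0) / (2 * s)
        + 2 * s * (c + 34 * 0) + K * ((3 * s + 2 * M) * 0)))))
      + d.factorial * (K * ((15 * d * M + 2) * 0))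
      + d * (d.factorial * (2 / (2 * M + 1))) * (K * (c + 14 * 0)) <
      ε * (K * (c / 6 - 10 * 0) - K * (K * (5 * 0))) := by
    have hKc : 0 < K * c := by positivity
    have h1 := mul_lt_mul_of_pos_right hM1 hKc
    have h2 := mul_lt_mul_of_pos_right hs1 hKc
    have h3 := mul_lt_mul_of_pos_right hK1 hc
    have h4 : d.factorial * (4 * (2 * M * (M + 1) * (d * (K * (c + 14 * 0) / (2 * s)
        + 2 * s * (c + 34 * 0) + K * ((3 * s + 2 * M) * 0))))) =
        A / (2 * s) * (K * c) + 2 * s * A * c := by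
      rw [hA]; field_simp; ring
    rw [h4]
    linarith
  -- With `M`, `K`, `s` fixed, the strict inequalities at `E = 0` persist for small `E` by
  -- continuity.
  have t1 := (Continuous.tendsto (f := fun E : ℝ => K * (c / 6 - 10 * E) - K * (K * (5 * E)))
    (by fun_prop) 0).eventually (lt_mem_nhds hlow)
  have t2 := (Continuous.tendsto (f := fun E : ℝ => ε * (K * (c / 6 - 10 * E) - K * (K * (5 * E)))
    - (d.factorial * (4 * (2 * M * (M + 1) * (d * (K * (c + 14 * E) / (2 * s)
        + 2 * s * (c + 34 * E) + K * ((3 * s + 2 * M) * E)))))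
      + d.factorial * (K * ((15 * d * M + 2) * E))
      + d * (d.factorial * (2 / (2 * M + 1))) * (K * (c + 14 * E))))
    (by fun_prop) 0).eventually (lt_mem_nhds (sub_pos.2 hup))
  filter_upwards [t1, t2] with E h1 h2
  exact ⟨h1, (sub_pos.1 h2).le⟩

/-- There are functions `u ∈ L^1` and `g ∈ L^∞` such that the pairing of `u` with all normalized
functions `f * det Dp` is much smaller than its pairing with `g`. -/
theorem exists_almost_orthogonal {d : ℕ} (hd : 2 ≤ d) {ε : ℝ} (hε : 0 < ε) :
    ∃ (u g : Euc d → ℝ) (C : ℝ), Measurable u ∧ Measurable g ∧ (∀ x, |u x| ≤ C) ∧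
      (∀ x, x ∉ interior (cube d) → u x = 0) ∧ (∀ x, |g x| ≤ 1) ∧ 0 < ∫ x, u x * g x ∧
      ∀ (f : Euc d → ℝ) (p : Fin d → Euc d → ℝ), LipschitzWith 1 f → (∀ x ∈ cube d, |f x| ≤ 1) →
        (∀ l, LipschitzWith 1 (p l)) → |∫ x, u x * f x * jac p x| ≤ ε * ∫ x, u x * g x := by
  have hij : (⟨0, by omega⟩ : Fin d) ≠ ⟨1, by omega⟩ := by simp
  obtain ⟨M, K, s, hs, hev⟩ := exists_parameters d (integral_bump_pos (d := d) (by omega)) hε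
  have htend : Filter.Tendsto (fun a : ℕ => 4 ^ K * ballVol d / (2 ^ a : ℕ)) Filter.atTop
      (nhds 0) := by
    push_cast
    exact Filter.Tendsto.div_atTop tendsto_const_nhds
      (tendsto_pow_atTop_atTop_of_one_lt one_lt_two)
  -- The base `N = 2 ^ a` is chosen last: it makes `E` small, and `M ≤ N` keeps the averaging
  -- translations within distance 1.
  obtain ⟨a, ⟨hpos, hle⟩, ha, hMa⟩ := ((htend.eventually hev).and
    ((Filter.eventually_ge_atTop 1).and (Filter.eventually_ge_atTop M))).exists
  have hlow := integral_testFun_mul_pairing_ge hij (Nat.one_le_two_pow (n := a)) K rfl rfl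
  refine ⟨testFun ⟨0, by omega⟩ ⟨1, by omega⟩ (2 ^ a) K,
    pairing ⟨0, by omega⟩ ⟨1, by omega⟩ (2 ^ a) K, _, measurable_testFun _ _ _ _,
    measurable_pairing K, abs_testFun_le _ _ _ _, ?_, abs_pairing_le_one K, hpos.trans_le hlow, ?_⟩
  · intro x hx
    rw [testFun, bump_eq_zero_of_notMem_interior hx, zero_mul]
  · intro f p hf hf1 hp
    refine (abs_integral_testFun_mul_jac_le hij ha hp hf hf1
      (hMa.trans Nat.lt_two_pow_self.le) hs K rfl rfl).trans (hle.trans ?_)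
    gcongr

/-! ### From normalized maps on the whole space to Lipschitz maps on the cube. -/

lemma jac_smul {d : ℕ} (c : Fin d → ℝ) (q : Fin d → Euc d → ℝ) (x : Euc d) :
    jac (fun l => c l • q l) x = (∏ l, c l) * jac q x := by
  have h : ∀ l, grad (c l • q l) x = c l • grad (q l) x := by
    intro l
    funext m
    simp [grad, fderiv_const_smul_field]
  simp only [jac, h]
  exact (Matrix.detRowAlternating (R := ℝ) (n := Fin d)).map_smul_univ c fun l => grad (q l) x

lemma lipschitzWith_inv_smul {α : Type*} [PseudoMetricSpace α] {κ : ℝ≥0} (hκ : 0 < κ) {q : α → ℝ}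
    (hq : LipschitzWith κ q) : LipschitzWith 1 (((κ : ℝ)⁻¹) • q) := by
  refine LipschitzWith.of_dist_le_mul fun x y => ?_
  have h := hq.dist_le_mul x y
  have hκ' : (0 : ℝ) < κ := by exact_mod_cast hκ
  rw [Pi.smul_apply, Pi.smul_apply, dist_smul₀, norm_inv, Real.norm_of_nonneg hκ'.le,
    NNReal.coe_one, one_mul, inv_mul_le_iff₀ hκ']
  exact h

lemma det_fderivWithin_cube {d : ℕ} {π : Euc d → Euc d} {q : Fin d → Euc d → ℝ} {x : Euc d}
    (hx : x ∈ interior (cube d)) (hq : ∀ l, DifferentiableAt ℝ (q l) x)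
    (h : ∀ l, ∀ y ∈ cube d, π y l = q l y) :
    (fderivWithin ℝ π (cube d) x).det = jac q x := by
  have hnhds : cube d ∈ nhds x := mem_interior_iff_mem_nhds.1 hx
  have hQ : DifferentiableAt ℝ (fun y => WithLp.toLp 2 fun l => q l y : Euc d → Euc d) x := by
    rw [differentiableAt_euclidean]
    exact hq
  have heq : π =ᶠ[nhds x] fun y => WithLp.toLp 2 fun l => q l y := by
    filter_upwards [hnhds] with y hy
    ext l
    exact h l y hy
  rw [fderivWithin_of_mem_nhds hnhds, heq.fderiv_eq, det_fderiv_eq_jac hQ]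

/-- Extend `f` and the components of `π` to the whole space and divide by their constants. As `u`
vanishes off the interior, neither the extension nor the behaviour of `fderivWithin` at the boundary
matters. -/
lemma abs_integral_mul_jacTerm_le {d : ℕ} {u : Euc d → ℝ} {η : ℝ}
    (hu : ∀ x, x ∉ interior (cube d) → u x = 0)
    (hη : ∀ (f : Euc d → ℝ) (p : Fin d → Euc d → ℝ), LipschitzWith 1 f →
      (∀ x ∈ cube d, |f x| ≤ 1) → (∀ l, LipschitzWith 1 (p l)) →
      |∫ x, u x * f x * jac p x| ≤ η)
    {f : Euc d → ℝ} {π : Euc d → Euc d} {r : ℝ≥0} {κ : Fin d → ℝ≥0} (hr : 0 < r)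
    (hκ : ∀ l, 0 < κ l) (hf : LipschitzOnWith r f (cube d)) (hfr : ∀ x ∈ cube d, |f x| ≤ r)
    (hπ : ∀ l, LipschitzOnWith (κ l) (fun x => π x l) (cube d)) :
    |∫ x, u x * jacTerm f π x ∂(cubeMeasure d)| ≤ η * (r * ∏ l, (κ l : ℝ)) := by
  obtain ⟨f', hf', hff'⟩ := hf.extend_real
  choose q hq hπq using fun l => (hπ l).extend_real
  have hr' : (0 : ℝ) < r := by exact_mod_cast hr
  have hκ' : ∀ l, (0 : ℝ) < κ l := fun l => by exact_mod_cast hκ l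
  have h1 := hη ((r : ℝ)⁻¹ • f') (fun l => ((κ l : ℝ)⁻¹) • q l) (lipschitzWith_inv_smul hr hf')
    (fun x hx => by
      rw [Pi.smul_apply, smul_eq_mul, abs_mul, abs_inv, abs_of_pos hr', ← hff' hx,
        inv_mul_le_iff₀ hr', mul_one]
      exact hfr x hx) fun l => lipschitzWith_inv_smul (hκ l) (hq l)
  have hset : ∫ x, u x * jacTerm f π x ∂(cubeMeasure d) = ∫ x, u x * jacTerm f π x :=
    setIntegral_eq_integral_of_forall_compl_eq_zero fun x hx => by
      rw [hu x fun h => hx (interior_subset h), zero_mul]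
  have hae : ∀ᵐ x, u x * jacTerm f π x = (r * ∏ l, (κ l : ℝ)) *
      (u x * ((r : ℝ)⁻¹ • f') x * jac (fun l => ((κ l : ℝ)⁻¹) • q l) x) := by
    have hdiff : ∀ᵐ x, ∀ l, DifferentiableAt ℝ (q l) x :=
      ae_all_iff.2 fun l => (hq l).ae_differentiableAt
    filter_upwards [hdiff] with x hx
    by_cases hxi : x ∈ interior (cube d)
    · rw [jacTerm, det_fderivWithin_cube hxi hx fun l y hy => hπq l hy, jac_smul,
        hff' (interior_subset hxi), Pi.smul_apply, smul_eq_mul, Finset.prod_inv_distrib]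
      have : ∏ l, (κ l : ℝ) ≠ 0 := (Finset.prod_pos fun l _ => hκ' l).ne'
      field_simp
    · rw [hu x hxi]
      ring
  have hP : 0 ≤ r * ∏ l, (κ l : ℝ) := by positivity
  rw [hset, integral_congr_ae hae, integral_const_mul, abs_mul, abs_of_nonneg hP, mul_comm]
  exact mul_le_mul_of_nonneg_right h1 hP

section

variable {d : ℕ} {f : Euc d → ℝ}

lemma lip_ne_top (hf : IsLip f) : lip f ≠ ∞ := by
  obtain ⟨K, hK⟩ := hf
  exact ne_top_of_le_ne_top ENNReal.coe_ne_top (iInf₂_le K hK)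

/-- The least Lipschitz constant is a Lipschitz constant. -/
lemma lipschitzOnWith_lip (hf : IsLip f) : LipschitzOnWith (lip f).toNNReal f (cube d) := by
  intro x hx y hy
  rw [ENNReal.coe_toNNReal (lip_ne_top hf)]
  rcases eq_or_ne x y with rfl | hxy
  · simp
  · have h0 : edist x y ≠ 0 := fun h => hxy (edist_eq_zero.1 h)
    rw [← ENNReal.div_le_iff h0 (edist_ne_top x y)]
    exact le_iInf₂ fun K hK => (ENNReal.div_le_iff h0 (edist_ne_top x y)).2 (hK hx hy)

lemma supNorm_ne_top (hf : IsLip f) : supNorm f ≠ ∞ := by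
  obtain ⟨K, hK⟩ := hf
  obtain ⟨g, hg, hfg⟩ := hK.extend_real
  obtain ⟨C, hC⟩ := (isCompact_closedBall (0 : Euc d) (d + 1)).exists_bound_of_continuousOn
    hg.continuous.continuousOn
  refine ne_top_of_le_ne_top (b := ENNReal.ofReal C) ENNReal.ofReal_ne_top
    (iSup₂_le fun x hx => ?_)
  rw [hfg hx, ← ofReal_norm]
  refine ENNReal.ofReal_le_ofReal (hC x ?_)
  by_contra h
  exact notMem_cube_of_notMem_closedBall h hx

lemma abs_le_supNorm (hf : IsLip f) {x : Euc d} (hx : x ∈ cube d) :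
    |f x| ≤ (supNorm f).toNNReal := by
  have h : ‖f x‖ₑ ≤ supNorm f := le_iSup₂ (f := fun x (_ : x ∈ cube d) => ‖f x‖ₑ) x hx
  have := ENNReal.toReal_mono (supNorm_ne_top hf) h
  rwa [toReal_enorm, Real.norm_eq_abs] at this

end

lemma abs_integral_mul_jacTerm_le_lip {d : ℕ} {u : Euc d → ℝ} {η : ℝ}
    (hu : ∀ x, x ∉ interior (cube d) → u x = 0)
    (hη : ∀ (f : Euc d → ℝ) (p : Fin d → Euc d → ℝ), LipschitzWith 1 f →
      (∀ x ∈ cube d, |f x| ≤ 1) → (∀ l, LipschitzWith 1 (p l)) →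
      |∫ x, u x * f x * jac p x| ≤ η)
    {f : Euc d → ℝ} {π : Euc d → Euc d} (hf : IsLip f) (hπ : ∀ l, IsLip fun x => π x l) :
    |∫ x, u x * jacTerm f π x ∂(cubeMeasure d)| ≤
      η * (max (supNorm f) (lip f) * ∏ l, lip fun x => π x l).toReal := by
  set r : ℝ≥0 := max (supNorm f).toNNReal (lip f).toNNReal with hr
  set κ : Fin d → ℝ≥0 := fun l => (lip fun x => π x l).toNNReal with hκ
  have hval : (max (supNorm f) (lip f) * ∏ l, lip fun x => π x l).toReal =
      r * ∏ l, (κ l : ℝ) := by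
    rw [ENNReal.toReal_mul, ENNReal.toReal_max (supNorm_ne_top hf) (lip_ne_top hf),
      ENNReal.toReal_prod]
    rfl
  rw [hval]
  -- The normalization divides by the constants, which may be zero; they are raised by `δ`, and then
  -- `δ` tends to zero.
  have hbound : ∀ δ : ℝ≥0, 0 < δ → |∫ x, u x * jacTerm f π x ∂(cubeMeasure d)| ≤
      η * ((r + δ : ℝ≥0) * ∏ l, ((κ l + δ : ℝ≥0) : ℝ)) := by
    intro δ hδ
    refine abs_integral_mul_jacTerm_le hu hη (by positivity) (fun l => by positivity)
      ((lipschitzOnWith_lip hf).weaken (le_add_right (le_max_right _ _))) (fun x hx => ?_)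
      fun l => (lipschitzOnWith_lip (hπ l)).weaken (le_add_right le_rfl)
    refine (abs_le_supNorm hf hx).trans (NNReal.coe_le_coe.2 (le_add_right (le_max_left _ _)))
  have hcont : Continuous fun δ : ℝ≥0 => η * ((r + δ : ℝ≥0) * ∏ l, ((κ l + δ : ℝ≥0) : ℝ)) := by
    fun_prop
  have ht := (hcont.tendsto 0).mono_left (nhdsWithin_le_nhds (s := Set.Ioi (0 : ℝ≥0)))
  simp only [add_zero] at ht
  exact ge_of_tendsto ht (Filter.eventually_of_mem self_mem_nhdsWithin hbound)

/-! ### The weak* topology and the conclusion. -/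

instance isFiniteMeasure_cubeMeasure (d : ℕ) : IsFiniteMeasure (cubeMeasure d) := by
  refine isFiniteMeasure_restrict.2 (ne_top_of_le_ne_top
    (measure_closedBall_lt_top (x := (0 : Euc d)) (r := d + 1)).ne (measure_mono fun x hx => ?_))
  by_contra h
  exact notMem_cube_of_notMem_closedBall h hx

/-- The pairing of `u ∈ L^1` with `L^∞`. -/
def pairingCLM {d : ℕ} (u : Lp ℝ 1 (cubeMeasure d)) : Linf d →L[ℝ] ℝ :=
  (ContinuousLinearMap.mul ℝ ℝ).lpPairing (cubeMeasure d) 1 ∞ u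

lemma pairingCLM_apply {d : ℕ} (u : Lp ℝ 1 (cubeMeasure d)) (ρ : Linf d) :
    pairingCLM u ρ = ∫ x, u x * ρ x ∂(cubeMeasure d) := by
  rw [pairingCLM, ContinuousLinearMap.lpPairing_eq_integral]
  rfl

/-- Weak* open sets are norm open, so small norm perturbations of a weak* interior point remain in
the interior. -/
lemma norm_le_weakStar (d : ℕ) :
    (inferInstance : TopologicalSpace (Linf d)) ≤ weakStar d := by
  refine le_iInf fun u => continuous_iff_le_induced.1 ?_
  simp only [← pairingCLM_apply]
  exact (pairingCLM u).continuous

open scoped Topology in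
lemma continuous_weakStar_pairingCLM {d : ℕ} (u : Lp ℝ 1 (cubeMeasure d)) :
    Continuous[weakStar d, inferInstance] (pairingCLM u) := by
  have h : (pairingCLM u : Linf d → ℝ) = fun ρ => ∫ x, u x * ρ x ∂(cubeMeasure d) :=
    funext (pairingCLM_apply u)
  rw [h]
  exact continuous_iInf_dom (i := u) continuous_induced_dom

lemma abs_pairingCLM_le {d : ℕ} {u : Euc d → ℝ} {η S : ℝ} (hS : 0 ≤ S) (hη0 : 0 ≤ η)
    (hu : ∀ x, x ∉ interior (cube d) → u x = 0)
    (hη : ∀ (f : Euc d → ℝ) (p : Fin d → Euc d → ℝ), LipschitzWith 1 f →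
      (∀ x ∈ cube d, |f x| ≤ 1) → (∀ l, LipschitzWith 1 (p l)) →
      |∫ x, u x * f x * jac p x| ≤ η)
    {v : Lp ℝ 1 (cubeMeasure d)} (hv : v =ᵐ[cubeMeasure d] u) {ρ : Linf d}
    (hρ : ρ ∈ jacSums d S) : |pairingCLM v ρ| ≤ η * S := by
  obtain ⟨f, π, hf, hπ, hsum, g, hg, -, hgρ⟩ := hρ
  set a : ℕ → ℝ≥0∞ := fun i => max (supNorm (f i)) (lip (f i)) * ∏ j, lip fun x => π i x j
  have htop : ∑' i, a i ≠ ∞ := ne_top_of_le_ne_top ENNReal.ofReal_ne_top hsum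
  have hterm : ∀ i, ‖pairingCLM v (g i)‖ ≤ η * (a i).toReal := by
    intro i
    have h : ∫ x, v x * g i x ∂(cubeMeasure d) =
        ∫ x, u x * jacTerm (f i) (π i) x ∂(cubeMeasure d) := by
      refine integral_congr_ae ?_
      filter_upwards [hv, hg i] with x h1 h2
      rw [h1, h2]
    rw [pairingCLM_apply, h, Real.norm_eq_abs]
    exact abs_integral_mul_jacTerm_le_lip hu hη (hf i) (hπ i)
  have h1 : HasSum (fun i => pairingCLM v (g i)) (pairingCLM v ρ) := (pairingCLM v).hasSum hgρ
  have h2 := tsum_of_norm_bounded ((ENNReal.summable_toReal htop).hasSum.mul_left η) hterm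
  rw [h1.tsum_eq, Real.norm_eq_abs] at h2
  refine h2.trans (mul_le_mul_of_nonneg_left ?_ hη0)
  rw [← ENNReal.tsum_toReal_eq fun i => ENNReal.ne_top_of_tsum_ne_top htop i]
  exact (ENNReal.toReal_mono ENNReal.ofReal_ne_top hsum).trans_eq (ENNReal.toReal_ofReal hS)

lemma exists_pairingCLM {d : ℕ} (hd : 2 ≤ d) {S : ℝ} (hS : 0 ≤ S) {ε : ℝ} (hε : 0 < ε) :
    ∃ (v : Lp ℝ 1 (cubeMeasure d)) (g : Linf d), ‖g‖ ≤ 1 ∧ 0 < pairingCLM v g ∧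
      ∀ ρ ∈ jacSums d S, |pairingCLM v ρ| ≤ ε * pairingCLM v g := by
  -- The bound for normalized terms is multiplied by `S` on the sums; dividing by `S + 1` also
  -- covers `S = 0`.
  obtain ⟨u, g, C, hum, hgm, huC, hu0, hg1, hpos, hη⟩ :=
    exists_almost_orthogonal hd (show 0 < ε / (S + 1) by positivity)
  have hu : Integrable u (cubeMeasure d) :=
    Integrable.of_bound hum.aestronglyMeasurable C (Filter.Eventually.of_forall huC)
  have hg : MemLp g ∞ (cubeMeasure d) :=
    memLp_top_of_bound hgm.aestronglyMeasurable 1 (Filter.Eventually.of_forall hg1)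
  have hval : pairingCLM (hu.toL1 u) (hg.toLp g) = ∫ x, u x * g x := by
    have h1 : ∫ x, u x * g x ∂(cubeMeasure d) = ∫ x, u x * g x :=
      setIntegral_eq_integral_of_forall_compl_eq_zero fun x hx => by
        rw [hu0 x fun h => hx (interior_subset h), zero_mul]
    rw [pairingCLM_apply, ← h1]
    refine integral_congr_ae ?_
    filter_upwards [hu.coeFn_toL1, hg.coeFn_toLp] with x h1 h2
    rw [h1, h2]
  refine ⟨hu.toL1 u, hg.toLp g, ?_, hval ▸ hpos, fun ρ hρ => ?_⟩
  · have hb : ∀ᵐ x ∂(cubeMeasure d), ‖hg.toLp g x‖ ≤ 1 := by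
      filter_upwards [hg.coeFn_toLp] with x hx
      rw [hx]
      exact hg1 x
    simpa using Lp.norm_le_of_ae_bound zero_le_one hb
  · rw [hval]
    refine (abs_pairingCLM_le hS (by positivity) hu0 hη hu.coeFn_toL1 hρ).trans ?_
    have : ε / (S + 1) * S ≤ ε := by
      rw [div_mul_eq_mul_div, div_le_iff₀ (by positivity)]
      nlinarith
    calc ε / (S + 1) * (∫ x, u x * g x) * S = ε / (S + 1) * S * ∫ x, u x * g x := by ring
      _ ≤ _ := by gcongr

open scoped Topology in
/-- A subset of the unit ball on which suitable functionals are much smaller than their suprema on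
the ball is nowhere dense for a topology that is coarser than the norm topology and for which these
functionals are continuous. -/
lemma isNowhereDense_of_functionals {E : Type*} [NormedAddCommGroup E] [NormedSpace ℝ E]
    {t : TopologicalSpace (Metric.closedBall (0 : E) 1)}
    (ht : TopologicalSpace.induced Subtype.val UniformSpace.toTopologicalSpace ≤ t)
    {s : Set (Metric.closedBall (0 : E) 1)}
    (h : ∀ ε : ℝ, 0 < ε → ∃ (φ : E →L[ℝ] ℝ) (g : E),
      Continuous[t, inferInstance] (fun b : Metric.closedBall (0 : E) 1 => φ b) ∧ ‖g‖ ≤ 1 ∧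
      0 < φ g ∧ ∀ b ∈ s, |φ b| ≤ ε * φ g) : @IsNowhereDense _ t s := by
  rw [IsNowhereDense, Set.eq_empty_iff_forall_notMem]
  intro b hb
  have hopen := ht _ (@isOpen_interior _ t (@closure _ t s))
  obtain ⟨δ, hδ, hball⟩ := Metric.isOpen_iff.1 hopen b hb
  set τ : ℝ := min 1 (δ / 3) with hτ
  have hτ0 : 0 < τ := by positivity
  have hτ1 : τ ≤ 1 := min_le_left _ _
  have hτδ : τ ≤ δ / 3 := min_le_right _ _
  -- At `b` moved by the fraction `τ` towards `g`, the functional is at least `τ * φ g - (1 - τ) *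
  -- (τ / 4) * φ g`, which exceeds the bound `τ / 4 * φ g` valid on the closure.
  obtain ⟨φ, g, hφ, hg, hφg, hs⟩ := h (τ / 4) (by positivity)
  have hcl : ∀ b' ∈ @interior _ t (@closure _ t s), |φ b'| ≤ τ / 4 * φ g := by
    have hclosed : @IsClosed _ t
        ((fun b : Metric.closedBall (0 : E) 1 => φ b) ⁻¹' {y | |y| ≤ τ / 4 * φ g}) :=
      @IsClosed.preimage _ _ t _ _ hφ _ (isClosed_le continuous_abs continuous_const)
    have hsub : s ⊆ (fun b : Metric.closedBall (0 : E) 1 => φ b) ⁻¹' {y | |y| ≤ τ / 4 * φ g} := hs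
    exact fun b' hb' => @closure_minimal _ t _ _ hsub hclosed _ (@interior_subset _ t _ b' hb')
  have hb1 : ‖(b : E)‖ ≤ 1 := mem_closedBall_zero_iff.1 b.2
  have hmem : (1 - τ) • (b : E) + τ • g ∈ Metric.closedBall (0 : E) 1 :=
    convex_closedBall (0 : E) 1 b.2 (mem_closedBall_zero_iff.2 hg) (by linarith) hτ0.le (by ring)
  have hdist : dist (⟨_, hmem⟩ : Metric.closedBall (0 : E) 1) b < δ := by
    rw [Subtype.dist_eq, dist_eq_norm]
    have : (1 - τ) • (b : E) + τ • g - b = τ • (g - b) := by module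
    rw [this, norm_smul, Real.norm_of_nonneg hτ0.le]
    have h2 := norm_sub_le g (b : E)
    nlinarith
  have e1 := abs_le.1 (hcl _ (hball hdist))
  have e2 := abs_le.1 (hcl b hb)
  simp only [map_add, map_smul, smul_eq_mul] at e1
  nlinarith [mul_pos hτ0 hφg]

end LipJac

end

theorem theorem5 (d : ℕ) (hd : 2 ≤ d) (S : ℝ) (hS : 0 ≤ S) :
    @IsNowhereDense (Metric.closedBall (0 : LipJac.Linf d) 1)
      (TopologicalSpace.induced Subtype.val (LipJac.weakStar d))
      (Subtype.val ⁻¹' LipJac.jacSums d S) := by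
  refine LipJac.isNowhereDense_of_functionals (induced_mono (LipJac.norm_le_weakStar d))
    fun ε hε => ?_
  obtain ⟨v, g, hg, hpos, hle⟩ := LipJac.exists_pairingCLM hd hS hε
  refine ⟨LipJac.pairingCLM v, g, ?_, hg, hpos, fun b hb => hle b hb⟩
  exact @Continuous.comp _ _ _ (TopologicalSpace.induced Subtype.val (LipJac.weakStar d))
    (LipJac.weakStar d) _ _ _ (LipJac.continuous_weakStar_pairingCLM v) continuous_induced_dom
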